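/- Varieties are complex algebraic varieties. Let $K_0(\mathrm{Var})$ be their Grothendieck group, let $\mathbb L=\mathbb A^1$ and $\mathbb L^0=\mathrm{pt}$, let $\mathcal N$ be the localization of $K_0(\mathrm{Var})$ at the powers of $\mathbb L$, let $F^k\mathcal N$ be the subgroup generated by the $[X]/\mathbb L^i$ with $i-\dim X\ge k$, and let $\overline{\mathcal N}$ be the image of $\mathcal N$ in $\varprojlim_k \mathcal N/F^k\mathcal N$. A *motivic invariant* is a group homomorphism $\overline{\mathcal N}[(\frac1{\mathbb L^i-1})_{i\ge1}]\to\mathbb Z$. A family $\phi=(\phi_{j,n})_{j,n\in\mathbb Z}$ of motivic invariants is *of type* $(a,b)\in\mathbb Z^2$ if $\phi_{j,n}(X\times\mathbb L^k)=\phi_{j-ak,\,n-bk}(X)$ for all $j,n\in\mathbb Z$, $k\ge 0$ and all varieties $X$; it is *bounded* if for every variety $X$ only finitely many $\phi_{j,n}(X)$ are nonzero. For a bounded family put $\phi(X;u,v)=\sum_{j,n}\phi_{j,n}(X)u^jv^n$. Let $\rho:Y\to X$ be a resolution of singularities of a normal irreducible variety with $K_Y=\rho^*K_X+\sum_{i\in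 I}a_iD_i$, where the $D_i$ $(i\in I)$ are the exceptional prime divisors of $\rho$ and $a_i\in\mathbb Q$. For $J\subset I$ put $D_J^0=\bigcap_{j\in J}D_j\setminus\bigcup_{i\in I\setminus J}D_i$ (with $D_\emptyset^0=Y\setminus\bigcup_{i\in I} D_i$). The stringy $\phi$-function of type $(a,b)$, computed by means of $\rho$, is $$\phi^{st}(X;u,v)=\sum_{J\subset I}\phi(D_J^0;u,v)\prod_{j\in J}\frac{u^av^b-1}{(u^av^b)^{a_j+1}-1},$$ and Batyrev's stringy $E$-function, computed by means of $\rho$, is $$E_{st}(X;u,v)=\sum_{J\subset I}E(D_J^0;u,v)\prod_{j\in J}\frac{uv-1}{(uv)^{a_j+1}-1},$$ where $E$ is the $E$-polynomial (Hodge--Deligne polynomial), i.e. the ring homomorphism $K_0(\mathrm{Var})\to\mathbb Z[u,v]$ with $E(Z;u,v)=\sum_{p,q}(-1)^{p+q}h^{p,q}(Z)u^pv^q$ for smooth proper $Z$. Both are rational functions in $u,v$ with rational exponents. **Lemma.** Let $X$ be a $\mathbb Q$-Gorenstein toric variety given by a finite fan $\Sigma$ of strongly convex rational polyhedral cones in $\mathbb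 R^d$, and let $\rho:X'\to X$ be the toric resolution given by a regular subdivision $\Sigma'$ of $\Sigma$. Let $\phi$ be a bounded family of motivic invariants of type $(a,b)\ne(0,0)$. Then, with $\phi^{st}$ and $E_{st}$ computed by means of $\rho$, the substitution $u\mapsto u^a$, $v\mapsto v^b$ is defined on $E_{st}(X;u,v)$ and $$\phi^{st}(X;u,v)=E_{st}(X;u^a,v^b)\cdot\phi(\mathbb L^0;u,v).$$ -/

import Mathlib

open AlgebraicGeometry CategoryTheory CategoryTheory.Limits TopologicalSpace

noncomputable section

namespace Stringy

/-! ### Complex algebraic varieties and their Grothendieck group -/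

/-- The scheme `Spec ℂ`. -/
abbrev SpecC : Scheme.{0} := Spec (CommRingCat.of ℂ)

/-- A complex algebraic variety: a reduced separated scheme of finite type over `ℂ`
(possibly reducible, possibly empty). -/
structure CVariety where
  X : Scheme.{0}
  str : X ⟶ SpecC
  isReduced : AlgebraicGeometry.IsReduced X
  isSeparated : IsSeparated str
  locallyOfFiniteType : LocallyOfFiniteType str
  quasiCompact : QuasiCompact str

namespace CVariety

instance (X : CVariety) : AlgebraicGeometry.IsReduced X.X := X.isReduced

instance (X : CVariety) : IsSeparated X.str := X.isSeparated

instance (X : CVariety) : LocallyOfFiniteType X.str := X.locallyOfFiniteType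

instance (X : CVariety) : QuasiCompact X.str := X.quasiCompact

instance (X : CVariety) : IsLocallyNoetherian X.X :=
  haveI : IsLocallyNoetherian SpecC := isLocallyNoetherian_Spec.mpr (inferInstanceAs
    (IsNoetherianRing ℂ))
  LocallyOfFiniteType.isLocallyNoetherian X.str

/-- The one-point variety `Spec ℂ = 𝕃⁰`. -/
def point : CVariety where
  X := SpecC
  str := 𝟙 SpecC
  isReduced := inferInstance
  isSeparated := inferInstance
  locallyOfFiniteType := inferInstance
  quasiCompact := inferInstance

/-- The product `X × 𝕃ᵏ` of a variety with affine `k`-space. -/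
def prodAffine (X : CVariety) (k : ℕ) : CVariety where
  X := 𝔸(Fin k; X.X)
  str := (𝔸(Fin k; X.X) ↘ X.X) ≫ X.str
  isReduced := inferInstance
  isSeparated := inferInstance
  locallyOfFiniteType := inferInstance
  quasiCompact := inferInstance

/-- The reduced closed subscheme on a closed subset is reduced. -/
theorem isReduced_subscheme (X : Scheme.{0}) (T : Closeds X) :
    AlgebraicGeometry.IsReduced (Scheme.IdealSheafData.vanishingIdeal T).subscheme := by
  have h : ∀ U : X.affineOpens, AlgebraicGeometry.IsReduced (Spec (CommRingCat.of
      (Γ(X, U.1) ⧸ (Scheme.IdealSheafData.vanishingIdeal T).ideal U))) := by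
    intro U
    have hr : ((Scheme.IdealSheafData.vanishingIdeal T).ideal U).IsRadical := by
      rw [Scheme.IdealSheafData.vanishingIdeal_ideal]
      exact PrimeSpectrum.isRadical_vanishingIdeal _
    have : _root_.IsReduced (Γ(X, U.1) ⧸ (Scheme.IdealSheafData.vanishingIdeal T).ideal U) :=
      (Ideal.isRadical_iff_quotient_reduced _).mp hr
    infer_instance
  have h' : ∀ i, AlgebraicGeometry.IsReduced
      ((Scheme.IdealSheafData.vanishingIdeal T).subschemeCover.openCover.X i) := h
  exact IsReduced.of_openCover _
    (Scheme.IdealSheafData.vanishingIdeal T).subschemeCover.openCover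

/-- The locally closed subvariety `T ∩ V` of `Y` (`T` closed, `V` open), with its reduced
structure. -/
def locallyClosed (Y : CVariety) (T : Closeds Y.X) (V : Y.X.Opens) : CVariety where
  X := (Scheme.IdealSheafData.vanishingIdeal (X := (V : Scheme.{0}))
    (T.preimage V.ι.continuous)).subscheme
  str := (Scheme.IdealSheafData.vanishingIdeal (X := (V : Scheme.{0}))
    (T.preimage V.ι.continuous)).subschemeι ≫ V.ι ≫ Y.str
  isReduced := isReduced_subscheme _ _
  isSeparated := inferInstance
  locallyOfFiniteType := inferInstance
  quasiCompact := inferInstance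

end CVariety

/-- The defining relations of the Grothendieck group: `[X] = [Y]` for isomorphic varieties and
`[X] = [Z] + [U]` for a closed subvariety `Z` with open complement `U`. -/
def scissorRelations : Set (FreeAbelianGroup CVariety) :=
  {r | ∃ (X Y : CVariety) (e : X.X ≅ Y.X), e.hom ≫ Y.str = X.str ∧
      r = FreeAbelianGroup.of X - FreeAbelianGroup.of Y} ∪
  {r | ∃ (X Z U : CVariety) (i : Z.X ⟶ X.X) (j : U.X ⟶ X.X),
      IsClosedImmersion i ∧ IsOpenImmersion j ∧ i ≫ X.str = Z.str ∧ j ≫ X.str = U.str ∧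
      Set.range j = (Set.range i)ᶜ ∧
      r = FreeAbelianGroup.of X - FreeAbelianGroup.of Z - FreeAbelianGroup.of U}

/-- The Grothendieck group `K₀(Var)` of complex algebraic varieties. -/
abbrev K0 : Type 1 := FreeAbelianGroup CVariety ⧸ AddSubgroup.closure scissorRelations

/-- The class `[X] ∈ K₀(Var)`. -/
def K0.of (X : CVariety) : K0 := QuotientAddGroup.mk (FreeAbelianGroup.of X)

/-- Multiplication by the class of the affine line, `[X] ↦ [X × 𝕃]`. -/
def lefschetz : K0 →+ K0 :=
  QuotientAddGroup.lift _ (FreeAbelianGroup.lift fun X => K0.of (X.prodAffine 1)) <| by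
    rw [AddSubgroup.closure_le]
    rintro r (⟨X, Y, e, he, rfl⟩ | ⟨X, Z, U, i, j, hi, hj, hi', hj', hij, rfl⟩)
    · have hA : IsIso (AffineSpace.map (Fin 1) e.hom) :=
        ⟨AffineSpace.map (Fin 1) e.inv, by simp [← AffineSpace.map_comp],
          by simp [← AffineSpace.map_comp]⟩
      have hs : AffineSpace.map (Fin 1) e.hom ≫ (𝔸(Fin 1; Y.X) ↘ Y.X) ≫ Y.str =
          (𝔸(Fin 1; X.X) ↘ X.X) ≫ X.str := by
        rw [AffineSpace.map_over_assoc, he]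
      simp only [SetLike.mem_coe, AddMonoidHom.mem_ker, map_sub, FreeAbelianGroup.lift_apply_of]
      change (QuotientAddGroup.mk _ : K0) - QuotientAddGroup.mk _ = 0
      rw [← QuotientAddGroup.mk_sub, QuotientAddGroup.eq_zero_iff]
      refine AddSubgroup.subset_closure (Or.inl ⟨X.prodAffine 1, Y.prodAffine 1,
        @asIso _ _ _ _ (AffineSpace.map (Fin 1) e.hom) hA, hs, rfl⟩)
    · simp only [SetLike.mem_coe, AddMonoidHom.mem_ker, map_sub, FreeAbelianGroup.lift_apply_of]
      change (QuotientAddGroup.mk _ : K0) - QuotientAddGroup.mk _ - QuotientAddGroup.mk _ = 0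
      rw [← QuotientAddGroup.mk_sub, ← QuotientAddGroup.mk_sub, QuotientAddGroup.eq_zero_iff]
      have hpi := AffineSpace.isPullback_map (n := Fin 1) i
      have hpj := AffineSpace.isPullback_map (n := Fin 1) j
      refine AddSubgroup.subset_closure (Or.inr ⟨X.prodAffine 1, Z.prodAffine 1, U.prodAffine 1,
        AffineSpace.map (Fin 1) i, AffineSpace.map (Fin 1) j,
        MorphismProperty.of_isPullback (P := @IsClosedImmersion) hpi.flip hi,
        MorphismProperty.of_isPullback (P := @IsOpenImmersion) hpj.flip hj, ?_, ?_, ?_, rfl⟩)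
      · simp [CVariety.prodAffine, AffineSpace.map_over_assoc, hi']
      · simp [CVariety.prodAffine, AffineSpace.map_over_assoc, hj']
      · have h1 : Set.range (AffineSpace.map (Fin 1) i) =
            (𝔸(Fin 1; X.X) ↘ X.X) ⁻¹' Set.range i := by
          have h := Scheme.image_preimage_eq_of_isPullback hpi.flip Set.univ
          simpa only [Set.preimage_univ, Set.image_univ] using h
        have h2 : Set.range (AffineSpace.map (Fin 1) j) =
            (𝔸(Fin 1; X.X) ↘ X.X) ⁻¹' Set.range j := by
          have h := Scheme.image_preimage_eq_of_isPullback hpj.flip Set.univ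
          simpa only [Set.preimage_univ, Set.image_univ] using h
        have h3 : Set.range (AffineSpace.map (Fin 1) j) =
            (Set.range (AffineSpace.map (Fin 1) i))ᶜ := by
          rw [h2, hij, Set.preimage_compl, ← h1]
        exact h3

/-! ### The localized and completed Grothendieck groups -/

/-- `K₀(Var)` as a module over `𝓛 = ℤ[𝕃]`, the variable acting by `[X] ↦ [X × 𝕃]`. -/
abbrev K0Mod : Type 1 := Module.AEval' lefschetz.toIntLinearMap

/-- The localization `𝒩 = S⁻¹K₀(Var)` at `S = {𝕃ⁱ}`. -/
abbrev NLoc : Type 1 :=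
  LocalizedModule (Submonoid.powers (Polynomial.X : Polynomial ℤ)) K0Mod

/-- The element `[X]/𝕃ⁱ` of `𝒩`. -/
def NLoc.frac (X : CVariety) (i : ℕ) : NLoc :=
  LocalizedModule.mk (Module.AEval'.of lefschetz.toIntLinearMap (K0.of X))
    ⟨Polynomial.X ^ i, i, rfl⟩

/-- The subgroup `Fᵏ𝒩` generated by the `[X]/𝕃ⁱ` with `i - dim X ≥ k`. -/
def NLoc.filtration (k : ℤ) : AddSubgroup NLoc :=
  AddSubgroup.closure {x | ∃ (X : CVariety) (i n : ℕ),
    topologicalKrullDim X.X ≤ (n : WithBot ℕ∞) ∧ k ≤ (i : ℤ) - n ∧ x = NLoc.frac X i}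

theorem NLoc.filtration_anti {k l : ℤ} (h : k ≤ l) :
    NLoc.filtration l ≤ NLoc.filtration k :=
  AddSubgroup.closure_mono fun _ ⟨X, i, n, hn, hi, hx⟩ => ⟨X, i, n, hn, h.trans hi, hx⟩

theorem NLoc.X_smul_frac (X : CVariety) (i : ℕ) :
    (Polynomial.X : Polynomial ℤ) • NLoc.frac X (i + 1) = NLoc.frac X i := by
  rw [NLoc.frac, NLoc.frac, LocalizedModule.smul'_mk, LocalizedModule.mk_eq]
  refine ⟨1, ?_⟩
  rw [one_smul, one_smul, Submonoid.smul_def, Submonoid.smul_def, smul_smul]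
  change (Polynomial.X ^ i * Polynomial.X : Polynomial ℤ) • _ =
    (Polynomial.X ^ (i + 1) : Polynomial ℤ) • _
  rw [pow_succ]

theorem NLoc.X_smul_mem (k : ℤ) (hk : 0 ≤ k) {x : NLoc} (hx : x ∈ NLoc.filtration (k + 1)) :
    (Polynomial.X : Polynomial ℤ) • x ∈ NLoc.filtration k := by
  induction hx using AddSubgroup.closure_induction with
  | mem x h =>
    obtain ⟨X, i, n, hn, hi, rfl⟩ := h
    obtain ⟨j, rfl⟩ : ∃ j, i = j + 1 := ⟨i - 1, by omega⟩
    rw [NLoc.X_smul_frac]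
    exact AddSubgroup.subset_closure ⟨X, j, n, hn, by push_cast at hi; omega, rfl⟩
  | zero => simp
  | add x y _ _ hx hy => rw [smul_add]; exact add_mem hx hy
  | neg x _ hx => rw [smul_neg]; exact neg_mem hx

/-- The kernel `⋂ₖ Fᵏ𝒩` of the canonical map from `𝒩` to its completion `lim 𝒩/Fᵏ𝒩`. -/
def NLoc.completionKer : Submodule (Polynomial ℤ) NLoc where
  carrier := {x | ∀ k : ℤ, x ∈ NLoc.filtration k}
  add_mem' hx hy k := add_mem (hx k) (hy k)
  zero_mem' k := zero_mem _
  smul_mem' p x hx := by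
    induction p using Polynomial.induction_on' with
    | add p q hp hq => intro k; rw [add_smul]; exact add_mem (hp k) (hq k)
    | monomial n m =>
      have hX : ∀ y : NLoc, (∀ k : ℤ, y ∈ NLoc.filtration k) →
          ∀ k : ℤ, (Polynomial.X : Polynomial ℤ) • y ∈ NLoc.filtration k := fun y hy k =>
        NLoc.filtration_anti (le_max_left k 0)
          (NLoc.X_smul_mem _ (le_max_right k 0) (hy _))
      have hXn : ∀ k : ℤ, (Polynomial.X : Polynomial ℤ) ^ n • x ∈ NLoc.filtration k := by
        induction n with
        | zero => simpa using hx
        | succ n ih => intro k; rw [pow_succ', mul_smul]; exact hX _ ih k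
      intro k
      have : (Polynomial.monomial n m : Polynomial ℤ) • x =
          m • ((Polynomial.X : Polynomial ℤ) ^ n • x) := by
        rw [← Polynomial.C_mul_X_pow_eq_monomial, mul_smul]
        rw [show (Polynomial.C m : Polynomial ℤ) = (m : Polynomial ℤ) by simp]
        exact Int.cast_smul_eq_zsmul (Polynomial ℤ) m ((Polynomial.X : Polynomial ℤ) ^ n • x)
      rw [this]
      exact zsmul_mem (hXn k) m

/-- The image `𝒩̄` of `𝒩` in its completion, as the quotient by the kernel. -/
abbrev NBar : Type 1 := NLoc ⧸ NLoc.completionKer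

/-- The group `𝒩̄[(1/(𝕃ⁱ - 1))_{i ≥ 1}]`. -/
abbrev MotivicGroup : Type 1 :=
  LocalizedModule
    (Submonoid.closure {p : Polynomial ℤ | ∃ i : ℕ, 1 ≤ i ∧ p = Polynomial.X ^ i - 1}) NBar

/-- The class of a variety in `𝒩̄[(1/(𝕃ⁱ - 1))_{i ≥ 1}]`. -/
def motivicClass (X : CVariety) : MotivicGroup :=
  LocalizedModule.mkLinearMap _ NBar (Submodule.Quotient.mk (NLoc.frac X 0))

/-! ### Motivic invariants -/

/-- A motivic invariant: a group homomorphism `𝒩̄[(1/(𝕃ⁱ - 1))_{i ≥ 1}] → ℤ`. -/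
abbrev MotivicInvariant : Type 1 := MotivicGroup →+ ℤ

/-- The family `φ = (φ_{j,n})` is of type `(a, b)`:
`φ_{j,n}(X × 𝕃ᵏ) = φ_{j - ak, n - bk}(X)`. -/
def IsOfType (φ : ℤ → ℤ → MotivicInvariant) (a b : ℤ) : Prop :=
  ∀ (j n : ℤ) (X : CVariety) (k : ℕ),
    φ j n (motivicClass (X.prodAffine k)) = φ (j - a * k) (n - b * k) (motivicClass X)

/-- The family `φ` is bounded: for each variety `X`, `φ_{j,n}(X)` vanishes outside a bounded
set of indices `(j, n)`. -/
def IsBounded (φ : ℤ → ℤ → MotivicInvariant) : Prop :=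
  ∀ X : CVariety, ∃ B : ℤ, ∀ j n : ℤ, (B < |j| ∨ B < |n|) → φ j n (motivicClass X) = 0

/-! ### Rational functions with fractional exponents -/

/-- Polynomial expressions in `u, v` with rational exponents: the group ring of `ℚ × ℚ`, in
which `(p, q)` stands for `uᵖ v^q`. -/
abbrev Puiseux : Type := AddMonoidAlgebra ℤ (ℚ × ℚ)

/-- Rational functions in `u, v` with rational exponents. -/
abbrev PuiseuxFrac : Type := FractionRing Puiseux

/-- The monomial `uᵖ v^q`. -/
def monom (p q : ℚ) : Puiseux := AddMonoidAlgebra.single (p, q) 1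

/-- The substitution `u ↦ uᵃ`, `v ↦ v^b` on polynomial expressions. -/
def substPoly (a b : ℤ) : Puiseux →+* Puiseux :=
  AddMonoidAlgebra.mapDomainRingHom ℤ
    ((AddMonoidHom.mulLeft (a : ℚ)).prodMap (AddMonoidHom.mulLeft (b : ℚ)))

/-- The substitution `u ↦ uᵃ`, `v ↦ v^b` makes sense for the rational function `f`: some
denominator of `f` does not vanish under it. -/
def SubstDefined (a b : ℤ) (f : PuiseuxFrac) : Prop :=
  ∃ P Q : Puiseux, substPoly a b Q ≠ 0 ∧
    f = algebraMap Puiseux PuiseuxFrac P / algebraMap Puiseux PuiseuxFrac Q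

open Classical in
/-- The rational function `f(uᵃ, v^b)`, meaningful if `SubstDefined a b f`. -/
def subst (a b : ℤ) (f : PuiseuxFrac) : PuiseuxFrac :=
  if h : SubstDefined a b f then
    algebraMap Puiseux PuiseuxFrac (substPoly a b h.choose) /
      algebraMap Puiseux PuiseuxFrac (substPoly a b h.choose_spec.choose)
  else 0

/-- `subst` may be computed from any presentation with admissible denominator. -/
theorem subst_eq (a b : ℤ) (P Q : Puiseux) (hQ : substPoly a b Q ≠ 0) :
    subst a b (algebraMap Puiseux PuiseuxFrac P / algebraMap Puiseux PuiseuxFrac Q) =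
      algebraMap Puiseux PuiseuxFrac (substPoly a b P) /
        algebraMap Puiseux PuiseuxFrac (substPoly a b Q) := by
  have inj : Function.Injective (algebraMap Puiseux PuiseuxFrac) := IsFractionRing.injective _ _
  have nz : ∀ Q : Puiseux, substPoly a b Q ≠ 0 → Q ≠ 0 := by
    rintro _ h rfl
    exact h (map_zero _)
  have h : SubstDefined a b (algebraMap Puiseux PuiseuxFrac P / algebraMap Puiseux PuiseuxFrac Q) :=
    ⟨P, Q, hQ, rfl⟩
  rw [subst, dif_pos h]
  obtain ⟨h1, h2⟩ := h.choose_spec.choose_spec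
  generalize h.choose_spec.choose = Q' at h1 h2 ⊢
  generalize h.choose = P' at h2 ⊢
  have e0 : ∀ {R : Puiseux}, R ≠ 0 → algebraMap Puiseux PuiseuxFrac R ≠ 0 := fun hR h0 =>
    hR (inj (h0.trans (map_zero _).symm))
  rw [div_eq_div_iff (e0 (nz _ hQ)) (e0 (nz _ h1)), ← map_mul, ← map_mul] at h2
  have h3 := congrArg (substPoly a b) (inj h2)
  rw [map_mul, map_mul] at h3
  rw [div_eq_div_iff (e0 h1) (e0 hQ), ← map_mul (algebraMap Puiseux PuiseuxFrac),
    ← map_mul (algebraMap Puiseux PuiseuxFrac), h3]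

/-- `φ(X; u, v) = ∑ φ_{j,n}(X) uʲ vⁿ`. -/
def phiPoly (φ : ℤ → ℤ → MotivicInvariant) (X : CVariety) : Puiseux :=
  ∑ᶠ p : ℤ × ℤ, φ p.1 p.2 (motivicClass X) • monom (p.1 : ℚ) (p.2 : ℚ)

/-! ### Differential forms, Hodge numbers and the `E`-polynomial -/

/-- Pull-back of `p`-forms `⋀ᵖ Ω_{A/ℂ} → ⋀ᵖ Ω_{B/ℂ}` along `A → B`. -/
def formMap (A B : Type) [CommRing A] [CommRing B] [Algebra ℂ A] [Algebra ℂ B] [Algebra A B]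
    [IsScalarTower ℂ A B] (p : ℕ) : ⋀[A]^p Ω[A⁄ℂ] →ₗ[A] ⋀[B]^p Ω[B⁄ℂ] :=
  exteriorPower.alternatingMapLinearEquiv
    { toFun := fun v => exteriorPower.ιMulti B p fun i => KaehlerDifferential.map ℂ ℂ A B (v i)
      map_update_add' := by
        intro _ v i x y
        simp only [Function.apply_update (fun _ => KaehlerDifferential.map ℂ ℂ A B), map_add,
          AlternatingMap.map_update_add]
      map_update_smul' := by
        intro _ v i c x
        simp only [Function.apply_update (fun _ => KaehlerDifferential.map ℂ ℂ A B), map_smul]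
        rw [← algebraMap_smul B c, AlternatingMap.map_update_smul, algebraMap_smul]
      map_eq_zero_of_eq' := by
        intro v i j h hij
        exact AlternatingMap.map_eq_zero_of_eq _ _ (by rw [h]) hij }

namespace CVariety

/-- The `ℂ`-algebra structure on global sections. -/
def toGlobal (X : CVariety) : ℂ →+* Γ(X.X, ⊤) :=
  X.str.appTop.hom.comp (Scheme.ΓSpecIso (CommRingCat.of ℂ)).inv.hom

instance sectionsAlgebra (X : CVariety) (U : X.X.Opens) : Algebra ℂ Γ(X.X, U) :=
  ((X.X.presheaf.map (homOfLE le_top : U ⟶ ⊤).op).hom.comp X.toGlobal).toAlgebra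

instance stalkAlgebra (X : CVariety) (x : X.X) : Algebra ℂ (X.X.presheaf.stalk x) :=
  ((X.X.presheaf.germ ⊤ x trivial).hom.comp X.toGlobal).toAlgebra

instance (X : CVariety) [IrreducibleSpace X.X] (x : X.X) :
    IsScalarTower ℂ (X.X.presheaf.stalk x) X.X.functionField := by
  refine IsScalarTower.of_algebraMap_eq' ?_
  change (X.X.presheaf.germ ⊤ (genericPoint X.X) trivial).hom.comp X.toGlobal =
    (X.X.presheaf.stalkSpecializes _).hom.comp
      ((X.X.presheaf.germ ⊤ x trivial).hom.comp X.toGlobal)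
  rw [← RingHom.comp_assoc]
  refine congrArg (fun g => RingHom.comp g X.toGlobal) ?_
  exact congrArg CommRingCat.Hom.hom (TopCat.Presheaf.germ_stalkSpecializes X.X.presheaf
    (Opens.mem_top x) ((genericPoint_spec X.X).specializes trivial)).symm

/-- The `p`-forms on the open set `U` (the sections of the sheaf `Ωᵖ` if `U` is affine). -/
abbrev Forms (X : CVariety) (p : ℕ) (U : X.X.Opens) : Type :=
  ⋀[Γ(X.X, U)]^p Ω[Γ(X.X, U)⁄ℂ]

/-- Restriction of `p`-forms. -/
def restrictForms (X : CVariety) (p : ℕ) {U V : X.X.Opens} (h : V ≤ U) :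
    X.Forms p U →ₗ[ℂ] X.Forms p V :=
  letI : Algebra Γ(X.X, U) Γ(X.X, V) := (X.X.presheaf.map (homOfLE h).op).hom.toAlgebra
  haveI : IsScalarTower ℂ Γ(X.X, U) Γ(X.X, V) := IsScalarTower.of_algebraMap_eq' <| by
    change (X.X.presheaf.map (homOfLE le_top : V ⟶ ⊤).op).hom.comp X.toGlobal =
      (X.X.presheaf.map (homOfLE h).op).hom.comp
        ((X.X.presheaf.map (homOfLE le_top : U ⟶ ⊤).op).hom.comp X.toGlobal)
    rw [← RingHom.comp_assoc, ← CommRingCat.hom_comp, ← Functor.map_comp]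
    rfl
  (formMap Γ(X.X, U) Γ(X.X, V) p).restrictScalars ℂ

variable (X : CVariety) {n : ℕ} (U : Fin n → X.X.Opens)

/-- The intersection `U_{s 0} ∩ ⋯ ∩ U_{s q}`. -/
def cechOpen {q : ℕ} (s : Fin (q + 1) → Fin n) : X.X.Opens :=
  Finset.univ.inf fun k => U (s k)

theorem cechOpen_le {q : ℕ} (s : Fin (q + 2) → Fin n) (j : Fin (q + 2)) :
    X.cechOpen U s ≤ X.cechOpen U (s ∘ j.succAbove) :=
  Finset.le_inf fun k _ =>
    Finset.inf_le (f := fun k => U (s k)) (Finset.mem_univ (j.succAbove k))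

/-- The Čech `q`-cochains of the sheaf `Ωᵖ` for the cover `U`. -/
abbrev CechCochains (p q : ℕ) : Type :=
  ∀ s : Fin (q + 1) → Fin n, X.Forms p (X.cechOpen U s)

/-- The Čech differential. -/
def cechD (p q : ℕ) : X.CechCochains U p q →ₗ[ℂ] X.CechCochains U p (q + 1) :=
  LinearMap.pi fun s => ∑ j : Fin (q + 2),
    (-1 : ℂ) ^ (j : ℕ) • (X.restrictForms p (X.cechOpen_le U s j) ∘ₗ
      LinearMap.proj (s ∘ j.succAbove))

/-- The Čech coboundaries. -/
def cechBoundaries (p : ℕ) : ∀ q : ℕ, Submodule ℂ (X.CechCochains U p q)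
  | 0 => ⊥
  | q + 1 => LinearMap.range (X.cechD U p q)

/-- The dimension of `H^q(X, Ωᵖ)`, computed by the Čech complex of the cover `U`
(cocycles modulo coboundaries, as a subspace of cochains modulo coboundaries). For a finite
cover by affine open sets (`X` is separated) this is the Hodge number `h^{p,q}(X)` when `X` is
smooth and proper. -/
def hodgeNumber (p q : ℕ) : ℕ :=
  Module.finrank ℂ
    ((LinearMap.ker (X.cechD U p q)).map (X.cechBoundaries U p q).mkQ)

end CVariety

/-- `E` is the `E`-polynomial (Hodge-Deligne polynomial): the ring homomorphism
`K₀(Var) → ℤ[u, v]` with `E(X) = ∑ (-1)^{p+q} h^{p,q}(X) uᵖ v^q` for smooth proper `X`.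
It is unique, since smooth proper varieties generate `K₀(Var)`; on an arbitrary variety its
coefficients are the Euler characteristics `∑ₖ (-1)ᵏ h^{p,q}(H_cᵏ(X, ℂ))` of Deligne's mixed
Hodge structure. -/
structure IsEPolynomial (E : K0 →+ MvPolynomial (Fin 2) ℤ) : Prop where
  map_prod : ∀ (X Y P : CVariety) (f : P.X ⟶ X.X) (g : P.X ⟶ Y.X),
    IsPullback f g X.str Y.str → f ≫ X.str = P.str →
      E (K0.of P) = E (K0.of X) * E (K0.of Y)
  smooth_proper : ∀ X : CVariety, Smooth X.str → IsProper X.str →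
    ∀ (n : ℕ) (U : Fin n → X.X.Opens), (∀ i, IsAffineOpen (U i)) → ⨆ i, U i = ⊤ →
      ∀ p q : ℕ, (E (K0.of X)).coeff (Finsupp.single 0 p + Finsupp.single 1 q) =
        (-1) ^ (p + q) * (X.hodgeNumber U p q : ℤ)

/-- `E(X; u, v)` as an element of the ring of polynomial expressions in `u, v`. -/
def ePoly (E : K0 →+ MvPolynomial (Fin 2) ℤ) (X : CVariety) : Puiseux :=
  MvPolynomial.aeval ![monom 1 0, monom 0 1] (E (K0.of X))

/-! ### Exceptional divisors, discrepancies, stringy functions -/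

/-- `y` is the generic point of a prime divisor of `Y` that is exceptional for the proper
birational morphism `ρ : Y → X`: its image has codimension at least two. -/
def IsExceptionalPrime {X Y : CVariety} (ρ : Y.X ⟶ X.X) (y : Y.X) : Prop :=
  Order.coheight y = 1 ∧ 2 ≤ Order.coheight (ρ y)

/-- Rational differential forms of top degree on an integral variety. -/
abbrev TopForms (Y : CVariety) [AlgebraicGeometry.IsIntegral Y.X] : Type :=
  ⋀[Y.X.functionField]^(Module.finrank Y.X.functionField Ω[Y.X.functionField⁄ℂ])
    Ω[Y.X.functionField⁄ℂ]

/-- The rational top form `ω` has order `m` along the prime divisor with generic point `y`: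
`ω = t θ`, where `θ` generates the top forms over the local ring at `y` and `t` has order `m`. -/
def HasFormOrder (Y : CVariety) [AlgebraicGeometry.IsIntegral Y.X] (y : Y.X) (ω : TopForms Y)
    (m : ℤ) : Prop :=
  ∃ (θ : ⋀[Y.X.presheaf.stalk y]^(Module.finrank Y.X.functionField Ω[Y.X.functionField⁄ℂ])
      Ω[Y.X.presheaf.stalk y⁄ℂ]) (t : Y.X.functionField),
    Submodule.span (Y.X.presheaf.stalk y) {θ} = ⊤ ∧ t ≠ 0 ∧
      ω = t • formMap (Y.X.presheaf.stalk y) Y.X.functionField _ θ ∧ Scheme.ord t y = m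

open Classical in
/-- `K_Y = ρ^* K_X + ∑_{i ∈ I} a_i D_i` for the proper birational morphism `ρ : Y → X`, where `I`
is the set of generic points of the exceptional prime divisors `D_i`. That is: `Y` is integral and
for some `r ≥ 1` and some rational top form `ω ≠ 0`, the divisor of `ω` on `Y` (which represents
`K_Y`, and also `K_X` away from the exceptional divisors) is such that near each point `x` of `X`
there is a rational function `f` with `r div(ω) = div(f ∘ ρ) + r ∑ a_i D_i` over a neighbourhood
of `x`. In particular `r K_X` is a Cartier divisor, with local equations `f`. -/
def IsRelativeCanonical {X Y : CVariety} (ρ : Y.X ⟶ X.X) (I : Finset Y.X) (a : Y.X → ℚ) : Prop :=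
  ∃ (_ : AlgebraicGeometry.IsIntegral Y.X) (r : ℕ) (ω : TopForms Y), 0 < r ∧ ω ≠ 0 ∧
    ∀ x : X.X, ∃ f : Y.X.functionField, f ≠ 0 ∧
      ∀ y : Y.X, Order.coheight y = 1 → ρ y ⤳ x → ∃ m : ℤ, HasFormOrder Y y ω m ∧
        (r * m : ℚ) = Scheme.ord f y + r * (if y ∈ I then a y else 0)

open Classical in
/-- The stratum `D_J⁰ = (⋂_{j ∈ J} D_j) \ ⋃_{i ∈ I \ J} D_i` of `Y` (with `D_∅ = Y`). -/
def stratum (Y : CVariety) (I J : Finset Y.X) : CVariety :=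
  Y.locallyClosed (J.inf fun j => Closeds.closure {j})
    ((I \ J).sup fun i => Closeds.closure {i}).compl

/-- For a function `Φ` on varieties, the sum
`∑_{J ⊆ I} Φ(D_J⁰) ∏_{j ∈ J} (uᵅ vᵝ - 1) / ((uᵅ vᵝ)^{a_j + 1} - 1)`. -/
def stringySum (Φ : CVariety → Puiseux) (α β : ℤ) (Y : CVariety) (I : Finset Y.X)
    (a : Y.X → ℚ) : PuiseuxFrac :=
  ∑ J ∈ I.powerset, algebraMap Puiseux PuiseuxFrac (Φ (stratum Y I J)) *
    ∏ j ∈ J, algebraMap Puiseux PuiseuxFrac (monom α β - 1) /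
      algebraMap Puiseux PuiseuxFrac (monom (α * (a j + 1)) (β * (a j + 1)) - 1)

/-- The stringy `φ`-function of type `(a, b)`, computed on a resolution `Y` with exceptional
divisors `I` and discrepancies `disc`. -/
def stringyPhi (φ : ℤ → ℤ → MotivicInvariant) (a b : ℤ) (Y : CVariety) (I : Finset Y.X)
    (disc : Y.X → ℚ) : PuiseuxFrac :=
  stringySum (phiPoly φ) a b Y I disc

/-- Batyrev's stringy `E`-function, computed on a resolution `Y` with exceptional divisors `I`
and discrepancies `disc`. -/
def stringyE (E : K0 →+ MvPolynomial (Fin 2) ℤ) (Y : CVariety) (I : Finset Y.X)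
    (disc : Y.X → ℚ) : PuiseuxFrac :=
  stringySum (ePoly E) 1 1 Y I disc

/-! ### Toric varieties -/

/-- The pairing between `M = ℤᵈ` and `N_ℝ = ℝᵈ`. -/
def pairing {d : ℕ} (m : Fin d → ℤ) (x : Fin d → ℝ) : ℝ := ∑ i, (m i : ℝ) * x i

/-- The cone in `N_ℝ` spanned by lattice vectors. -/
def latticeCone {d : ℕ} (s : Set (Fin d → ℤ)) : PointedCone ℝ (Fin d → ℝ) :=
  Submodule.span _ ((fun (v : Fin d → ℤ) (i : Fin d) => (v i : ℝ)) '' s)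

/-- `τ` is a face of `σ`: `τ = σ ∩ m^⊥` for some `m ∈ M` nonnegative on `σ`. -/
def IsFace {d : ℕ} (τ σ : PointedCone ℝ (Fin d → ℝ)) : Prop :=
  ∃ m : Fin d → ℤ, (∀ x ∈ σ, 0 ≤ pairing m x) ∧ ∀ x, x ∈ τ ↔ x ∈ σ ∧ pairing m x = 0

/-- A (finite) fan of strongly convex rational polyhedral cones in `N_ℝ`, `N = ℤᵈ`. -/
structure Fan (d : ℕ) where
  cones : Set (PointedCone ℝ (Fin d → ℝ))
  finite : cones.Finite
  nonempty : cones.Nonempty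
  rational : ∀ σ ∈ cones, ∃ s : Set (Fin d → ℤ), s.Finite ∧ σ = latticeCone s
  strongly_convex : ∀ σ ∈ cones, ∀ x ∈ σ, -x ∈ σ → x = 0
  face_mem : ∀ σ ∈ cones, ∀ τ, IsFace τ σ → τ ∈ cones
  inf_isFace : ∀ σ ∈ cones, ∀ τ ∈ cones, IsFace (σ ⊓ τ) σ

theorem Fan.inf_mem {d : ℕ} (Δ : Fan d) {σ τ : PointedCone ℝ (Fin d → ℝ)} (hσ : σ ∈ Δ.cones)
    (hτ : τ ∈ Δ.cones) : σ ⊓ τ ∈ Δ.cones :=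
  Δ.face_mem σ hσ _ (Δ.inf_isFace σ hσ τ hτ)

/-- `Δ'` is a regular subdivision of `Δ`: it has the same support, each of its cones lies in a
cone of `Δ`, and each of its cones is spanned by a part of a basis of the lattice `N`. -/
structure Fan.IsRegularSubdivision {d : ℕ} (Δ' Δ : Fan d) : Prop where
  le : ∀ σ' ∈ Δ'.cones, ∃ σ ∈ Δ.cones, σ' ≤ σ
  support : ∀ σ ∈ Δ.cones, ∀ x ∈ σ, ∃ σ' ∈ Δ'.cones, x ∈ σ'
  regular : ∀ σ' ∈ Δ'.cones, ∃ (b : Module.Basis (Fin d) ℤ (Fin d → ℤ)) (s : Set (Fin d)),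
    σ' = latticeCone (b '' s)

/-- The semigroup `σ^∨ ∩ M`. -/
def dualMonoid {d : ℕ} (σ : PointedCone ℝ (Fin d → ℝ)) : AddSubmonoid (Fin d → ℤ) where
  carrier := {m | ∀ x ∈ σ, 0 ≤ pairing m x}
  add_mem' {m n} hm hn x hx := by
    have h : pairing (m + n) x = pairing m x + pairing n x := by
      simp [pairing, add_mul, Finset.sum_add_distrib]
    rw [h]
    exact add_nonneg (hm x hx) (hn x hx)
  zero_mem' x _ := by simp [pairing]

theorem dualMonoid_anti {d : ℕ} {τ σ : PointedCone ℝ (Fin d → ℝ)} (h : τ ≤ σ) :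
    dualMonoid σ ≤ dualMonoid τ :=
  fun _ hm x hx => hm x (h hx)

/-- The ring `ℂ[σ^∨ ∩ M]`. -/
abbrev ConeRing {d : ℕ} (σ : PointedCone ℝ (Fin d → ℝ)) : Type :=
  AddMonoidAlgebra ℂ (dualMonoid σ)

/-- The affine toric variety `U_σ = Spec ℂ[σ^∨ ∩ M]`. -/
abbrev coneScheme {d : ℕ} (σ : PointedCone ℝ (Fin d → ℝ)) : Scheme.{0} :=
  Spec (CommRingCat.of (ConeRing σ))

/-- The canonical morphism `U_τ → U_σ` for `τ ⊆ σ`. -/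
def coneMap {d : ℕ} {τ σ : PointedCone ℝ (Fin d → ℝ)} (h : τ ≤ σ) :
    coneScheme τ ⟶ coneScheme σ :=
  Spec.map (CommRingCat.ofHom (AddMonoidAlgebra.mapDomainRingHom ℂ
    (AddSubmonoid.inclusion (dualMonoid_anti h))))

/-- The presentation of the variety `X` as the toric variety of the fan `Δ`: `X` is glued from the
affine charts `U_σ`, `σ ∈ Δ`, along the open subsets `U_{σ ∩ τ}` of `U_σ` and `U_τ`. -/
structure ToricAtlas {d : ℕ} (Δ : Fan d) (X : CVariety) where
  chart : ∀ σ ∈ Δ.cones, coneScheme σ ⟶ X.X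
  isOpenImmersion : ∀ σ hσ, IsOpenImmersion (chart σ hσ)
  chart_str : ∀ σ hσ, chart σ hσ ≫ X.str =
    Spec.map (CommRingCat.ofHom (algebraMap ℂ (ConeRing σ)))
  coneMap_chart : ∀ σ hσ τ hτ (h : τ ≤ σ), coneMap h ≫ chart σ hσ = chart τ hτ
  range_inter : ∀ σ hσ τ hτ, Set.range (chart σ hσ) ∩ Set.range (chart τ hτ) =
    Set.range (chart (σ ⊓ τ) (Δ.inf_mem hσ hτ))
  cover : ∀ x : X.X, ∃ σ hσ, x ∈ Set.range (chart σ hσ)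

/-- `ρ` is the toric morphism `X_{Δ'} → X_Δ` defined by the subdivision `Δ'` of `Δ`: on charts it
is given by the canonical morphisms `U_{σ'} → U_σ` for `σ' ⊆ σ`. -/
def IsToricMorphism {d : ℕ} {Δ' Δ : Fan d} {X' X : CVariety} (A' : ToricAtlas Δ' X')
    (A : ToricAtlas Δ X) (ρ : X'.X ⟶ X.X) : Prop :=
  ∀ σ' hσ' σ hσ (h : σ' ≤ σ), A'.chart σ' hσ' ≫ ρ = coneMap h ≫ A.chart σ hσ

end Stringy

end

/-! Both stringy functions are sums over the same strata, so the identity is proved term by term.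
Suppose the class of each stratum in `K0` is a polynomial `q_J(𝕃)`. A family of type `(a, b)` turns
multiplication by `𝕃` into multiplication by `uᵃvᵇ`, so `φ(D_J⁰) = q_J(uᵃvᵇ) φ(pt)`
(`isPhiSeries_tateClass`), while `E(D_J⁰) = q_J(uv)` (`ePoly_tateClass`). The substitution `u ↦ uᵃ`,
`v ↦ vᵇ` carries `uv` to `uᵃvᵇ`, hence each factor of `E_st` to the factor of `φ^st`, and `φ(pt)`
comes out of the sum (`stringyPhi_eq_of_tate`). Three inputs remain.

Strata. An exceptional prime has codimension one and lies outside the torus. In a chart its ideal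
contains a monomial, and having height one it is then spanned by monomials
(`chi_mem_of_height_one`); so the complement of its closure is a union of toric charts. Such unions
are stable under `∪` and `∩`, the charts of regular cones are products of affine lines and punctured
lines, and inclusion-exclusion gives `of_stratum_mem_range`.

The values `E(pt) = 1` and `E(X × 𝕃) = uv E(X)`. `IsEPolynomial` prescribes only products and Hodge
numbers of smooth proper varieties. The Čech complex of the two standard charts gives `E(ℙ¹) = 1 +
uv` (`hodgeNumber_projectiveLine`); multiplicativity and `[ℙ¹] = [𝔸¹] + [pt]` do the rest.

Denominators. As `(a, b) ≠ (0, 0)`, the substitution kills the denominator `(uv)^{a_j+1} - 1` only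
if `a_j = -1`, and `discrepancy_pos` shows `a_j > -1`. Write `ω = g · dlog x₁ ∧ ⋯ ∧ dlog x_d`; this
logarithmic form has a simple pole along every toric divisor. If `f` is a local equation of `r K_X`,
then `h = gʳ/f` has order `r(a_j + 1)` along an exceptional divisor, order `r` along a
non-exceptional toric divisor, and order `0` along divisors meeting the torus, all near the given
point of `X`. Up to a function not vanishing at that point, `h` is a Laurent polynomial. Positive
order along the rays of the original fan makes its exponents positive on the rays that are needed,
hence on their nonnegative combinations, hence on the exceptional ray. -/

namespace Stringy

/-! ### Classes of open subvarieties -/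

/-- The open subvariety on `V`. -/
noncomputable abbrev CVariety.restrict (Y : CVariety) (V : Y.X.Opens) : CVariety where
  X := V
  str := V.ι ≫ Y.str
  isReduced := inferInstance
  isSeparated := inferInstance
  locallyOfFiniteType := inferInstance
  quasiCompact := inferInstance

theorem K0.of_eq_of_iso {X Y : CVariety} (e : X.X ≅ Y.X) (he : e.hom ≫ Y.str = X.str) :
    K0.of X = K0.of Y := by
  refine (QuotientAddGroup.eq_iff_sub_mem).mpr ?_
  exact AddSubgroup.subset_closure (Or.inl ⟨X, Y, e, he, rfl⟩)

theorem K0.of_eq_add {X Z U : CVariety} (i : Z.X ⟶ X.X) (j : U.X ⟶ X.X) (hci : IsClosedImmersion i)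
    (hoj : IsOpenImmersion j) (hi : i ≫ X.str = Z.str) (hj : j ≫ X.str = U.str)
    (h : Set.range j = (Set.range i)ᶜ) : K0.of X = K0.of Z + K0.of U := by
  rw [← sub_eq_zero, ← sub_sub]
  change (QuotientAddGroup.mk _ : K0) - QuotientAddGroup.mk _ - QuotientAddGroup.mk _ = 0
  rw [← QuotientAddGroup.mk_sub, ← QuotientAddGroup.mk_sub, QuotientAddGroup.eq_zero_iff]
  exact AddSubgroup.subset_closure (Or.inr ⟨X, Z, U, i, j, hci, hoj, hi, hj, h, rfl⟩)

theorem K0.of_eq_restrict {U Y : CVariety} (j : U.X ⟶ Y.X) [IsOpenImmersion j]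
    (hj : j ≫ Y.str = U.str) : K0.of U = K0.of (Y.restrict j.opensRange) := by
  refine K0.of_eq_of_iso (Y := Y.restrict j.opensRange) j.isoOpensRange ?_
  change j.isoOpensRange.hom ≫ j.opensRange.ι ≫ Y.str = _
  rw [Scheme.Hom.isoOpensRange_hom_ι_assoc, hj]

theorem K0.of_restrict_top (Y : CVariety) : K0.of (Y.restrict ⊤) = K0.of Y :=
  K0.of_eq_of_iso (X := Y.restrict ⊤) Y.X.topIso rfl

/-- The empty variety is its own closed subvariety with itself as open complement, so its class `x`
satisfies `x = x + x`. -/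
theorem K0.of_restrict_bot (Y : CVariety) : K0.of (Y.restrict ⊥) = 0 := by
  have : IsEmpty ((⊥ : Y.X.Opens) : Scheme.{0}) := ⟨fun x => x.2⟩
  have h := K0.of_eq_add (X := Y.restrict ⊥) (Z := Y.restrict ⊥) (U := Y.restrict ⊥)
    (𝟙 ((⊥ : Y.X.Opens) : Scheme.{0})) (𝟙 ((⊥ : Y.X.Opens) : Scheme.{0}))
    inferInstance inferInstance
    (Category.id_comp _) (Category.id_comp _)
    (Set.ext fun x => (IsEmpty.false (α := ((⊥ : Y.X.Opens) : Scheme.{0})) x).elim)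
  simpa using h

/-- The closed piece `Z` is left arbitrary so that one and the same `Z` can serve inside two
different ambient open sets in `K0.of_restrict_sup_add_inf`. -/
theorem K0.of_restrict_eq_add (Y : CVariety) {V W : Y.X.Opens} (hVW : V ≤ W) {Z : CVariety}
    (i : Z.X ⟶ W) (hci : IsClosedImmersion i) (hi : i ≫ W.ι ≫ Y.str = Z.str)
    (h : Set.range (i ≫ W.ι) = (W : Set Y.X) \ V) :
    K0.of (Y.restrict W) = K0.of Z + K0.of (Y.restrict V) := by
  refine K0.of_eq_add (X := Y.restrict W) (U := Y.restrict V) i (Y.X.homOfLE hVW) hci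
    inferInstance hi ?_ ?_
  · change Y.X.homOfLE hVW ≫ W.ι ≫ Y.str = V.ι ≫ Y.str
    rw [Scheme.homOfLE_ι_assoc]
  · ext x
    have h1 : x ∈ Set.range (Y.X.homOfLE hVW) ↔ (W.ι x) ∈ V := by
      constructor
      · rintro ⟨y, rfl⟩
        rw [← Scheme.Hom.comp_apply, Scheme.homOfLE_ι]
        exact y.2
      · exact fun hx => ⟨⟨_, hx⟩, W.ι.isOpenEmbedding.injective (Scheme.homOfLE_apply hVW ⟨_, hx⟩)⟩
    have h2 : x ∈ Set.range i ↔ W.ι x ∈ Set.range (i ≫ W.ι) := by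
      constructor
      · rintro ⟨y, rfl⟩
        exact ⟨y, by simp⟩
      · rintro ⟨y, hy⟩
        exact ⟨y, W.ι.isOpenEmbedding.injective (by simpa using hy)⟩
    have h3 : W.ι x ∈ (W : Set Y.X) := x.2
    change x ∈ Set.range (Y.X.homOfLE hVW) ↔ x ∈ (Set.range i)ᶜ
    rw [h1, Set.mem_compl_iff, h2, h]
    simp [h3]

theorem CVariety.range_subschemeι_ι (Y : CVariety) (T : Closeds Y.X) (V : Y.X.Opens) :
    Set.range ((Scheme.IdealSheafData.vanishingIdeal (X := (V : Scheme.{0}))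
      (T.preimage V.ι.continuous)).subschemeι ≫ V.ι) = (T : Set Y.X) ∩ V := by
  rw [Scheme.Hom.comp_base, TopCat.coe_comp, Set.range_comp, Scheme.IdealSheafData.range_subschemeι,
    Scheme.IdealSheafData.coe_support_vanishingIdeal]
  ext x
  constructor
  · rintro ⟨y, hy, rfl⟩
    exact ⟨hy, y.2⟩
  · rintro ⟨h1, h2⟩
    exact ⟨⟨x, h2⟩, h1, rfl⟩

/-- The class of a locally closed subvariety in terms of classes of open subvarieties. -/
theorem K0.of_locallyClosed (Y : CVariety) (T : Closeds Y.X) (V : Y.X.Opens) :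
    K0.of (Y.locallyClosed T V) = K0.of (Y.restrict V) - K0.of (Y.restrict (V ⊓ T.compl)) := by
  rw [eq_sub_iff_add_eq]
  have hci : IsClosedImmersion (Scheme.IdealSheafData.vanishingIdeal (X := (V : Scheme.{0}))
      (T.preimage V.ι.continuous)).subschemeι := inferInstance
  refine (K0.of_restrict_eq_add Y inf_le_left (Z := Y.locallyClosed T V)
    (Scheme.IdealSheafData.vanishingIdeal (X := (V : Scheme.{0}))
      (T.preimage V.ι.continuous)).subschemeι hci rfl ?_).symm
  erw [CVariety.range_subschemeι_ι]
  ext x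
  change x ∈ T ∧ x ∈ V ↔ x ∈ V ∧ ¬ (x ∈ V ∧ x ∉ T)
  tauto

/-- The set `(V ∪ W) \ V` equals `W \ (V ∩ W)`, and it is closed both in `V ∪ W` and in `W`. The two
scissor relations have the same closed term, and subtracting them removes it. -/
theorem K0.of_restrict_sup_add_inf (Y : CVariety) (V W : Y.X.Opens) :
    K0.of (Y.restrict (V ⊔ W)) + K0.of (Y.restrict (V ⊓ W)) =
      K0.of (Y.restrict V) + K0.of (Y.restrict W) := by
  let T : Closeds Y.X := V.compl
  let i := (Scheme.IdealSheafData.vanishingIdeal (X := ((V ⊔ W : Y.X.Opens) : Scheme.{0}))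
      (T.preimage (V ⊔ W).ι.continuous)).subschemeι
  have hci : IsClosedImmersion i := inferInstanceAs (IsClosedImmersion
    (Scheme.IdealSheafData.vanishingIdeal (X := ((V ⊔ W : Y.X.Opens) : Scheme.{0}))
      (T.preimage (V ⊔ W).ι.continuous)).subschemeι)
  have hri : Set.range (i ≫ (V ⊔ W).ι) = (V : Set Y.X)ᶜ ∩ (V ⊔ W : Y.X.Opens) :=
    CVariety.range_subschemeι_ι Y T (V ⊔ W)
  have h1 : K0.of (Y.restrict (V ⊔ W)) =
      K0.of (Y.locallyClosed T (V ⊔ W)) + K0.of (Y.restrict V) := by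
    refine K0.of_restrict_eq_add Y le_sup_left (Z := Y.locallyClosed T (V ⊔ W)) i hci rfl ?_
    erw [hri]
    ext x
    simp only [Set.mem_inter_iff, Set.mem_compl_iff, SetLike.mem_coe, Set.mem_sdiff,
      Opens.mem_sup]
    tauto
  have hsub : Set.range (i ≫ (V ⊔ W).ι) ⊆ Set.range W.ι := by
    rw [hri, Scheme.Opens.range_ι]
    rintro x ⟨hx, hx' | hx'⟩
    · exact (hx hx').elim
    · exact hx'
  let k := IsOpenImmersion.lift W.ι (i ≫ (V ⊔ W).ι) hsub
  have hk : k ≫ W.ι = i ≫ (V ⊔ W).ι := IsOpenImmersion.lift_fac _ _ _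
  have hk' : k ≫ Y.X.homOfLE le_sup_right = i := by
    rw [← cancel_mono (V ⊔ W).ι, Category.assoc, Scheme.homOfLE_ι, hk]
  -- `k` followed by the separated open inclusion `W ⊆ V ∪ W` is the closed immersion `i`, so `k` is
  -- itself a closed immersion.
  have : IsClosedImmersion k := by
    have : IsClosedImmersion (k ≫ Y.X.homOfLE (le_sup_right : W ≤ V ⊔ W)) := by
      rw [hk']; infer_instance
    exact MorphismProperty.of_postcomp (W := @IsClosedImmersion) (W' := @IsSeparated)
      k (Y.X.homOfLE (le_sup_right : W ≤ V ⊔ W)) inferInstance this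
  have h2 : K0.of (Y.restrict W) =
      K0.of (Y.locallyClosed T (V ⊔ W)) + K0.of (Y.restrict (V ⊓ W)) := by
    refine K0.of_restrict_eq_add Y inf_le_right (Z := Y.locallyClosed T (V ⊔ W)) k this ?_ ?_
    · exact congrArg (· ≫ Y.str) hk
    · erw [hk, hri]
      ext x
      simp only [Set.mem_inter_iff, Set.mem_compl_iff, SetLike.mem_coe, Set.mem_sdiff,
        Opens.mem_sup, Opens.mem_inf]
      tauto
  rw [h1, h2]
  abel

/-- If a family of open subsets is closed under finite intersections and the classes of its members
lie in the subgroup `P`, then so do the classes of all finite unions of members. -/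
theorem K0.of_restrict_sup_mem (Y : CVariety) (P : AddSubgroup K0) (B : Set Y.X.Opens)
    (hinf : ∀ V ∈ B, ∀ W ∈ B, V ⊓ W ∈ B) (hB : ∀ V ∈ B, K0.of (Y.restrict V) ∈ P)
    (s : Finset Y.X.Opens) (hs : ∀ V ∈ s, V ∈ B) : K0.of (Y.restrict (s.sup id)) ∈ P := by
  classical
  -- The induction is on a bound for the cardinality: inclusion-exclusion produces the family `V ∩
  -- W'` with `W'` in `s.erase V`, which is not a subfamily of `s` but has fewer members.
  suffices H : ∀ n : ℕ, ∀ s : Finset Y.X.Opens, s.card ≤ n → (∀ V ∈ s, V ∈ B) →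
      K0.of (Y.restrict (s.sup id)) ∈ P from H _ s le_rfl hs
  intro n
  induction n with
  | zero =>
    intro s h _
    rw [Finset.card_eq_zero.mp (Nat.le_zero.mp h), Finset.sup_empty, K0.of_restrict_bot]
    exact zero_mem _
  | succ n ih =>
    intro s h hs
    rcases s.eq_empty_or_nonempty with rfl | ⟨V, hV⟩
    · exact ih ∅ (by simp) (by simp)
    have hc : (s.erase V).card ≤ n := by
      rw [Finset.card_erase_of_mem hV]; omega
    have h1 := K0.of_restrict_sup_add_inf Y V ((s.erase V).sup id)
    have h2 : V ⊔ (s.erase V).sup id = s.sup id := by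
      conv_rhs => rw [← Finset.insert_erase hV, Finset.sup_insert, id]
    have h3 : V ⊓ (s.erase V).sup id = ((s.erase V).image (V ⊓ ·)).sup id := by
      rw [Finset.sup_image, Finset.sup_inf_distrib_left]
      rfl
    rw [h2] at h1
    rw [eq_sub_iff_add_eq.mpr h1]
    refine sub_mem (add_mem (hB V (hs V hV)) (ih _ hc fun W hW => hs W (Finset.mem_of_mem_erase hW)))
      ?_
    rw [h3]
    refine ih _ (Finset.card_image_le.trans hc) fun W hW => ?_
    obtain ⟨W', hW', rfl⟩ := Finset.mem_image.mp hW
    exact hinf V (hs V hV) W' (hs W' (Finset.mem_of_mem_erase hW'))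

end Stringy

namespace Stringy

/-! ### Classes which are polynomials in `𝕃` -/

/-- The class `q(𝕃) [pt]`. -/
noncomputable def tateClass : Polynomial ℤ →+ K0 :=
  ((LinearMap.applyₗ (K0.of CVariety.point)).toAddMonoidHom).comp
    (Polynomial.aeval (R := ℤ) (A := Module.End ℤ K0)
      lefschetz.toIntLinearMap).toLinearMap.toAddMonoidHom

theorem tateClass_one : tateClass 1 = K0.of CVariety.point := by
  simp [tateClass]

theorem tateClass_X_mul (q : Polynomial ℤ) :
    tateClass (Polynomial.X * q) = lefschetz (tateClass q) := by
  simp [tateClass]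

theorem lefschetz_of (X : CVariety) : lefschetz (K0.of X) = K0.of (X.prodAffine 1) := by
  change QuotientAddGroup.lift _ _ _ (QuotientAddGroup.mk _) = _
  simp [QuotientAddGroup.lift_mk]

theorem lefschetz_mem_range {x : K0} (hx : x ∈ tateClass.range) :
    lefschetz x ∈ tateClass.range := by
  obtain ⟨q, rfl⟩ := hx
  exact ⟨_, tateClass_X_mul q⟩

/-! ### Affine varieties -/

section AffineVar

variable (R : Type) [CommRing R] [Algebra ℂ R]

/-- The affine variety with coordinate ring `R`. -/
noncomputable abbrev affineVar [Algebra.FiniteType ℂ R] [IsReduced R] : CVariety where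
  X := Spec (CommRingCat.of R)
  str := Spec.map (CommRingCat.ofHom (algebraMap ℂ R))
  isReduced := inferInstance
  isSeparated := inferInstance
  locallyOfFiniteType := by
    rw [HasRingHomProperty.Spec_iff (P := @LocallyOfFiniteType)]
    exact RingHom.finiteType_algebraMap.mpr ‹_›
  quasiCompact := inferInstance

variable {R} {S : Type} [CommRing S] [Algebra ℂ S]

theorem K0.of_affineVar_congr [Algebra.FiniteType ℂ R] [IsReduced R] [Algebra.FiniteType ℂ S]
    [IsReduced S] (e : R ≃ₐ[ℂ] S) : K0.of (affineVar R) = K0.of (affineVar S) := by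
  refine K0.of_eq_of_iso (X := affineVar R) (Y := affineVar S)
    (Scheme.Spec.mapIso e.toRingEquiv.toCommRingCatIso.symm.op) ?_
  change Spec.map _ ≫ Spec.map _ = Spec.map _
  rw [← Spec.map_comp]
  congr 1
  ext x
  exact e.symm.commutes x

theorem lefschetz_of_affineVar [Algebra.FiniteType ℂ R] [IsReduced R]
    [Algebra.FiniteType ℂ (Polynomial R)] [IsReduced (Polynomial R)] :
    lefschetz (K0.of (affineVar R)) = K0.of (affineVar (Polynomial R)) := by
  rw [lefschetz_of]
  refine K0.of_eq_of_iso (X := (affineVar R).prodAffine 1) (Y := affineVar (Polynomial R))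
    (AffineSpace.SpecIso (Fin 1) (CommRingCat.of R) ≪≫ Scheme.Spec.mapIso
      (MvPolynomial.uniqueAlgEquiv R (Fin 1)).toRingEquiv.toCommRingCatIso.symm.op) ?_
  rw [← Iso.eq_inv_comp]
  change _ = (Spec.map _ ≫ (AffineSpace.SpecIso (Fin 1) (CommRingCat.of R)).inv) ≫
    (𝔸(Fin 1; Spec (CommRingCat.of R)) ↘ Spec (CommRingCat.of R)) ≫ Spec.map _
  rw [Category.assoc, AffineSpace.SpecIso_inv_over_assoc]
  change Spec.map _ = Spec.map _ ≫ Spec.map _ ≫ Spec.map _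
  rw [← Spec.map_comp, ← Spec.map_comp]
  congr 1
  refine CommRingCat.hom_ext (RingHom.ext fun x => ?_)
  change algebraMap ℂ (Polynomial R) x = MvPolynomial.uniqueAlgEquiv R (Fin 1)
    (MvPolynomial.C (algebraMap ℂ R x))
  rw [← MvPolynomial.algebraMap_eq, AlgEquiv.commutes]
  rfl

/-- The decomposition of `Spec R` into the zero locus of `f` and the open subset `D(f)`. -/
theorem K0.of_affineVar_eq_add [Algebra.FiniteType ℂ R] [IsReduced R] [Algebra.FiniteType ℂ S]
    [IsReduced S] {A : Type} [CommRing A] [Algebra ℂ A] [Algebra.FiniteType ℂ A] [IsReduced A]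
    [Algebra R A] [IsScalarTower ℂ R A] (f : R) [IsLocalization.Away f A] (g : R →ₐ[ℂ] S)
    (hg : Function.Surjective g) (hf : RingHom.ker g = Ideal.span {f}) :
    K0.of (affineVar R) = K0.of (affineVar S) + K0.of (affineVar A) := by
  refine K0.of_eq_add (X := affineVar R) (Z := affineVar S) (U := affineVar A)
    (Spec.map (CommRingCat.ofHom g.toRingHom)) (Spec.map (CommRingCat.ofHom (algebraMap R A)))
    (IsClosedImmersion.spec_of_surjective _ hg) (IsOpenImmersion.of_isLocalization f) ?_ ?_ ?_
  · rw [← Spec.map_comp, ← CommRingCat.ofHom_comp]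
    congr 2
    exact g.comp_algebraMap
  · rw [← Spec.map_comp, ← CommRingCat.ofHom_comp]
    congr 2
    exact (IsScalarTower.algebraMap_eq ℂ R A).symm
  · refine (PrimeSpectrum.localization_away_comap_range A f).trans ?_
    rw [PrimeSpectrum.basicOpen_eq_zeroLocus_compl, ← PrimeSpectrum.zeroLocus_span, ← hf]
    congr 1
    exact (range_comap_of_surjective S g.toRingHom hg).symm

end AffineVar

/-- The affine variety with coordinate ring `R` has class `q(𝕃) [pt]` for some polynomial `q`. -/
def IsTate (R : Type) [CommRing R] [Algebra ℂ R] : Prop :=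
  ∃ (_ : Algebra.FiniteType ℂ R) (_ : IsDomain R), K0.of (affineVar R) ∈ tateClass.range

section IsTate

variable {R : Type} [CommRing R] [Algebra ℂ R] {S : Type} [CommRing S] [Algebra ℂ S]

theorem IsTate.congr (h : IsTate R) (e : R ≃ₐ[ℂ] S) : IsTate S := by
  obtain ⟨h1, h2, h3⟩ := h
  have h4 : Algebra.FiniteType ℂ S := h1.equiv e
  have h5 : IsDomain S := e.symm.toMulEquiv.isDomain _
  exact ⟨h4, h5, K0.of_affineVar_congr e ▸ h3⟩

theorem isTate_complex : IsTate ℂ := by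
  refine ⟨inferInstance, inferInstance, ?_⟩
  refine ⟨1, tateClass_one.trans ?_⟩
  refine K0.of_eq_of_iso (X := CVariety.point) (Y := affineVar ℂ) (Iso.refl _) ?_
  exact (Category.id_comp _).trans (Spec.map_id _)

theorem IsTate.polynomial (h : IsTate R) : IsTate (Polynomial R) := by
  obtain ⟨h1, h2, h3⟩ := h
  have h4 : Algebra.FiniteType ℂ (Polynomial R) := Algebra.FiniteType.trans h1 inferInstance
  exact ⟨h4, inferInstance, lefschetz_of_affineVar (R := R) ▸ lefschetz_mem_range h3⟩

/-- `Spec R × 𝔾_m` is the complement of the zero section in `Spec R × 𝔸¹`, so its class is the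
difference of two classes already known to be polynomials in `𝕃`. -/
theorem IsTate.laurentPolynomial (h : IsTate R) : IsTate (LaurentPolynomial R) := by
  have h' := h.polynomial
  obtain ⟨h1, h2, h3⟩ := h
  obtain ⟨h4, h5, h6⟩ := h'
  have : IsScalarTower ℂ (Polynomial R) (LaurentPolynomial R) :=
    IsScalarTower.of_algebraMap_eq fun x => (Polynomial.toLaurent_C _).symm
  have h7 : Algebra.FiniteType ℂ (LaurentPolynomial R) :=
    Algebra.FiniteType.trans h1 (inferInstanceAs (Algebra.FiniteType R (AddMonoidAlgebra R ℤ)))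
  refine ⟨h7, inferInstance, ?_⟩
  have key := K0.of_affineVar_eq_add (R := Polynomial R) (S := R) (A := LaurentPolynomial R)
    Polynomial.X ((Polynomial.aeval (0 : R)).restrictScalars ℂ)
    (fun r => ⟨Polynomial.C r, by simp⟩) (by
      ext p
      rw [Ideal.mem_span_singleton, Polynomial.X_dvd_iff, RingHom.mem_ker]
      simp [Polynomial.coeff_zero_eq_aeval_zero])
  rw [add_comm, ← sub_eq_iff_eq_add] at key
  rw [← key]
  exact sub_mem h6 h3

end IsTate

end Stringy

namespace Stringy

/-! ### Coordinate rings of regular cones -/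

section MonoidAlgebra

variable {M N : Type} [AddCommMonoid M] [AddCommMonoid N]

theorem IsTate.addMonoidAlgebra_congr (h : IsTate (AddMonoidAlgebra ℂ M)) (e : M ≃+ N) :
    IsTate (AddMonoidAlgebra ℂ N) :=
  h.congr (AddMonoidAlgebra.domCongr ℂ ℂ e)

/-- The monoid algebra of a product as an iterated monoid algebra. -/
noncomputable def curryAlgEquiv (M N : Type) [AddCommMonoid M] [AddCommMonoid N] :
    AddMonoidAlgebra (AddMonoidAlgebra ℂ N) M ≃ₐ[ℂ] AddMonoidAlgebra ℂ (M × N) :=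
  AlgEquiv.ofRingEquiv (f := (AddMonoidAlgebra.curryRingEquiv (R := ℂ) (M := M) (N := N)).symm)
    fun r => by
      rw [RingEquiv.symm_apply_eq]
      simp only [AddMonoidAlgebra.coe_algebraMap, Function.comp_apply]
      exact (AddMonoidAlgebra.curryRingEquiv_single (0 : M) (0 : N) r).symm

theorem IsTate.nat_prod (h : IsTate (AddMonoidAlgebra ℂ M)) :
    IsTate (AddMonoidAlgebra ℂ (ℕ × M)) :=
  (h.polynomial.congr (AlgEquiv.ofRingEquiv
    (f := Polynomial.toFinsuppIso (AddMonoidAlgebra ℂ M)) fun _ => rfl)).congr (curryAlgEquiv ℕ M)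

theorem IsTate.int_prod (h : IsTate (AddMonoidAlgebra ℂ M)) :
    IsTate (AddMonoidAlgebra ℂ (ℤ × M)) :=
  IsTate.congr (R := AddMonoidAlgebra (AddMonoidAlgebra ℂ M) ℤ) h.laurentPolynomial
    (curryAlgEquiv ℤ M)

theorem isTate_of_subsingleton [Subsingleton M] : IsTate (AddMonoidAlgebra ℂ M) := by
  refine isTate_complex.congr (AlgEquiv.ofBijective (Algebra.ofId ℂ (AddMonoidAlgebra ℂ M))
    ⟨?_, fun x => ⟨x.coeff 0, ?_⟩⟩)
  · intro x y hxy
    have := congrArg (fun f => AddMonoidAlgebra.coeff f 0) hxy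
    simpa [Algebra.ofId_apply] using this
  · ext m
    rw [Subsingleton.elim m 0]
    simp [Algebra.ofId_apply]

theorem IsTate.fin_nat_prod (h : IsTate (AddMonoidAlgebra ℂ M)) (k : ℕ) :
    IsTate (AddMonoidAlgebra ℂ ((Fin k → ℕ) × M)) := by
  induction k with
  | zero => exact h.addMonoidAlgebra_congr AddEquiv.uniqueProd.symm
  | succ k ih =>
    exact ih.nat_prod.addMonoidAlgebra_congr (AddEquiv.prodAssoc.symm.trans
      (AddEquiv.prodCongr (Fin.consLinearEquiv ℕ fun _ => ℕ).toAddEquiv (AddEquiv.refl M)))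

theorem IsTate.fin_int_prod (h : IsTate (AddMonoidAlgebra ℂ M)) (k : ℕ) :
    IsTate (AddMonoidAlgebra ℂ ((Fin k → ℤ) × M)) := by
  induction k with
  | zero => exact h.addMonoidAlgebra_congr AddEquiv.uniqueProd.symm
  | succ k ih =>
    exact ih.int_prod.addMonoidAlgebra_congr (AddEquiv.prodAssoc.symm.trans
      (AddEquiv.prodCongr (Fin.consLinearEquiv ℤ fun _ => ℤ).toAddEquiv (AddEquiv.refl M)))

/-- The monoid of integer vectors which are nonnegative at the indices in `s`. -/
def nonnegOn {d : ℕ} (s : Set (Fin d)) : AddSubmonoid (Fin d → ℤ) where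
  carrier := {f | ∀ i ∈ s, 0 ≤ f i}
  add_mem' hf hg i hi := add_nonneg (hf i hi) (hg i hi)
  zero_mem' _ _ := le_rfl

open Classical in
/-- A vector which is nonnegative on `s` is a vector of natural numbers on `s` and a vector of
integers on the complement. -/
noncomputable def nonnegOnEquiv {d : ℕ} (s : Set (Fin d)) :
    ((s → ℕ) × ((sᶜ : Set (Fin d)) → ℤ)) ≃+ nonnegOn s where
  toFun f := ⟨fun i => if h : i ∈ s then (f.1 ⟨i, h⟩ : ℤ) else f.2 ⟨i, h⟩, fun i hi => by
    simp [hi]⟩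
  invFun f := (fun i => (f.1 i).toNat, fun i => f.1 i)
  left_inv f := by
    ext i
    · have := i.2
      simp
    · have : (i : Fin d) ∉ s := i.2
      simp [this]
  right_inv f := by
    ext i
    by_cases h : i ∈ s
    · simpa [h] using f.2 i h
    · simp [h]
  map_add' f g := by
    ext i
    by_cases h : i ∈ s <;> simp [h]

/-- The monoid is `ℕ^s × ℤ^{sᶜ}`, so its algebra is obtained from `ℂ` by adjoining polynomial and
Laurent variables one at a time; the variety is a product of lines and punctured lines. -/
theorem isTate_nonnegOn {d : ℕ} (s : Set (Fin d)) : IsTate (AddMonoidAlgebra ℂ (nonnegOn s)) := by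
  classical
  have h1 := ((isTate_of_subsingleton (M := Unit)).fin_int_prod
    (Fintype.card (sᶜ : Set (Fin d)))).fin_nat_prod (Fintype.card s)
  refine h1.addMonoidAlgebra_congr (AddEquiv.trans ?_ (nonnegOnEquiv s))
  exact AddEquiv.prodCongr (LinearEquiv.funCongrLeft ℕ ℕ (Fintype.equivFin s)).toAddEquiv
    (AddEquiv.prodUnique.trans
      (LinearEquiv.funCongrLeft ℤ ℤ (Fintype.equivFin (sᶜ : Set (Fin d)))).toAddEquiv)

end MonoidAlgebra

section Cone

variable {d : ℕ}

/-- The coercion of a lattice vector to a real vector. -/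
def toReal (v : Fin d → ℤ) : Fin d → ℝ := fun i => (v i : ℝ)

/-- The pairing of lattice vectors. -/
def intPairing (m v : Fin d → ℤ) : ℤ := ∑ i, m i * v i

theorem pairing_toReal (m v : Fin d → ℤ) : pairing m (toReal v) = (intPairing m v : ℝ) := by
  simp [pairing, toReal, intPairing]

theorem pairing_nonneg_on_latticeCone {s : Set (Fin d → ℤ)} {m : Fin d → ℤ} :
    (∀ x ∈ latticeCone s, 0 ≤ pairing m x) ↔ ∀ v ∈ s, 0 ≤ intPairing m v := by
  constructor
  · intro h v hv
    have := h (toReal v) (Submodule.subset_span ⟨v, hv, rfl⟩)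
    rw [pairing_toReal] at this
    exact_mod_cast this
  · intro h x hx
    induction hx using Submodule.span_induction with
    | mem x hx =>
      obtain ⟨v, hv, rfl⟩ := hx
      change 0 ≤ pairing m (toReal v)
      rw [pairing_toReal]
      exact_mod_cast h v hv
    | zero => simp [pairing]
    | add x y _ _ hx hy =>
      have : pairing m (x + y) = pairing m x + pairing m y := by
        simp [pairing, mul_add, Finset.sum_add_distrib]
      rw [this]
      exact add_nonneg hx hy
    | smul c x _ hx =>
      have : pairing m (c • x) = c * pairing m x := by
        simp only [pairing, Finset.mul_sum]
        refine Finset.sum_congr rfl fun i _ => ?_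
        change (m i : ℝ) * ((c : ℝ) * x i) = _
        ring
      rw [this]
      exact mul_nonneg c.2 hx

/-- The coordinates of a character in the basis dual to `b`. -/
noncomputable def dualCoords (b : Module.Basis (Fin d) ℤ (Fin d → ℤ)) :
    (Fin d → ℤ) ≃ₗ[ℤ] (Fin d → ℤ) :=
  ((Pi.basisFun ℤ (Fin d)).constr ℤ (M' := ℤ)).trans (b.constr ℤ (M' := ℤ)).symm

theorem dualCoords_apply (b : Module.Basis (Fin d) ℤ (Fin d → ℤ)) (m : Fin d → ℤ) (i : Fin d) :
    dualCoords b m i = intPairing m (b i) := by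
  simp [dualCoords, intPairing, Module.Basis.constr_apply_fintype, Module.Basis.constr_symm_apply, mul_comm]

/-- In the coordinates dual to `b`, a character is nonnegative on the cone exactly when its
coordinates with index in `s` are nonnegative. -/
theorem isTate_coneRing (b : Module.Basis (Fin d) ℤ (Fin d → ℤ)) (s : Set (Fin d)) :
    IsTate (ConeRing (latticeCone (b '' s))) := by
  refine (isTate_nonnegOn s).addMonoidAlgebra_congr (AddEquiv.symm ?_)
  refine ((dualCoords b).toAddEquiv.addSubmonoidMap _).trans (AddEquiv.addSubmonoidCongr ?_)
  ext f
  obtain ⟨m, rfl⟩ := (dualCoords b).surjective f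
  have : m ∈ dualMonoid (latticeCone (b '' s)) ↔ dualCoords b m ∈ nonnegOn s := by
    refine pairing_nonneg_on_latticeCone.trans ?_
    rw [Set.forall_mem_image]
    refine forall₂_congr fun i _ => ?_
    rw [dualCoords_apply]
  rw [← this]
  exact AddSubmonoid.mem_map_equiv.trans (by simp)

end Cone

end Stringy

namespace Stringy

/-! ### Supporting hyperplanes of rational cones -/

section Gordan

variable {d : ℕ}

theorem pairing_toReal_right_add (m n v : Fin d → ℤ) :
    intPairing (m + n) v = intPairing m v + intPairing n v := by
  simp [intPairing, add_mul, Finset.sum_add_distrib]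

theorem intPairing_smul (k : ℤ) (m v : Fin d → ℤ) :
    intPairing (k • m) v = k * intPairing m v := by
  simp [intPairing, Finset.mul_sum, mul_assoc]

theorem toReal_injective : Function.Injective (toReal (d := d)) := fun _ _ hab =>
  funext fun i => Int.cast_injective (congrFun hab i)

/-- The hypothesis says that the convex hull of `s`, which is compact, misses the line of `w`, which
is closed. Hahn-Banach separates the two. -/
theorem exists_real_functional_pos (s : Finset (Fin d → ℤ)) (w : Fin d → ℤ)
    (h : ∀ (c : (Fin d → ℤ) → ℝ) (t : ℝ), (∀ v ∈ s, 0 ≤ c v) →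
      ∑ v ∈ s, c v • toReal v = t • toReal w → ∀ v ∈ s, c v = 0) :
    ∃ x : Fin d → ℝ, ∑ i, x i * w i = 0 ∧ ∀ v ∈ s, 0 < ∑ i, x i * v i := by
  classical
  let K : Set (Fin d → ℝ) := convexHull ℝ (s.image toReal : Finset (Fin d → ℝ))
  let L : Submodule ℝ (Fin d → ℝ) := Submodule.span ℝ {toReal w}
  have hinj := toReal_injective (d := d)
  have hdisj : Disjoint K (L : Set (Fin d → ℝ)) := by
    rw [Set.disjoint_left]
    intro x hx hxL
    obtain ⟨t, rfl⟩ := Submodule.mem_span_singleton.mp hxL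
    rw [Finset.mem_convexHull'] at hx
    obtain ⟨c, hc, hc1, hcx⟩ := hx
    rw [Finset.sum_image hinj.injOn] at hc1 hcx
    have h0 := h (fun v => c (toReal v)) t (fun v hv => hc _ (Finset.mem_image_of_mem _ hv)) hcx
    rw [Finset.sum_congr rfl h0] at hc1
    simp at hc1
  obtain ⟨f, u, v, hu, huv, hv⟩ := geometric_hahn_banach_compact_closed
    (convex_convexHull ℝ _) ((s.image toReal).finite_toSet.isCompact_convexHull ℝ)
    L.convex (Submodule.closed_of_finiteDimensional L) hdisj
  -- A functional bounded below on a line vanishes on it: otherwise some multiple of `w` takes the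
  -- value `v - 1`.
  have hfw : f (toReal w) = 0 := by
    by_contra hne
    have h1 := hv (((v - 1) / f (toReal w)) • toReal w)
      (Submodule.smul_mem _ _ (Submodule.mem_span_singleton_self _))
    rw [map_smul, smul_eq_mul, div_mul_cancel₀ _ hne] at h1
    linarith
  have hv0 : v < 0 := by simpa using hv 0 (zero_mem L)
  have hf : ∀ x : Fin d → ℝ, f x = ∑ i, f (Pi.single i 1) * x i := fun x => by
    conv_lhs => rw [pi_eq_sum_univ' x]
    simp [map_sum, mul_comm]
  -- On the hull `f < u < v < 0`, whence the change of sign.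
  refine ⟨fun i => - f (Pi.single i 1), ?_, fun z hz => ?_⟩
  · have := hf (toReal w)
    rw [hfw] at this
    simp only [neg_mul, Finset.sum_neg_distrib]
    rw [neg_eq_zero]
    exact this.symm
  · have h1 := hu (toReal z) (subset_convexHull ℝ _ (Finset.mem_coe.mpr
      (Finset.mem_image_of_mem _ hz)))
    have h2 := hf (toReal z)
    simp only [neg_mul, Finset.sum_neg_distrib]
    have h3 : ∑ i, f (Pi.single i 1) * (z i : ℝ) = f (toReal z) := h2.symm
    rw [h3]
    linarith

/-- If no nontrivial nonnegative combination of the vectors in `s` lies on the line of `w`, then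
there is a lattice functional which vanishes on `w` and is positive on `s`. -/
theorem exists_intPairing_pos (s : Finset (Fin d → ℤ)) (w : Fin d → ℤ)
    (h : ∀ (c : (Fin d → ℤ) → ℝ) (t : ℝ), (∀ v ∈ s, 0 ≤ c v) →
      ∑ v ∈ s, c v • toReal v = t • toReal w → ∀ v ∈ s, c v = 0) :
    ∃ m : Fin d → ℤ, intPairing m w = 0 ∧ ∀ v ∈ s, 0 < intPairing m v := by
  classical
  obtain ⟨x, hxw, hxs⟩ := exists_real_functional_pos s w h
  -- `W = w · w` makes `y ↦ W y - (y · w) w` an integral multiple of the orthogonal projection away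
  -- from `w`. For `w = 0` this `W` would be zero, and `1` is used instead.
  obtain ⟨W, hW, hWw⟩ : ∃ W : ℤ, 0 < W ∧ ∀ k : ℤ, W * k * (∑ i, w i * w i) =
      (∑ i, w i * w i) * (k * ∑ i, w i * w i) ∧ (w = 0 ∨ W = ∑ i, w i * w i) := by
    by_cases hw : w = 0
    · exact ⟨1, one_pos, fun k => ⟨by simp [hw], Or.inl hw⟩⟩
    · refine ⟨∑ i, w i * w i, ?_, fun k => ⟨by ring, Or.inr rfl⟩⟩
      obtain ⟨i, hi⟩ := Function.ne_iff.mp hw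
      exact Finset.sum_pos' (fun i _ => mul_self_nonneg _) ⟨i, Finset.mem_univ _, mul_self_pos.mpr hi⟩
  -- Rational points are dense but need not be orthogonal to `w`. So the open condition is imposed
  -- on the projection of `y`; a rational point of `O` is found, its denominators are cleared, and
  -- the result is projected.
  let O : Set (Fin d → ℝ) := ⋂ v ∈ s, {y : Fin d → ℝ |
    0 < W * (∑ i, y i * v i) - (∑ i, y i * w i) * ∑ i, (w i : ℝ) * v i}
  have hO : IsOpen O := isOpen_biInter_finset fun v _ =>
    isOpen_lt continuous_const (by fun_prop)
  have hxO : x ∈ O := by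
    refine Set.mem_iInter₂.mpr fun v hv => ?_
    rw [Set.mem_ofPred_eq, hxw, zero_mul, sub_zero]
    exact mul_pos (by exact_mod_cast hW) (hxs v hv)
  obtain ⟨q, hq⟩ := (DenseRange.piMap (ι := Fin d) (fun _ => Rat.denseRange_cast (𝕜 := ℝ))).exists_mem_open
    hO ⟨x, hxO⟩
  let D : ℕ := ∏ i, (q i).den
  have hD : 0 < D := Finset.prod_pos fun i _ => (q i).pos
  have hz : ∀ i, ∃ z : ℤ, (z : ℝ) = D * (q i : ℝ) := fun i => by
    obtain ⟨e, he⟩ := Finset.dvd_prod_of_mem (fun i => (q i).den) (Finset.mem_univ i)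
    refine ⟨e * (q i).num, ?_⟩
    have h1 : (q i : ℝ) * (q i).den = (q i).num := by exact_mod_cast Rat.mul_den_eq_num (q i)
    change _ = ((∏ i, (q i).den : ℕ) : ℝ) * _
    rw [he]
    push_cast
    rw [← h1]
    ring
  choose z hz using hz
  refine ⟨W • z - (∑ i, z i * w i) • w, ?_, fun v hv => ?_⟩
  · have h1 : intPairing (W • z - (∑ i, z i * w i) • w) w =
        W * (∑ i, z i * w i) - (∑ i, z i * w i) * ∑ i, w i * w i := by
      simp only [intPairing, Pi.sub_apply, Pi.smul_apply, smul_eq_mul, sub_mul,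
        Finset.sum_sub_distrib, mul_assoc, Finset.mul_sum]
    rw [h1]
    rcases (hWw 0).2 with hw | hw
    · simp [hw]
    · rw [hw]; ring
  · have h1 : intPairing (W • z - (∑ i, z i * w i) • w) v =
        W * (∑ i, z i * v i) - (∑ i, z i * w i) * ∑ i, w i * v i := by
      simp only [intPairing, Pi.sub_apply, Pi.smul_apply, smul_eq_mul, sub_mul,
        Finset.sum_sub_distrib, mul_assoc, Finset.mul_sum]
    rw [h1]
    have h2 : (0 : ℝ) < D * (W * (∑ i, (q i : ℝ) * v i) -
        (∑ i, (q i : ℝ) * w i) * ∑ i, (w i : ℝ) * v i) :=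
      mul_pos (by exact_mod_cast hD) (Set.mem_iInter₂.mp hq v hv)
    have h3 : (D * (W * (∑ i, (q i : ℝ) * v i) -
        (∑ i, (q i : ℝ) * w i) * ∑ i, (w i : ℝ) * v i)) =
        ((W * (∑ i, z i * v i) - (∑ i, z i * w i) * ∑ i, w i * v i : ℤ) : ℝ) := by
      push_cast
      simp only [hz, mul_assoc, ← Finset.mul_sum]
      ring
    rw [h3] at h2
    exact_mod_cast h2

end Gordan

/-! ### Faces and localizations -/

section Cone

variable {d : ℕ}

theorem toReal_mem_latticeCone {s : Set (Fin d → ℤ)} {v : Fin d → ℤ} (hv : v ∈ s) :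
    toReal v ∈ latticeCone s := Submodule.subset_span ⟨v, hv, rfl⟩

/-- The zero cone is a face of a strongly convex rational polyhedral cone. -/
theorem isFace_bot {s : Set (Fin d → ℤ)} (hs : s.Finite)
    (h : ∀ x ∈ latticeCone s, -x ∈ latticeCone s → x = 0) : IsFace ⊥ (latticeCone s) := by
  classical
  have hinj := toReal_injective (d := d)
  have hmem : ∀ v ∈ hs.toFinset.erase 0, v ∈ s := fun v hv =>
    hs.mem_toFinset.mp (Finset.mem_of_mem_erase hv)
  -- The separation with `w = 0`: in a vanishing nonnegative combination each term is the negative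
  -- of the sum of the others, so strong convexity makes every term zero.
  obtain ⟨m, -, hm⟩ := exists_intPairing_pos (hs.toFinset.erase 0) 0 fun c t hc hct v hv => by
    have h0 : (toReal (0 : Fin d → ℤ)) = 0 := by ext; simp [toReal]
    rw [h0, smul_zero] at hct
    by_contra hne
    have hcv : ∀ v (hv : v ∈ hs.toFinset.erase 0), c v • toReal v ∈ latticeCone s := fun v hv =>
      Submodule.smul_mem _ (⟨c v, hc v hv⟩ : {r : ℝ // 0 ≤ r}) (toReal_mem_latticeCone (hmem v hv))
    have h1 := h (c v • toReal v) (hcv v hv) (by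
      rw [← Finset.add_sum_erase _ _ hv, add_eq_zero_iff_eq_neg] at hct
      rw [hct, neg_neg]
      exact sum_mem fun v' hv' => hcv v' (Finset.mem_of_mem_erase hv'))
    rcases smul_eq_zero.mp h1 with h2 | h2
    · exact hne h2
    · exact Finset.ne_of_mem_erase hv (hinj (h2.trans h0.symm))
  have hm' : ∀ v ∈ s, 0 ≤ intPairing m v := fun v hv => by
    by_cases h0 : v = 0
    · simp [h0, intPairing]
    · exact (hm v (Finset.mem_erase.mpr ⟨h0, hs.mem_toFinset.mpr hv⟩)).le
  have hpos := pairing_nonneg_on_latticeCone.mpr hm'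
  refine ⟨m, hpos, fun x => ⟨?_, ?_⟩⟩
  · rintro hx
    rw [Submodule.mem_bot] at hx
    subst hx
    exact ⟨zero_mem _, by simp [pairing]⟩
  · rintro ⟨hx, hx0⟩
    rw [Submodule.mem_bot]
    have : ∀ x ∈ latticeCone s, pairing m x = 0 → x = 0 := by
      intro x hx
      induction hx using Submodule.span_induction with
      | mem x hx =>
        obtain ⟨v, hv, rfl⟩ := hx
        intro h0
        by_contra hne
        have hv0 : v ≠ 0 := by rintro rfl; exact hne (by ext; simp)
        have h1 := hm v (Finset.mem_erase.mpr ⟨hv0, hs.mem_toFinset.mpr hv⟩)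
        have h2 := pairing_toReal m v
        change pairing m (toReal v) = 0 at h0
        rw [h0] at h2
        have : intPairing m v = 0 := by exact_mod_cast h2.symm
        omega
      | zero => simp
      | add x y hx hy ihx ihy =>
        intro h0
        have h1 : pairing m (x + y) = pairing m x + pairing m y := by
          simp [pairing, mul_add, Finset.sum_add_distrib]
        have h2 := hpos x hx
        have h3 := hpos y hy
        rw [ihx (by linarith), ihy (by linarith), add_zero]
      | smul c x hx ih =>
        intro h0
        have h1 : pairing m (c • x) = c * pairing m x := by
          simp only [pairing, Finset.mul_sum]
          refine Finset.sum_congr rfl fun i _ => ?_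
          change (m i : ℝ) * ((c : ℝ) * x i) = _
          ring
        rw [h1] at h0
        rcases mul_eq_zero.mp h0 with h2 | h2
        · rw [show c = 0 from Subtype.ext h2, zero_smul]
        · rw [ih h2, smul_zero]
    exact this x hx hx0

theorem Fan.bot_mem (Δ : Fan d) : ⊥ ∈ Δ.cones := by
  obtain ⟨σ, hσ⟩ := Δ.nonempty
  obtain ⟨s, hs, rfl⟩ := Δ.rational σ hσ
  exact Δ.face_mem _ hσ _ (isFace_bot hs (Δ.strongly_convex _ hσ))

/-- The ring homomorphism underlying `coneMap`. -/
noncomputable abbrev coneRingHom {τ σ : PointedCone ℝ (Fin d → ℝ)} (h : τ ≤ σ) :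
    ConeRing σ →+* ConeRing τ :=
  AddMonoidAlgebra.mapDomainRingHom ℂ (AddSubmonoid.inclusion (dualMonoid_anti h))

/-- The monomial `χᵐ`. -/
noncomputable abbrev chi {σ : PointedCone ℝ (Fin d → ℝ)} (m : dualMonoid σ) : ConeRing σ :=
  AddMonoidAlgebra.single m 1

theorem coneRingHom_single {τ σ : PointedCone ℝ (Fin d → ℝ)} (h : τ ≤ σ) (m : dualMonoid σ)
    (c : ℂ) : coneRingHom h (AddMonoidAlgebra.single m c) =
      AddMonoidAlgebra.single (AddSubmonoid.inclusion (dualMonoid_anti h) m) c := by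
  simp [coneRingHom]

theorem coneRingHom_injective {τ σ : PointedCone ℝ (Fin d → ℝ)} (h : τ ≤ σ) :
    Function.Injective (coneRingHom h) :=
  AddMonoidAlgebra.mapDomain_injective (AddSubmonoid.inclusion_injective (dualMonoid_anti h))

/-- A character which is nonnegative on the face of `σ` cut out by `m` becomes nonnegative on `σ`
after adding a multiple of `m`. -/
theorem exists_add_nsmul_mem_dualMonoid {s : Set (Fin d → ℤ)} (hs : s.Finite)
    {τ : PointedCone ℝ (Fin d → ℝ)} (m : dualMonoid (latticeCone s))
    (hτ : ∀ x, x ∈ τ ↔ x ∈ latticeCone s ∧ pairing m x = 0) (n : dualMonoid τ) :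
    ∃ k : ℕ, (n : Fin d → ℤ) + k • (m : Fin d → ℤ) ∈ dualMonoid (latticeCone s) := by
  classical
  -- The multiple exceeds every `|⟨n, v⟩|`. On generators with `⟨m, v⟩ ≥ 1` this compensates for
  -- `n`; generators with `⟨m, v⟩ = 0` lie in `τ`, where `n` is nonnegative already.
  refine ⟨∑ v ∈ hs.toFinset, (intPairing n v).natAbs, pairing_nonneg_on_latticeCone.mpr ?_⟩
  intro v hv
  set k := ∑ v ∈ hs.toFinset, (intPairing n v).natAbs
  have hk : (intPairing n v).natAbs ≤ k :=
    Finset.single_le_sum (f := fun v => (intPairing n v).natAbs) (fun _ _ => Nat.zero_le _)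
      (hs.mem_toFinset.mpr hv)
  have h1 : intPairing ((n : Fin d → ℤ) + k • (m : Fin d → ℤ)) v =
      intPairing n v + k * intPairing m v := by
    rw [pairing_toReal_right_add, ← natCast_zsmul, intPairing_smul]
  have h2 : 0 ≤ intPairing m v := pairing_nonneg_on_latticeCone.mp m.2 v hv
  rw [h1]
  rcases h2.eq_or_lt with h3 | h3
  · have h4 : toReal v ∈ τ := (hτ _).mpr ⟨toReal_mem_latticeCone hv, by
      rw [pairing_toReal, ← h3]; simp⟩
    have h5 := n.2 _ h4
    rw [pairing_toReal] at h5
    have : 0 ≤ intPairing n v := by exact_mod_cast h5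
    rw [← h3]
    omega
  · have : (k : ℤ) * 1 ≤ k * intPairing m v := mul_le_mul_of_nonneg_left h3 (by positivity)
    omega

/-- `ℂ[τ^∨ ∩ M]` is the localization of `ℂ[σ^∨ ∩ M]` at `χᵐ` if `τ` is the face of `σ` cut out
by `m`. -/
theorem range_coneMap {s : Set (Fin d → ℤ)} (hs : s.Finite) {τ : PointedCone ℝ (Fin d → ℝ)}
    (m : dualMonoid (latticeCone s)) (hτ : ∀ x, x ∈ τ ↔ x ∈ latticeCone s ∧ pairing m x = 0)
    (h : τ ≤ latticeCone s) :
    Set.range (coneMap h) = {p : coneScheme (latticeCone s) | chi m ∉ p.asIdeal} := by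
  let : Algebra (ConeRing (latticeCone s)) (ConeRing τ) := (coneRingHom h).toAlgebra
  have hmul : ∀ (f : ConeRing τ), ∃ (k : ℕ) (g : ConeRing (latticeCone s)),
      coneRingHom h (chi m ^ k) * f = coneRingHom h g := by
    intro f
    induction f using AddMonoidAlgebra.induction_linear with
    | zero => exact ⟨0, 0, by simp⟩
    | single n c =>
      obtain ⟨k, hk⟩ := exists_add_nsmul_mem_dualMonoid hs m hτ n
      refine ⟨k, AddMonoidAlgebra.single ⟨_, hk⟩ c, ?_⟩
      rw [AddMonoidAlgebra.single_pow, coneRingHom_single, coneRingHom_single,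
        AddMonoidAlgebra.single_mul_single, one_pow, one_mul]
      congr 1
      ext1
      simp [add_comm]
    | add f g hf hg =>
      obtain ⟨k, f', hf⟩ := hf
      obtain ⟨l, g', hg⟩ := hg
      refine ⟨k + l, chi m ^ l * f' + chi m ^ k * g', ?_⟩
      simp only [map_add, map_mul, pow_add, ← hf, ← hg]
      ring
  have hloc : IsLocalization.Away (chi m) (ConeRing τ) := by
    refine ⟨?_, ?_, ?_⟩
    · rintro ⟨_, k, rfl⟩
      rw [map_pow]
      refine IsUnit.pow _ ?_
      have hneg : -(m : Fin d → ℤ) ∈ dualMonoid τ := fun x hx => by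
        have : pairing (-(m : Fin d → ℤ)) x = - pairing m x := by simp [pairing]
        rw [this, ((hτ x).mp hx).2, neg_zero]
      refine IsUnit.of_mul_eq_one (AddMonoidAlgebra.single ⟨_, hneg⟩ 1 : ConeRing τ) ?_
      change coneRingHom h (chi m) * _ = 1
      rw [coneRingHom_single, AddMonoidAlgebra.single_mul_single, one_mul,
        AddMonoidAlgebra.one_def]
      congr 1
      ext1
      simp
    · intro f
      obtain ⟨k, g, hg⟩ := hmul f
      exact ⟨⟨g, ⟨_, k, rfl⟩⟩, by rw [mul_comm]; exact hg⟩
    · intro f g hfg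
      exact ⟨1, by rw [coneRingHom_injective h hfg]⟩
  refine (PrimeSpectrum.localization_away_comap_range (ConeRing τ) (chi m)).trans ?_
  rfl

end Cone

end Stringy

namespace Stringy

/-! ### Invariant primes of height one -/

section Prime

variable {d : ℕ} {σ : PointedCone ℝ (Fin d → ℝ)}

/-- This property, inherited from the lattice, makes the monoid algebra a domain; kernels of
endomorphisms of `ConeRing σ` are therefore prime. -/
instance : UniqueSums (dualMonoid σ) :=
  UniqueSums.of_injective_addHom (H := dualMonoid σ) (G := Fin d → ℤ)
    (dualMonoid σ).subtype.toAddHom Subtype.val_injective inferInstance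

open Classical in
/-- The endomorphism of the monoid algebra which kills the monomials in the prime ideal `p`. -/
noncomputable def killMonomials (p : Ideal (ConeRing σ)) [p.IsPrime] : ConeRing σ →ₐ[ℂ] ConeRing σ :=
  AddMonoidAlgebra.lift ℂ (ConeRing σ) (dualMonoid σ)
    { toFun := fun m => if chi m.toAdd ∈ p then 0 else chi m.toAdd
      map_one' := by
        have h1 : chi (0 : dualMonoid σ) = 1 := rfl
        rw [toAdd_one, h1, if_neg ((Ideal.ne_top_iff_one p).mp (Ideal.IsPrime.ne_top ‹_›))]
      -- Because `p` is prime, the monomials outside `p` are closed under products, and those inside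
      -- absorb multiplication; discarding the latter is multiplicative.
      map_mul' := fun m n => by
        have h1 : chi (m * n).toAdd = chi m.toAdd * chi n.toAdd := by
          rw [AddMonoidAlgebra.single_mul_single, one_mul]; rfl
        rw [h1]
        by_cases hm : chi m.toAdd ∈ p
        · rw [if_pos hm, if_pos (Ideal.mul_mem_right _ _ hm), zero_mul]
        · by_cases hn : chi n.toAdd ∈ p
          · rw [if_pos hn, if_pos (Ideal.mul_mem_left _ _ hn), mul_zero]
          · have : chi m.toAdd * chi n.toAdd ∉ p := fun h =>
              (Ideal.IsPrime.mem_or_mem ‹_› h).elim hm hn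
            rw [if_neg hm, if_neg hn, if_neg this] }

theorem coeff_killMonomials (p : Ideal (ConeRing σ)) [p.IsPrime] (f : ConeRing σ)
    (m : dualMonoid σ) (hm : chi m ∉ p) : (killMonomials p f).coeff m = f.coeff m := by
  classical
  induction f using AddMonoidAlgebra.induction_linear with
  | zero => simp
  | single n c =>
    have h1 : killMonomials p (AddMonoidAlgebra.single n c) =
        c • (if chi n ∈ p then (0 : ConeRing σ) else chi n) := by
      rw [killMonomials, AddMonoidAlgebra.lift_single]
      rfl
    rw [h1]
    by_cases hn : chi n ∈ p
    · have : n ≠ m := by rintro rfl; exact hm hn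
      simp [hn, this]
    · rw [if_neg hn]
      simp
  | add f g hf hg => rw [map_add, AddMonoidAlgebra.coeff_add, Finsupp.add_apply, hf, hg]; simp

theorem sum_mem_of_chi {p : Ideal (ConeRing σ)} {f : ConeRing σ}
    (h : ∀ m ∈ f.coeff.support, chi m ∈ p) : f ∈ p := by
  rw [← AddMonoidAlgebra.sum_coeff_single f]
  refine sum_mem fun m hm => ?_
  have : AddMonoidAlgebra.single m (f.coeff m) = algebraMap ℂ (ConeRing σ) (f.coeff m) * chi m := by
    simp
  rw [this]
  exact Ideal.mul_mem_left _ _ (h m hm)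

/-- If `p` is a prime of height one containing a monomial, then every element of `p` is a sum of
monomials in `p`. -/
theorem chi_mem_of_height_one (p : Ideal (ConeRing σ)) [p.IsPrime]
    (hp : ∀ K : Ideal (ConeRing σ), K.IsPrime → K ≤ p → K ≠ ⊥ → K = p)
    {m₀ : dualMonoid σ} (hm₀ : chi m₀ ∈ p) {f : ConeRing σ} (hf : f ∈ p)
    {m : dualMonoid σ} (hm : m ∈ f.coeff.support) : chi m ∈ p := by
  classical
  -- The kernel consists of sums of monomials lying in `p`. It is prime, contained in `p`, and
  -- nonzero because of `χ^{m₀}`; height one forces it to be `p`.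
  have hK : RingHom.ker (killMonomials p) = p := by
    refine hp _ (RingHom.ker_isPrime _) (fun g hg => sum_mem_of_chi fun n hn => ?_) fun h => ?_
    · by_contra hnp
      rw [Finsupp.mem_support_iff, ← coeff_killMonomials p g n hnp, hg] at hn
      simp at hn
    · have h1 : chi m₀ ∈ RingHom.ker (killMonomials p) := by
        rw [RingHom.mem_ker, killMonomials, AddMonoidAlgebra.lift_single]
        change (1 : ℂ) • (if chi m₀ ∈ p then (0 : ConeRing σ) else chi m₀) = 0
        rw [if_pos hm₀, smul_zero]
      rw [h, Ideal.mem_bot, AddMonoidAlgebra.single_eq_zero] at h1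
      exact one_ne_zero h1
  by_contra hmp
  rw [← hK] at hf
  rw [Finsupp.mem_support_iff, ← coeff_killMonomials p f m hmp, hf] at hm
  simp at hm

end Prime

theorem eq_of_le_of_coheight_eq_one {R : CommRingCat.{0}} [IsDomain R] {p : Spec R}
    (hp : Order.coheight p = 1) (K : Ideal R) (hKp : K.IsPrime) (hK : K ≤ p.asIdeal)
    (hK0 : K ≠ ⊥) : K = p.asIdeal := by
  by_contra hne
  have h1 : p.asIdeal.height = 1 := (idealHeight_eq_coheight R p).trans hp
  have hlt : K < p.asIdeal := lt_of_le_of_ne hK hne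
  have h2 : K.height < 1 := by
    rw [← h1]
    have : K.FiniteHeight := Ideal.finiteHeight_iff_lt.mpr (Or.inr
      (lt_of_le_of_lt ((Ideal.height_mono hK).trans h1.le) (by decide)))
    exact Ideal.height_strict_mono_of_isPrime hlt
  exact hK0 (Ideal.height_eq_zero_iff_eq_bot.mp (Order.lt_one_iff.mp h2))

/-! ### Open subsets which are unions of charts -/

section Toric

variable {d : ℕ} {Δ : Fan d} {X : CVariety} (A : ToricAtlas Δ X)

/-- `V` is a union of charts. -/
def ToricAtlas.IsInvariantOpen (V : X.X.Opens) : Prop :=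
  ∀ x ∈ V, ∃ σ hσ, x ∈ Set.range (A.chart σ hσ) ∧ Set.range (A.chart σ hσ) ⊆ V

variable {A}

theorem ToricAtlas.IsInvariantOpen.inf {V W : X.X.Opens} (hV : A.IsInvariantOpen V)
    (hW : A.IsInvariantOpen W) : A.IsInvariantOpen (V ⊓ W) := by
  intro x hx
  obtain ⟨σ, hσ, h1, h2⟩ := hV x hx.1
  obtain ⟨τ, hτ, h3, h4⟩ := hW x hx.2
  refine ⟨σ ⊓ τ, Δ.inf_mem hσ hτ, ?_, ?_⟩
  · rw [← A.range_inter σ hσ τ hτ]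
    exact ⟨h1, h3⟩
  · rw [← A.range_inter σ hσ τ hτ]
    exact fun y hy => ⟨h2 hy.1, h4 hy.2⟩

theorem ToricAtlas.IsInvariantOpen.sup {V W : X.X.Opens} (hV : A.IsInvariantOpen V)
    (hW : A.IsInvariantOpen W) : A.IsInvariantOpen (V ⊔ W) := by
  rintro x (hx | hx)
  · obtain ⟨σ, hσ, h1, h2⟩ := hV x hx
    exact ⟨σ, hσ, h1, fun y hy => Or.inl (h2 hy)⟩
  · obtain ⟨σ, hσ, h1, h2⟩ := hW x hx
    exact ⟨σ, hσ, h1, fun y hy => Or.inr (h2 hy)⟩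

theorem ToricAtlas.isInvariantOpen_top : A.IsInvariantOpen ⊤ := fun x _ => by
  obtain ⟨σ, hσ, h⟩ := A.cover x
  exact ⟨σ, hσ, h, fun _ _ => trivial⟩

theorem ToricAtlas.isInvariantOpen_bot : A.IsInvariantOpen ⊥ := fun _ hx => hx.elim

theorem ToricAtlas.isInvariantOpen_compl_sup {s : Finset X.X}
    (hs : ∀ y ∈ s, A.IsInvariantOpen (Closeds.closure {y}).compl) :
    A.IsInvariantOpen (s.sup fun y => Closeds.closure {y}).compl := by
  classical
  induction s using Finset.induction_on with
  | empty =>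
    have : ((∅ : Finset X.X).sup fun y => Closeds.closure {y}).compl = ⊤ := by
      ext; simp
    rw [this]
    exact A.isInvariantOpen_top
  | insert y s hy ih =>
    have : ((insert y s).sup fun y => Closeds.closure {y}).compl =
        (Closeds.closure {y}).compl ⊓ (s.sup fun y => Closeds.closure {y}).compl := by
      ext; simp [Finset.sup_insert]
    rw [this]
    exact (hs y (Finset.mem_insert_self y s)).inf (ih fun z hz => hs z (Finset.mem_insert_of_mem hz))

theorem ToricAtlas.isInvariantOpen_compl_inf {s : Finset X.X}
    (hs : ∀ y ∈ s, A.IsInvariantOpen (Closeds.closure {y}).compl) :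
    A.IsInvariantOpen (s.inf fun y => Closeds.closure {y}).compl := by
  classical
  induction s using Finset.induction_on with
  | empty =>
    have : ((∅ : Finset X.X).inf fun y => Closeds.closure {y}).compl = ⊥ := by
      ext; simp
    rw [this]
    exact A.isInvariantOpen_bot
  | insert y s hy ih =>
    have : ((insert y s).inf fun y => Closeds.closure {y}).compl =
        (Closeds.closure {y}).compl ⊔ (s.inf fun y => Closeds.closure {y}).compl := by
      ext x
      change x ∉ (insert y s).inf (fun y => Closeds.closure {y}) ↔
        (x ∉ Closeds.closure {y} ∨ x ∉ s.inf fun y => Closeds.closure {y})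
      rw [Finset.inf_insert, ← not_and_or]
      rfl
    rw [this]
    exact (hs y (Finset.mem_insert_self y s)).sup (ih fun z hz => hs z (Finset.mem_insert_of_mem hz))

variable (A)

/-- The classes of invariant open subsets are polynomials in `𝕃`. -/
theorem ToricAtlas.IsInvariantOpen.of_restrict_mem
    (hreg : ∀ σ ∈ Δ.cones, IsTate (ConeRing σ)) {V : X.X.Opens}
    (hV : A.IsInvariantOpen V) : K0.of (X.restrict V) ∈ tateClass.range := by
  classical
  -- The charts form a finite family stable under intersection by the axioms of a fan, so
  -- inclusion-exclusion applies to any union of them.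
  let B : Set X.X.Opens := {W | ∃ σ hσ, (W : Set X.X) = Set.range (A.chart σ hσ)}
  have hfin : B.Finite := by
    have := Δ.finite
    have h2 : B ⊆ (fun σ => if hσ : σ ∈ Δ.cones then
        (haveI := A.isOpenImmersion σ hσ; (A.chart σ hσ).opensRange) else ⊥) '' Δ.cones := by
      rintro W ⟨σ, hσ, hW⟩
      refine ⟨σ, hσ, ?_⟩
      simp only [dif_pos hσ]
      ext x
      exact (Set.ext_iff.mp hW x).symm
    exact (this.image _).subset h2
  have hVeq : V = (hfin.toFinset.filter (· ≤ V)).sup (id : X.X.Opens → X.X.Opens) := by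
    refine le_antisymm (fun x hx => ?_) (Finset.sup_le fun W hW => (Finset.mem_filter.mp hW).2)
    obtain ⟨σ, hσ, h1, h2⟩ := hV x hx
    have := A.isOpenImmersion σ hσ
    have h3 : (A.chart σ hσ).opensRange ≤ (hfin.toFinset.filter (· ≤ V)).sup (id : X.X.Opens → X.X.Opens) :=
      Finset.le_sup (f := @id X.X.Opens) (Finset.mem_filter.mpr
        ⟨hfin.mem_toFinset.mpr ⟨σ, hσ, rfl⟩, fun y hy => h2 hy⟩)
    exact h3 h1
  rw [hVeq]
  refine K0.of_restrict_sup_mem X _ B ?_ ?_ _ fun W hW =>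
    hfin.mem_toFinset.mp (Finset.mem_filter.mp hW).1
  · rintro V ⟨σ, hσ, h1⟩ W ⟨τ, hτ, h2⟩
    refine ⟨_, Δ.inf_mem hσ hτ, ?_⟩
    rw [← A.range_inter σ hσ τ hτ, ← h1, ← h2]
    rfl
  · rintro W ⟨σ, hσ, hW⟩
    have := A.isOpenImmersion σ hσ
    obtain ⟨h1, h2, h3⟩ := hreg σ hσ
    have h4 := K0.of_eq_restrict (U := affineVar (ConeRing σ)) (Y := X) (A.chart σ hσ)
      (A.chart_str σ hσ)
    have h5 : W = (A.chart σ hσ).opensRange := by ext x; exact Set.ext_iff.mp hW x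
    rw [h5, ← h4]
    exact h3

/-- The complement of an invariant prime divisor is invariant. -/
theorem ToricAtlas.isInvariantOpen_compl_closure (y : X.X) (hy : Order.coheight y = 1)
    (hy0 : y ∉ Set.range (A.chart ⊥ Δ.bot_mem)) :
    A.IsInvariantOpen (Closeds.closure {y}).compl := by
  intro x hx
  obtain ⟨σ, hσ, x, rfl⟩ := A.cover x
  -- If `y` lies outside a chart, that whole open chart avoids the closure of `y`, since open sets
  -- are stable under generization.
  by_cases hyσ : y ∈ Set.range (A.chart σ hσ)
  swap
  · refine ⟨σ, hσ, ⟨x, rfl⟩, fun z hz hzy => hyσ ?_⟩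
    have := A.isOpenImmersion σ hσ
    have h1 : y ⤳ z := specializes_iff_mem_closure.mpr hzy
    exact h1.mem_open (A.chart σ hσ).opensRange.2 hz
  obtain ⟨p, rfl⟩ := hyσ
  have hσ' := hσ
  obtain ⟨s, hs, rfl⟩ := Δ.rational σ hσ
  have := A.isOpenImmersion _ hσ
  rw [coheight_eq_of_isOpenImmersion] at hy
  have hprime : p.asIdeal.IsPrime := p.2
  have hp := fun K h1 h2 h3 => eq_of_le_of_coheight_eq_one (R := CommRingCat.of _) hy K h1 h2 h3
  -- The torus is the locus in `U_σ` where one monomial, cut out by a supporting character of the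
  -- zero face, does not vanish. As `y` is not in the torus, that monomial lies in `p`.
  obtain ⟨m₀, hm₀⟩ : ∃ m₀, chi m₀ ∈ p.asIdeal := by
    obtain ⟨m, hm, hτ⟩ := isFace_bot hs (Δ.strongly_convex _ hσ)
    refine ⟨⟨m, hm⟩, ?_⟩
    by_contra hmp
    have h1 : p ∈ Set.range (coneMap (bot_le : ⊥ ≤ latticeCone s)) := by
      rw [range_coneMap hs ⟨m, hm⟩ hτ bot_le]
      exact hmp
    obtain ⟨q, rfl⟩ := h1
    refine hy0 ⟨q, ?_⟩
    rw [← A.coneMap_chart _ hσ _ Δ.bot_mem bot_le]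
    rfl
  have hpx : ¬ p.asIdeal ≤ x.asIdeal := fun h => hx (by
    have h1 : p ⤳ x := (PrimeSpectrum.le_iff_specializes p x).mp h
    exact specializes_iff_mem_closure.mp (h1.map (A.chart _ hσ).continuous))
  obtain ⟨f, hfp, hfx⟩ := SetLike.not_le_iff_exists.mp hpx
  -- A function in `p` not vanishing at `x` has a monomial not vanishing at `x`, which again lies in
  -- `p`. The face it cuts out gives a chart containing `x` and missing `y`.
  obtain ⟨m, hm, hmx⟩ : ∃ m ∈ f.coeff.support, chi m ∉ x.asIdeal := by
    by_contra! hcon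
    exact hfx (sum_mem_of_chi hcon)
  have hmp : chi m ∈ p.asIdeal := chi_mem_of_height_one p.asIdeal hp hm₀ hfp hm
  let τ : PointedCone ℝ (Fin d → ℝ) :=
    { carrier := {z | z ∈ latticeCone s ∧ pairing m z = 0}
      add_mem' := fun {y z} hy hz => ⟨add_mem hy.1 hz.1, by
        have : pairing m (y + z) = pairing m y + pairing m z := by
          simp [pairing, mul_add, Finset.sum_add_distrib]
        rw [this, hy.2, hz.2, add_zero]⟩
      zero_mem' := ⟨zero_mem _, by simp [pairing]⟩
      smul_mem' := fun c z hz => ⟨Submodule.smul_mem _ _ hz.1, by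
        have : pairing m (c • z) = c * pairing m z := by
          simp only [pairing, Finset.mul_sum]
          refine Finset.sum_congr rfl fun i _ => ?_
          change (m.1 i : ℝ) * ((c : ℝ) * z i) = _
          ring
        rw [this, hz.2, mul_zero]⟩ }
  have hτ : ∀ z, z ∈ τ ↔ z ∈ latticeCone s ∧ pairing m z = 0 := fun z => Iff.rfl
  have hτσ : τ ≤ latticeCone s := fun z hz => hz.1
  have hτΔ : τ ∈ Δ.cones := Δ.face_mem _ hσ τ ⟨m, m.2, hτ⟩
  have hr := range_coneMap hs m hτ hτσ
  have hch := A.coneMap_chart _ hσ _ hτΔ hτσ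
  have hinj := (A.chart _ hσ).isOpenEmbedding.injective
  refine ⟨τ, hτΔ, ?_, fun z hz hzy => ?_⟩
  · have : x ∈ Set.range (coneMap hτσ) := by rw [hr]; exact hmx
    obtain ⟨x', rfl⟩ := this
    exact ⟨x', by rw [← hch]; rfl⟩
  · have h1 : A.chart _ hσ p ⤳ z := specializes_iff_mem_closure.mpr hzy
    have := A.isOpenImmersion τ hτΔ
    obtain ⟨q, hq⟩ := h1.mem_open (A.chart τ hτΔ).opensRange.2 hz
    have h2 : coneMap hτσ q = p := hinj (by rw [← hq, ← hch]; rfl)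
    have h3 : p ∈ Set.range (coneMap hτσ) := ⟨q, h2⟩
    rw [hr] at h3
    exact h3 hmp

/-- An exceptional prime of a toric resolution is not a point of the torus. -/
theorem not_mem_torus_of_isExceptionalPrime {Δ' : Fan d} {X' : CVariety} (A' : ToricAtlas Δ' X')
    {ρ : X'.X ⟶ X.X} (hρ : IsToricMorphism A' A ρ) {y : X'.X} (hy : IsExceptionalPrime ρ y) :
    y ∉ Set.range (A'.chart ⊥ Δ'.bot_mem) := by
  rintro ⟨q, rfl⟩
  -- On the torus `ρ` is the identity in charts, so it preserves codimension and cannot send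
  -- codimension one to at least two.
  have h := hρ ⊥ Δ'.bot_mem ⊥ Δ.bot_mem le_rfl
  have h1 : coneMap (le_rfl : (⊥ : PointedCone ℝ (Fin d → ℝ)) ≤ ⊥) = 𝟙 _ := by
    refine (congrArg Spec.map (CommRingCat.hom_ext ?_)).trans (Spec.map_id _)
    exact AddMonoidAlgebra.ringHom_ext (fun r => coneRingHom_single le_rfl _ _)
      fun m => coneRingHom_single le_rfl _ _
  rw [h1, Category.id_comp] at h
  have := A'.isOpenImmersion ⊥ Δ'.bot_mem
  have := A.isOpenImmersion ⊥ Δ.bot_mem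
  obtain ⟨hy1, hy2⟩ := hy
  have h2 : ρ (A'.chart ⊥ Δ'.bot_mem q) = A.chart ⊥ Δ.bot_mem q := by rw [← h]; rfl
  rw [h2, coheight_eq_of_isOpenImmersion] at hy2
  rw [coheight_eq_of_isOpenImmersion] at hy1
  rw [hy1] at hy2
  exact absurd hy2 (by decide)

/-- The strata of a regular toric resolution have classes which are polynomials in `𝕃`. -/
theorem of_stratum_mem_range {Δ' : Fan d} (hΔ : Δ'.IsRegularSubdivision Δ) {X' : CVariety}
    (A' : ToricAtlas Δ' X') {ρ : X'.X ⟶ X.X} (hρ : IsToricMorphism A' A ρ) {I : Finset X'.X}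
    (hI : ∀ y ∈ I, IsExceptionalPrime ρ y) {J : Finset X'.X} (hJ : J ⊆ I) :
    K0.of (stratum X' I J) ∈ tateClass.range := by
  classical
  have hreg : ∀ σ ∈ Δ'.cones, IsTate (ConeRing σ) := fun σ hσ => by
    obtain ⟨b, s, rfl⟩ := hΔ.regular σ hσ
    exact isTate_coneRing b s
  have hinv : ∀ y ∈ I, A'.IsInvariantOpen (Closeds.closure {y}).compl := fun y hy =>
    A'.isInvariantOpen_compl_closure y (hI y hy).1
      (not_mem_torus_of_isExceptionalPrime A A' hρ (hI y hy))
  have h1 := ToricAtlas.isInvariantOpen_compl_sup (A := A') (s := I \ J) fun y hy =>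
    hinv y (Finset.mem_sdiff.mp hy).1
  have h2 := ToricAtlas.isInvariantOpen_compl_inf (A := A') (s := J) fun y hy => hinv y (hJ hy)
  have h3 := K0.of_locallyClosed X' (J.inf fun j => Closeds.closure {j})
    ((I \ J).sup fun i => Closeds.closure {i}).compl
  rw [stratum, show K0.of _ = _ from h3]
  exact sub_mem (ToricAtlas.IsInvariantOpen.of_restrict_mem A' hreg h1)
    (ToricAtlas.IsInvariantOpen.of_restrict_mem A' hreg (h1.inf h2))

end Toric

end Stringy

/-! ### Invariants of polynomials in `𝕃`, substitution, and the termwise comparison -/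

namespace Stringy

/-! ### Motivic invariants of classes which are polynomials in `𝕃` -/

/-- The canonical homomorphism `K₀(Var) → 𝒩̄[(1/(𝕃ⁱ - 1))_{i ≥ 1}]`. -/
noncomputable def motivicHom : K0 →+ MotivicGroup :=
  ((LocalizedModule.mkLinearMap _ NBar ∘ₗ Submodule.mkQ NLoc.completionKer ∘ₗ
    LocalizedModule.mkLinearMap _ K0Mod).toAddMonoidHom).comp
      (Module.AEval'.of lefschetz.toIntLinearMap).toAddEquiv.toAddMonoidHom

theorem motivicHom_of (X : CVariety) : motivicHom (K0.of X) = motivicClass X := by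
  have : NLoc.frac X 0 = LocalizedModule.mkLinearMap _ K0Mod
      (Module.AEval'.of lefschetz.toIntLinearMap (K0.of X)) := by
    rw [LocalizedModule.mkLinearMap_apply]
    exact congrArg (LocalizedModule.mk _) (Subtype.ext (pow_zero _))
  rw [motivicClass, this]
  rfl

theorem monom_mul_monom (p q r s : ℚ) : monom p q * monom r s = monom (p + r) (q + s) := by
  simp [monom, AddMonoidAlgebra.single_mul_single]

/-- `f` is the generating function of the numbers `φ_{j,n}(x)`. -/
def IsPhiSeries (φ : ℤ → ℤ → MotivicInvariant) (x : K0) (f : Puiseux) : Prop :=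
  (∀ j n : ℤ, f.coeff ((j : ℚ), (n : ℚ)) = φ j n (motivicHom x)) ∧
    ∀ p : ℚ × ℚ, (∀ j n : ℤ, p ≠ ((j : ℚ), (n : ℚ))) → f.coeff p = 0

section Phi

variable {φ : ℤ → ℤ → MotivicInvariant} {x y : K0} {f g : Puiseux}

theorem IsPhiSeries.unique (hf : IsPhiSeries φ x f) (hg : IsPhiSeries φ x g) : f = g := by
  ext p
  by_cases h : ∃ j n : ℤ, p = ((j : ℚ), (n : ℚ))
  · obtain ⟨j, n, rfl⟩ := h
    rw [hf.1, hg.1]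
  · push Not at h
    rw [hf.2 p h, hg.2 p h]

theorem IsPhiSeries.add (hf : IsPhiSeries φ x f) (hg : IsPhiSeries φ y g) :
    IsPhiSeries φ (x + y) (f + g) :=
  ⟨fun j n => by simp [hf.1, hg.1], fun p hp => by simp [hf.2 p hp, hg.2 p hp]⟩

theorem IsPhiSeries.zsmul (hf : IsPhiSeries φ x f) (k : ℤ) : IsPhiSeries φ (k • x) (k • f) :=
  ⟨fun j n => by rw [AddMonoidAlgebra.coeff_smul, Finsupp.smul_apply, hf.1, map_zsmul, map_zsmul],
    fun p hp => by rw [AddMonoidAlgebra.coeff_smul, Finsupp.smul_apply, hf.2 p hp, smul_zero]⟩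

/-- Boundedness is what makes the `finsum` in `phiPoly` the actual sum rather than the default value
`0`. -/
theorem isPhiSeries_phiPoly (hφ : IsBounded φ) (X : CVariety) :
    IsPhiSeries φ (K0.of X) (phiPoly φ X) := by
  classical
  obtain ⟨B, hB⟩ := hφ X
  let s : Finset (ℤ × ℤ) := Finset.Icc (-B) B ×ˢ Finset.Icc (-B) B
  have hs : ∀ p : ℤ × ℤ, p ∉ s → φ p.1 p.2 (motivicClass X) = 0 := fun p hp => by
    refine hB _ _ ?_
    by_contra! h
    exact hp (Finset.mem_product.mpr
      ⟨Finset.mem_Icc.mpr (abs_le.mp h.1), Finset.mem_Icc.mpr (abs_le.mp h.2)⟩)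
  have hsum : phiPoly φ X = ∑ p ∈ s, φ p.1 p.2 (motivicClass X) • monom (p.1 : ℚ) (p.2 : ℚ) :=
    finsum_eq_sum_of_support_subset _ fun p hp => by
      by_contra hps
      exact hp (by simp only [hs p hps, zero_smul])
  have hcoeff : ∀ q : ℚ × ℚ, (phiPoly φ X).coeff q = ∑ p ∈ s,
      if ((p.1 : ℚ), (p.2 : ℚ)) = q then φ p.1 p.2 (motivicClass X) else 0 := fun q => by
    rw [hsum, AddMonoidAlgebra.coeff_sum, Finsupp.finsetSum_apply]
    refine Finset.sum_congr rfl fun p _ => ?_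
    rw [monom, AddMonoidAlgebra.coeff_smul, Finsupp.smul_apply, AddMonoidAlgebra.coeff_single,
      Finsupp.single_apply]
    split_ifs <;> simp
  refine ⟨fun j n => ?_, fun q hq => ?_⟩
  · rw [hcoeff, motivicHom_of, Finset.sum_eq_single (j, n)]
    · simp
    · rintro ⟨j', n'⟩ _ hne
      rw [if_neg]
      intro h
      simp only [Prod.mk.injEq, Int.cast_inj] at h
      exact hne (by rw [h.1, h.2])
    · intro h
      rw [hs _ h]
      simp
  · rw [hcoeff]
    exact Finset.sum_eq_zero fun p _ => if_neg (hq _ _).symm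

theorem IsOfType.apply_lefschetz {a b : ℤ} (hφ : IsOfType φ a b) (j n : ℤ) (x : K0) :
    φ j n (motivicHom (lefschetz x)) = φ (j - a) (n - b) (motivicHom x) := by
  have : (φ j n).comp (motivicHom.comp lefschetz) = (φ (j - a) (n - b)).comp motivicHom := by
    refine QuotientAddGroup.addMonoidHom_ext _ (FreeAbelianGroup.lift_ext _ _ fun X => ?_)
    change φ j n (motivicHom (lefschetz (K0.of X))) = φ (j - a) (n - b) (motivicHom (K0.of X))
    rw [lefschetz_of, motivicHom_of, motivicHom_of]
    simpa using hφ j n X 1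
  exact DFunLike.congr_fun this x

/-- The type condition shifts the index by `(a, b)`, and multiplication by `uᵃvᵇ` shifts
coefficients in the same way. Exponents that are not integral have to be tracked separately. -/
theorem IsPhiSeries.lefschetz {a b : ℤ} (hφ : IsOfType φ a b) (hf : IsPhiSeries φ x f) :
    IsPhiSeries φ (lefschetz x) (monom a b * f) := by
  have h : ∀ p : ℚ × ℚ, (monom a b * f).coeff p = f.coeff (p - ((a : ℚ), (b : ℚ))) := fun p => by
    have : p = ((a : ℚ), (b : ℚ)) + (p - ((a : ℚ), (b : ℚ))) := by abel
    conv_lhs => rw [this, monom]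
    rw [AddMonoidAlgebra.coeff_single_mul_add]
    simp
  refine ⟨fun j n => ?_, fun p hp => ?_⟩
  · rw [h, hφ.apply_lefschetz, ← hf.1]
    congr 1
    simp
  · rw [h]
    refine hf.2 _ fun j n hjn => hp (j + a) (n + b) ?_
    rw [sub_eq_iff_eq_add] at hjn
    rw [hjn]
    simp

/-- Both sides are additive in `q`, so it is enough to treat `k Tⁿ`; there each factor `𝕃`
contributes one factor `uᵃvᵇ`, starting from the series of the point. Uniqueness of the series then
identifies `phiPoly` on any variety whose class is a polynomial in `𝕃`. -/
theorem isPhiSeries_tateClass {a b : ℤ} (hφ : IsOfType φ a b) (hφb : IsBounded φ)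
    (q : Polynomial ℤ) : IsPhiSeries φ (tateClass q)
      (Polynomial.aeval (monom a b) q * phiPoly φ CVariety.point) := by
  induction q using Polynomial.induction_on' with
  | add p q hp hq =>
    rw [map_add, map_add, add_mul]
    exact hp.add hq
  | monomial n k =>
    induction n with
    | zero =>
      have h := (isPhiSeries_phiPoly hφb CVariety.point).zsmul k
      rw [← tateClass_one, ← map_zsmul] at h
      convert h using 1
      · congr 1
        simp [Polynomial.monomial_zero_left]
      · simp
    | succ n ih =>
      have h := ih.lefschetz hφ
      rw [← tateClass_X_mul, ← mul_assoc] at h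
      convert h using 2
      · rw [Polynomial.X_mul_monomial]
      · rw [← Polynomial.X_mul_monomial, map_mul, Polynomial.aeval_X]

end Phi

/-! ### The `E`-polynomial of classes which are polynomials in `𝕃` -/

section EPoly

variable {E : K0 →+ MvPolynomial (Fin 2) ℤ}

/-- The same induction for `E`. The two values of `E` on which it rests are hypotheses here and are
derived from `IsEPolynomial` by means of the projective line. -/
theorem ePoly_tateClass (h1 : E (K0.of CVariety.point) = 1)
    (hL : ∀ X : CVariety, E (K0.of (X.prodAffine 1)) =
      MvPolynomial.X 0 * MvPolynomial.X 1 * E (K0.of X)) (q : Polynomial ℤ) :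
    MvPolynomial.aeval ![monom 1 0, monom 0 1] (E (tateClass q)) =
      Polynomial.aeval (monom 1 1) q := by
  have hL' : ∀ x, E (lefschetz x) = MvPolynomial.X 0 * MvPolynomial.X 1 * E x := by
    have : E.comp lefschetz =
        (AddMonoidHom.mulLeft (MvPolynomial.X 0 * MvPolynomial.X 1)).comp E := by
      refine QuotientAddGroup.addMonoidHom_ext _ (FreeAbelianGroup.lift_ext _ _ fun X => ?_)
      change E (lefschetz (K0.of X)) = _ * E (K0.of X)
      rw [lefschetz_of, hL]
    exact DFunLike.congr_fun this
  induction q using Polynomial.induction_on' with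
  | add p q hp hq => simp only [map_add, hp, hq]
  | monomial n k =>
    induction n with
    | zero =>
      have : Polynomial.monomial 0 k = k • (1 : Polynomial ℤ) := by
        simp [Polynomial.monomial_zero_left]
      rw [this]
      simp only [map_zsmul, tateClass_one, h1, map_one]
    | succ n ih =>
      rw [← Polynomial.X_mul_monomial, tateClass_X_mul, hL', map_mul, ih, map_mul, map_mul,
        Polynomial.aeval_X]
      congr 1
      simp [monom_mul_monom]

end EPoly

/-! ### Substitution -/

section Subst

theorem substPoly_monom (a b : ℤ) (p q : ℚ) :
    substPoly a b (monom p q) = monom (a * p) (b * q) := by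
  simp [substPoly, monom]

theorem substPoly_aeval_monom (a b : ℤ) (q : Polynomial ℤ) :
    substPoly a b (Polynomial.aeval (monom 1 1) q) = Polynomial.aeval (monom a b) q := by
  have := Polynomial.aeval_algHom_apply (substPoly a b).toIntAlgHom (monom 1 1) q
  change _ = substPoly a b _ at this
  rw [← this]
  congr 2
  refine (substPoly_monom a b 1 1).trans (by simp)

theorem monom_sub_one_ne_zero {p q : ℚ} (h : (p, q) ≠ 0) : monom p q - 1 ≠ 0 := by
  intro h0
  have h1 := congrArg (fun f : Puiseux => f.coeff 0) (sub_eq_zero.mp h0)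
  simp only [monom, AddMonoidAlgebra.one_def, AddMonoidAlgebra.coeff_single] at h1
  rw [Finsupp.single_eq_of_ne h.symm, Finsupp.single_eq_same] at h1
  exact zero_ne_one h1

/-- `g` arises from `f` by the substitution `u ↦ uᵃ`, `v ↦ v^b`. -/
def HasSubst (a b : ℤ) (f g : PuiseuxFrac) : Prop :=
  ∃ P Q : Puiseux, substPoly a b Q ≠ 0 ∧
    f = algebraMap Puiseux PuiseuxFrac P / algebraMap Puiseux PuiseuxFrac Q ∧
    g = algebraMap Puiseux PuiseuxFrac (substPoly a b P) /
      algebraMap Puiseux PuiseuxFrac (substPoly a b Q)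

variable {a b : ℤ} {f g f' g' : PuiseuxFrac}

theorem HasSubst.substDefined (h : HasSubst a b f g) : SubstDefined a b f := by
  obtain ⟨P, Q, hQ, hf, -⟩ := h
  exact ⟨P, Q, hQ, hf⟩

theorem HasSubst.subst_eq (h : HasSubst a b f g) : subst a b f = g := by
  obtain ⟨P, Q, hQ, rfl, rfl⟩ := h
  exact Stringy.subst_eq a b P Q hQ

theorem algebraMap_puiseux_ne_zero {P : Puiseux} (hP : P ≠ 0) :
    algebraMap Puiseux PuiseuxFrac P ≠ 0 := fun h =>
  hP (IsFractionRing.injective Puiseux PuiseuxFrac (h.trans (map_zero _).symm))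

theorem ne_zero_of_substPoly_ne_zero {Q : Puiseux} (hQ : substPoly a b Q ≠ 0) : Q ≠ 0 := by
  rintro rfl
  exact hQ (map_zero _)

theorem hasSubst_algebraMap (P : Puiseux) : HasSubst a b (algebraMap Puiseux PuiseuxFrac P)
    (algebraMap Puiseux PuiseuxFrac (substPoly a b P)) :=
  ⟨P, 1, by simp, by simp, by simp⟩

/-- The choice-free relation `HasSubst` is compatible with sums and products by multiplying
denominators. The ring of exponents being a domain, the product denominator still survives the
substitution. -/
theorem HasSubst.add (h : HasSubst a b f g) (h' : HasSubst a b f' g') :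
    HasSubst a b (f + f') (g + g') := by
  obtain ⟨P, Q, hQ, rfl, rfl⟩ := h
  obtain ⟨P', Q', hQ', rfl, rfl⟩ := h'
  refine ⟨P * Q' + Q * P', Q * Q', by rw [map_mul]; exact mul_ne_zero hQ hQ', ?_, ?_⟩
  · rw [div_add_div _ _ (algebraMap_puiseux_ne_zero (ne_zero_of_substPoly_ne_zero hQ))
      (algebraMap_puiseux_ne_zero (ne_zero_of_substPoly_ne_zero hQ'))]
    simp only [map_mul, map_add]
  · rw [div_add_div _ _ (algebraMap_puiseux_ne_zero hQ) (algebraMap_puiseux_ne_zero hQ')]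
    simp only [map_mul, map_add]

theorem HasSubst.mul (h : HasSubst a b f g) (h' : HasSubst a b f' g') :
    HasSubst a b (f * f') (g * g') := by
  obtain ⟨P, Q, hQ, rfl, rfl⟩ := h
  obtain ⟨P', Q', hQ', rfl, rfl⟩ := h'
  refine ⟨P * P', Q * Q', by rw [map_mul]; exact mul_ne_zero hQ hQ', ?_, ?_⟩ <;>
    simp only [map_mul, div_mul_div_comm]

theorem HasSubst.sum {ι : Type*} (s : Finset ι) {F G : ι → PuiseuxFrac}
    (h : ∀ i ∈ s, HasSubst a b (F i) (G i)) : HasSubst a b (∑ i ∈ s, F i) (∑ i ∈ s, G i) := by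
  classical
  induction s using Finset.induction_on with
  | empty => simpa using hasSubst_algebraMap (a := a) (b := b) 0
  | insert i s hi ih =>
    rw [Finset.sum_insert hi, Finset.sum_insert hi]
    exact (h i (Finset.mem_insert_self i s)).add (ih fun j hj => h j (Finset.mem_insert_of_mem hj))

theorem HasSubst.prod {ι : Type*} (s : Finset ι) {F G : ι → PuiseuxFrac}
    (h : ∀ i ∈ s, HasSubst a b (F i) (G i)) : HasSubst a b (∏ i ∈ s, F i) (∏ i ∈ s, G i) := by
  classical
  induction s using Finset.induction_on with
  | empty => simpa using hasSubst_algebraMap (a := a) (b := b) 1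
  | insert i s hi ih =>
    rw [Finset.prod_insert hi, Finset.prod_insert hi]
    exact (h i (Finset.mem_insert_self i s)).mul (ih fun j hj => h j (Finset.mem_insert_of_mem hj))

end Subst

/-! ### Comparison of the stringy functions -/

/-- The comparison for strata whose classes are polynomials in `𝕃` and discrepancies different
from `-1`. -/
theorem stringyPhi_eq_of_tate (Y : CVariety) (I : Finset Y.X) (disc : Y.X → ℚ)
    (hI : ∀ J ⊆ I, K0.of (stratum Y I J) ∈ tateClass.range) (hdisc : ∀ j ∈ I, disc j + 1 ≠ 0)
    (E : K0 →+ MvPolynomial (Fin 2) ℤ) (h1 : E (K0.of CVariety.point) = 1)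
    (hL : ∀ X : CVariety, E (K0.of (X.prodAffine 1)) =
      MvPolynomial.X 0 * MvPolynomial.X 1 * E (K0.of X))
    (φ : ℤ → ℤ → MotivicInvariant) (a b : ℤ) (hab : (a, b) ≠ (0, 0))
    (hφ : IsOfType φ a b) (hφb : IsBounded φ) :
    SubstDefined a b (stringyE E Y I disc) ∧ stringyPhi φ a b Y I disc =
      subst a b (stringyE E Y I disc) *
        algebraMap Puiseux PuiseuxFrac (phiPoly φ CVariety.point) := by
  -- The value `0` for `J ⊄ I` only serves to make the choice total.
  have hq : ∀ J, ∃ q, J ⊆ I → tateClass q = K0.of (stratum Y I J) := fun J => by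
    by_cases hJ : J ⊆ I
    · obtain ⟨q, hq⟩ := hI J hJ
      exact ⟨q, fun _ => hq⟩
    · exact ⟨0, fun h => (hJ h).elim⟩
  choose q hq using hq
  have hE : ∀ J ⊆ I, ePoly E (stratum Y I J) = Polynomial.aeval (monom 1 1) (q J) := fun J hJ => by
    rw [ePoly, ← hq J hJ, ePoly_tateClass h1 hL]
  have hΦ : ∀ J ⊆ I, phiPoly φ (stratum Y I J) =
      Polynomial.aeval (monom a b) (q J) * phiPoly φ CVariety.point := fun J hJ => by
    have h2 := isPhiSeries_phiPoly hφb (stratum Y I J)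
    rw [← hq J hJ] at h2
    exact h2.unique (isPhiSeries_tateClass hφ hφb (q J))
  have key : HasSubst a b (stringyE E Y I disc) (∑ J ∈ I.powerset,
      algebraMap Puiseux PuiseuxFrac (Polynomial.aeval (monom a b) (q J)) *
        ∏ j ∈ J, algebraMap Puiseux PuiseuxFrac (monom a b - 1) /
          algebraMap Puiseux PuiseuxFrac (monom (a * (disc j + 1)) (b * (disc j + 1)) - 1)) := by
    refine HasSubst.sum _ fun J hJ => HasSubst.mul ?_ (HasSubst.prod _ fun j hj => ?_)
    · rw [hE J (Finset.mem_powerset.mp hJ), ← substPoly_aeval_monom]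
      exact hasSubst_algebraMap _
    · have hj0 := hdisc j (Finset.mem_powerset.mp hJ hj)
      refine ⟨monom 1 1 - 1, monom (disc j + 1) (disc j + 1) - 1, ?_, ?_, ?_⟩
      · rw [map_sub, map_one, substPoly_monom]
        -- The substituted denominator has exponents `a(a_j + 1)` and `b(a_j + 1)`; with `a_j + 1 ≠
        -- 0` they are both zero only if `a = b = 0`.
        refine monom_sub_one_ne_zero fun h => hab ?_
        have h2 := congrArg Prod.fst h
        have h3 := congrArg Prod.snd h
        simp only [Prod.fst_zero, Prod.snd_zero, mul_eq_zero, hj0, or_false, Int.cast_eq_zero]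
          at h2 h3
        rw [h2, h3]
      · simp
      · simp [substPoly_monom]
  refine ⟨key.substDefined, ?_⟩
  rw [key.subst_eq, stringyPhi, stringySum, Finset.sum_mul]
  refine Finset.sum_congr rfl fun J hJ => ?_
  rw [hΦ J (Finset.mem_powerset.mp hJ), map_mul]
  ring

end Stringy

/-! ### Čech complexes of differential forms and the Hodge numbers of the projective line -/

namespace Stringy

/-! ### Restriction of forms -/

theorem kaehlerMap_map (A B C : Type) [CommRing A] [CommRing B] [CommRing C] [Algebra ℂ A]
    [Algebra ℂ B] [Algebra ℂ C] [Algebra A B] [Algebra B C] [Algebra A C] [IsScalarTower ℂ A B]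
    [IsScalarTower ℂ B C] [IsScalarTower ℂ A C] [IsScalarTower A B C] (x : Ω[A⁄ℂ]) :
    KaehlerDifferential.map ℂ ℂ B C (KaehlerDifferential.map ℂ ℂ A B x) =
      KaehlerDifferential.map ℂ ℂ A C x := by
  have hx : x ∈ Submodule.span A (Set.range (KaehlerDifferential.D ℂ A)) := by
    rw [KaehlerDifferential.span_range_derivation]; trivial
  induction hx using Submodule.span_induction with
  | mem x hx =>
    obtain ⟨a, rfl⟩ := hx
    simp only [KaehlerDifferential.map_D, ← IsScalarTower.algebraMap_apply]
  | zero => simp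
  | add x y _ _ hx hy => simp only [map_add, hx, hy]
  | smul a x _ hx =>
    rw [(KaehlerDifferential.map ℂ ℂ A B).map_smul, (KaehlerDifferential.map ℂ ℂ A C).map_smul, ← hx, ← algebraMap_smul B a,
      (KaehlerDifferential.map ℂ ℂ B C).map_smul,
      ← algebraMap_smul C (algebraMap A B a), ← IsScalarTower.algebraMap_apply, algebraMap_smul]

theorem kaehlerMap_self (A : Type) [CommRing A] [Algebra ℂ A] (x : Ω[A⁄ℂ]) :
    KaehlerDifferential.map ℂ ℂ A A x = x := by
  have hx : x ∈ Submodule.span A (Set.range (KaehlerDifferential.D ℂ A)) := by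
    rw [KaehlerDifferential.span_range_derivation]; trivial
  induction hx using Submodule.span_induction with
  | mem x hx =>
    obtain ⟨a, rfl⟩ := hx
    simp
  | zero => simp
  | add x y _ _ hx hy => simp only [map_add, hx, hy]
  | smul a x _ hx => rw [map_smul, hx]

theorem formMap_ιMulti (A B : Type) [CommRing A] [CommRing B] [Algebra ℂ A] [Algebra ℂ B]
    [Algebra A B] [IsScalarTower ℂ A B] (p : ℕ) (v : Fin p → Ω[A⁄ℂ]) :
    formMap A B p (exteriorPower.ιMulti A p v) =
      exteriorPower.ιMulti B p fun i => KaehlerDifferential.map ℂ ℂ A B (v i) := by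
  rw [formMap, exteriorPower.alternatingMapLinearEquiv_apply_ιMulti]
  rfl

theorem formMap_formMap (A B C : Type) [CommRing A] [CommRing B] [CommRing C] [Algebra ℂ A]
    [Algebra ℂ B] [Algebra ℂ C] [Algebra A B] [Algebra B C] [Algebra A C] [IsScalarTower ℂ A B]
    [IsScalarTower ℂ B C] [IsScalarTower ℂ A C] [IsScalarTower A B C] (p : ℕ)
    (x : ⋀[A]^p Ω[A⁄ℂ]) : formMap B C p (formMap A B p x) = formMap A C p x := by
  have hx : x ∈ Submodule.span A (Set.range (exteriorPower.ιMulti A p (M := Ω[A⁄ℂ]))) := by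
    rw [exteriorPower.ιMulti_span]; trivial
  induction hx using Submodule.span_induction with
  | mem x hx =>
    obtain ⟨v, rfl⟩ := hx
    simp only [formMap_ιMulti, kaehlerMap_map]
  | zero => simp
  | add x y _ _ hx hy => simp only [map_add, hx, hy]
  | smul a x _ hx =>
    rw [(formMap A B p).map_smul, (formMap A C p).map_smul, ← hx, ← algebraMap_smul B a, (formMap B C p).map_smul,
      ← algebraMap_smul C (algebraMap A B a), ← IsScalarTower.algebraMap_apply, algebraMap_smul]

theorem formMap_self (A : Type) [CommRing A] [Algebra ℂ A] (p : ℕ) (x : ⋀[A]^p Ω[A⁄ℂ]) :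
    formMap A A p x = x := by
  have hx : x ∈ Submodule.span A (Set.range (exteriorPower.ιMulti A p (M := Ω[A⁄ℂ]))) := by
    rw [exteriorPower.ιMulti_span]; trivial
  induction hx using Submodule.span_induction with
  | mem x hx =>
    obtain ⟨v, rfl⟩ := hx
    simp only [formMap_ιMulti, kaehlerMap_self]
  | zero => simp
  | add x y _ _ hx hy => simp only [map_add, hx, hy]
  | smul a x _ hx => rw [map_smul, hx]

namespace CVariety

variable (X : CVariety)

theorem restrictForms_restrictForms (p : ℕ) {U V W : X.X.Opens} (h : V ≤ U) (h' : W ≤ V)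
    (ω : X.Forms p U) :
    X.restrictForms p h' (X.restrictForms p h ω) = X.restrictForms p (h'.trans h) ω := by
  let i1 : Algebra Γ(X.X, U) Γ(X.X, V) := (X.X.presheaf.map (homOfLE h).op).hom.toAlgebra
  let i2 : Algebra Γ(X.X, V) Γ(X.X, W) := (X.X.presheaf.map (homOfLE h').op).hom.toAlgebra
  let i3 : Algebra Γ(X.X, U) Γ(X.X, W) :=
    (X.X.presheaf.map (homOfLE (h'.trans h)).op).hom.toAlgebra
  have tower : ∀ {U V : X.X.Opens} (h : V ≤ U), @IsScalarTower ℂ Γ(X.X, U) Γ(X.X, V) _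
      (X.X.presheaf.map (homOfLE h).op).hom.toAlgebra.toSMul _ := fun {U V} h =>
    letI : Algebra Γ(X.X, U) Γ(X.X, V) := (X.X.presheaf.map (homOfLE h).op).hom.toAlgebra
    IsScalarTower.of_algebraMap_eq' <| by
      change (X.X.presheaf.map (homOfLE le_top : V ⟶ ⊤).op).hom.comp X.toGlobal =
        (X.X.presheaf.map (homOfLE h).op).hom.comp
          ((X.X.presheaf.map (homOfLE le_top : U ⟶ ⊤).op).hom.comp X.toGlobal)
      rw [← RingHom.comp_assoc, ← CommRingCat.hom_comp, ← Functor.map_comp]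
      rfl
  have := tower h
  have := tower h'
  have := tower (h'.trans h)
  have : IsScalarTower Γ(X.X, U) Γ(X.X, V) Γ(X.X, W) := IsScalarTower.of_algebraMap_eq' <| by
    change (X.X.presheaf.map (homOfLE (h'.trans h)).op).hom =
      (X.X.presheaf.map (homOfLE h').op).hom.comp (X.X.presheaf.map (homOfLE h).op).hom
    rw [← CommRingCat.hom_comp, ← Functor.map_comp]
    rfl
  exact formMap_formMap Γ(X.X, U) Γ(X.X, V) Γ(X.X, W) p ω

theorem restrictForms_self (p : ℕ) {U : X.X.Opens} (h : U ≤ U) (ω : X.Forms p U) :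
    X.restrictForms p h ω = ω := by
  -- The algebra structure is given by the restriction map, which equals the identity but is not
  -- syntactically `Algebra.id`; it is generalized so that it can be replaced.
  have key : ∀ (i : Algebra Γ(X.X, U) Γ(X.X, U)) (hi : i = Algebra.id _)
      (ht : @IsScalarTower ℂ Γ(X.X, U) Γ(X.X, U) _ i.toSMul _),
      @formMap Γ(X.X, U) Γ(X.X, U) _ _ _ _ i ht p ω = ω := by
    rintro _ rfl _
    exact formMap_self _ p ω
  refine key _ ?_ _
  refine Algebra.algebra_ext _ _ fun r => ?_
  change (X.X.presheaf.map (homOfLE h).op).hom r = r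
  have : (homOfLE h).op = 𝟙 _ := rfl
  rw [this, CategoryTheory.Functor.map_id]
  rfl

end CVariety

end Stringy

namespace Stringy

namespace CVariety

/-! ### The Čech complex of a cover by two open subsets -/

variable (X : CVariety) (U : Fin 2 → X.X.Opens) (p : ℕ)

theorem cechD_apply {n : ℕ} (U : Fin n → X.X.Opens) (q : ℕ) (c : X.CechCochains U p q)
    (s : Fin (q + 2) → Fin n) :
    X.cechD U p q c s = ∑ j : Fin (q + 2), (-1 : ℂ) ^ (j : ℕ) •
      X.restrictForms p (X.cechOpen_le U s j) (c (s ∘ j.succAbove)) := by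
  simp [cechD]

theorem restrictForms_congr {n : ℕ} {U : Fin n → X.X.Opens} {q : ℕ} (c : X.CechCochains U p q)
    {s t : Fin (q + 1) → Fin n} (h : s = t) {V : X.X.Opens} (hs : V ≤ X.cechOpen U s)
    (ht : V ≤ X.cechOpen U t) :
    X.restrictForms p hs (c s) = X.restrictForms p ht (c t) := by
  subst h
  rfl

theorem mem_cechOpen {n : ℕ} {U : Fin n → X.X.Opens} {q : ℕ} {s : Fin (q + 1) → Fin n} {x : X.X} :
    x ∈ X.cechOpen U s ↔ ∀ k, x ∈ U (s k) := by
  have h : ∀ t : Finset (Fin (q + 1)), x ∈ t.inf (fun k => U (s k)) ↔ ∀ k ∈ t, x ∈ U (s k) := by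
    intro t
    induction t using Finset.induction_on with
    | empty => simp
    | insert a t ha ih => rw [Finset.inf_insert, Opens.mem_inf, ih]; simp
  rw [cechOpen, h]
  simp

theorem sum_neg_one_pow_smul_odd {M : Type*} [AddCommMonoid M] [Module ℂ M] {m : ℕ} (hm : ¬ Even m)
    (x : M) : ∑ j : Fin m, (-1 : ℂ) ^ (j : ℕ) • x = x := by
  rw [← Finset.sum_smul, Fin.sum_univ_eq_sum_range (fun j => (-1 : ℂ) ^ j), neg_one_geom_sum,
    if_neg hm, one_smul]

theorem add_neg_one_smul {M : Type*} [AddCommMonoid M] [Module ℂ M] (x : M) :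
    x + (-1 : ℂ) • x = 0 := by
  nth_rw 1 [← one_smul ℂ x]
  rw [← add_smul, add_neg_cancel, zero_smul]

theorem sum_neg_one_pow_succ_smul_odd {M : Type*} [AddCommMonoid M] [Module ℂ M] {m : ℕ}
    (hm : ¬ Even m) (x : M) : ∑ j : Fin m, (-1 : ℂ) ^ ((j : ℕ) + 1) • x = (-1 : ℂ) • x := by
  rw [← Finset.sum_smul]
  simp only [pow_succ]
  rw [← Finset.sum_mul, Fin.sum_univ_eq_sum_range (fun j => (-1 : ℂ) ^ j), neg_one_geom_sum,
    if_neg hm, one_mul]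

theorem add_sum_smul_zero {M : Type*} [AddCommMonoid M] [Module ℂ M] (x : M) {m : ℕ}
    (f : Fin m → ℂ) : x + ∑ j : Fin m, f j • (0 : M) = x := by
  simp

theorem eq_sum_of_add_sum_eq_zero {M : Type*} [AddCommMonoid M] [Module ℂ M] {m : ℕ} (x : M)
    (f : Fin m → M) (h : x + ∑ j : Fin m, (-1 : ℂ) ^ ((j : ℕ) + 1) • f j = 0) :
    x = ∑ j : Fin m, (-1 : ℂ) ^ (j : ℕ) • f j := by
  have h2 : ∑ j : Fin m, (-1 : ℂ) ^ ((j : ℕ) + 1) • f j + ∑ j : Fin m, (-1 : ℂ) ^ (j : ℕ) • f j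
      = 0 := by
    rw [← Finset.sum_add_distrib]
    refine Finset.sum_eq_zero fun j _ => ?_
    rw [← add_smul, pow_succ, mul_neg_one, neg_add_cancel, zero_smul]
  rw [← add_zero x, ← h2, ← add_assoc, h, zero_add]

variable {X U p}

/-- The constant index tuple `(1, …, 1)`. -/
abbrev ones (m : ℕ) : Fin m → Fin 2 := fun _ => 1

theorem cons_comp_succAbove {m : ℕ} (a : Fin 2) (s : Fin (m + 1) → Fin 2) (j : Fin (m + 1)) :
    (Fin.cons a s : Fin (m + 2) → Fin 2) ∘ j.succ.succAbove = Fin.cons a (s ∘ j.succAbove) := by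
  funext i
  refine Fin.cases ?_ (fun i => ?_) i
  · simp
  · simp [Fin.succ_succAbove_succ]

theorem cons_comp_succAbove_zero {m : ℕ} (a : Fin 2) (s : Fin (m + 1) → Fin 2) :
    (Fin.cons a s : Fin (m + 2) → Fin 2) ∘ Fin.succAbove 0 = s := by
  funext i
  simp

/-- If some entry of `s` is not `1`, then `0` already occurs, and prepending another `0` does not
shrink the intersection. Prepending `0` can thus act as a contracting homotopy away from the tuple
`(1, …, 1)`. -/
theorem le_cechOpen_cons {q : ℕ} {s : Fin (q + 1) → Fin 2} (hs : s ≠ ones (q + 1)) :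
    X.cechOpen U s ≤ X.cechOpen U (Fin.cons 0 s : Fin (q + 2) → Fin 2) := by
  intro x hx
  rw [mem_cechOpen] at hx ⊢
  obtain ⟨i, hi⟩ := Function.ne_iff.mp hs
  have hi0 : s i = 0 := by
    have : s i ≠ 1 := hi
    omega
  refine Fin.cases ?_ fun k => ?_
  · have := hx i
    rwa [hi0] at this
  · simpa using hx k

/-- The coboundary at an index tuple beginning with `0`. -/
theorem cechD_cons {q : ℕ} (c : X.CechCochains U p q) (s : Fin (q + 1) → Fin 2) {V : X.X.Opens}
    (hV : V ≤ X.cechOpen U (Fin.cons 0 s : Fin (q + 2) → Fin 2))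
    (hVs : V ≤ X.cechOpen U s)
    (hVj : ∀ j : Fin (q + 1), V ≤ X.cechOpen U
      ((Fin.cons 0 s : Fin (q + 2) → Fin 2) ∘ j.succ.succAbove)) :
    X.restrictForms p hV (X.cechD U p q c (Fin.cons 0 s)) = X.restrictForms p hVs (c s) +
      ∑ j : Fin (q + 1), (-1 : ℂ) ^ ((j : ℕ) + 1) • X.restrictForms p (hVj j)
        (c ((Fin.cons 0 s : Fin (q + 2) → Fin 2) ∘ j.succ.succAbove)) := by
  rw [cechD_apply, Fin.sum_univ_succ, map_add, map_sum]
  congr 1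
  · rw [Fin.val_zero, pow_zero, one_smul, restrictForms_restrictForms]
    have e := X.restrictForms_congr p c (cons_comp_succAbove_zero 0 s)
      (hV.trans (X.cechOpen_le U (Fin.cons 0 s : Fin (q + 2) → Fin 2) 0)) hVs
    exact e
  · refine Finset.sum_congr rfl fun j _ => ?_
    rw [map_smul, restrictForms_restrictForms, Fin.val_succ]

/-- A cocycle of degree at least one which vanishes at `(1, …, 1)` and at `(0, 1, …, 1)` is a
coboundary. -/
theorem mem_range_of_vanish {k : ℕ} (c : X.CechCochains U p (k + 1))
    (hc : X.cechD U p (k + 1) c = 0) (h1 : c (ones (k + 2)) = 0)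
    (h0 : c (Fin.cons 0 (ones (k + 1))) = 0) : c ∈ LinearMap.range (X.cechD U p k) := by
  classical
  -- The cone construction `b(s) = c(0, s)`. At `(1, …, 1)` the value `c(0, 1, …, 1)` lives on a
  -- smaller open set; since it is zero by hypothesis, the primitive may be taken to be zero there.
  let b : X.CechCochains U p k := fun s =>
    if hs : s = ones (k + 1) then 0 else X.restrictForms p (le_cechOpen_cons hs) (c (Fin.cons 0 s))
  refine ⟨b, funext fun s => ?_⟩
  by_cases hs : s = ones (k + 2)
  · subst hs
    rw [h1, cechD_apply]
    refine Finset.sum_eq_zero fun j _ => ?_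
    have : b (ones (k + 2) ∘ j.succAbove) = 0 := dif_pos rfl
    rw [this, map_zero, smul_zero]
  · have hle := le_cechOpen_cons (U := U) hs
    have hj : ∀ j : Fin (k + 2), X.cechOpen U s ≤ X.cechOpen U
        ((Fin.cons 0 s : Fin (k + 3) → Fin 2) ∘ j.succ.succAbove) := fun j =>
      hle.trans (X.cechOpen_le U _ _)
    have h := cechD_cons c s hle le_rfl hj
    rw [hc, Pi.zero_apply, map_zero, restrictForms_self] at h
    rw [eq_sum_of_add_sum_eq_zero _ _ h.symm, cechD_apply]
    refine Finset.sum_congr rfl fun j _ => ?_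
    congr 1
    -- Deleting an entry can produce the exceptional tuple; the corresponding term of the cocycle
    -- relation is then `c(0, 1, …, 1) = 0`, in agreement with the chosen value of `b`.
    by_cases hsj : s ∘ j.succAbove = ones (k + 1)
    · have hb : b (s ∘ j.succAbove) = 0 := dif_pos hsj
      have hz : (Fin.cons 0 s : Fin (k + 3) → Fin 2) ∘ j.succ.succAbove =
          Fin.cons 0 (ones (k + 1)) := by rw [cons_comp_succAbove, hsj]
      rw [hb, map_zero, X.restrictForms_congr p c hz _ (by rw [← hz]; exact hj j), h0, map_zero]
    · have hb : b (s ∘ j.succAbove) = X.restrictForms p (le_cechOpen_cons hsj)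
          (c (Fin.cons 0 (s ∘ j.succAbove))) := dif_neg hsj
      rw [hb, restrictForms_restrictForms]
      exact X.restrictForms_congr p c (cons_comp_succAbove 0 s j).symm _ _

theorem cechD_ones {q : ℕ} (c : X.CechCochains U p q) :
    X.cechD U p q c (ones (q + 2)) = ∑ j : Fin (q + 2), (-1 : ℂ) ^ (j : ℕ) •
      X.restrictForms p (X.cechOpen_le U (ones (q + 2)) 0) (c (ones (q + 1))) := by
  rw [cechD_apply]
  rfl

/-- Deleting two entries in either order gives the same tuple with opposite signs; the involution on
pairs of positions exchanges the two orders. -/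
theorem cechD_cechD {n : ℕ} {U : Fin n → X.X.Opens} {q : ℕ} (b : X.CechCochains U p q) :
    X.cechD U p (q + 1) (X.cechD U p q b) = 0 := by
  funext s
  have key : ∀ (i : Fin (q + 3)) (j : Fin (q + 2)),
      X.cechOpen U s ≤ X.cechOpen U ((s ∘ i.succAbove) ∘ j.succAbove) := fun i j =>
    (X.cechOpen_le U s i).trans (X.cechOpen_le U _ j)
  have h : X.cechD U p (q + 1) (X.cechD U p q b) s =
      ∑ a : Fin (q + 3) × Fin (q + 2), (-1 : ℂ) ^ ((a.1 : ℕ) + a.2) •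
        X.restrictForms p (key a.1 a.2) (b ((s ∘ a.1.succAbove) ∘ a.2.succAbove)) := by
    rw [cechD_apply, Fintype.sum_prod_type]
    refine Finset.sum_congr rfl fun i _ => ?_
    rw [cechD_apply, map_sum, Finset.smul_sum]
    refine Finset.sum_congr rfl fun j _ => ?_
    rw [map_smul, restrictForms_restrictForms, smul_smul, pow_add]
  rw [h]
  refine Finset.sum_involution
    (fun a _ => (a.1.succAbove a.2, a.2.predAbove a.1)) ?_ ?_ ?_ ?_
  · rintro ⟨i, j⟩ _
    have hs : (s ∘ (i.succAbove j).succAbove) ∘ (j.predAbove i).succAbove =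
        (s ∘ i.succAbove) ∘ j.succAbove := by
      funext k
      simp [Fin.succAbove_succAbove_succAbove_predAbove]
    dsimp only
    rw [X.restrictForms_congr p b hs (key _ _) (key i j), Fin.neg_one_pow_succAbove_add_predAbove]
    rw [← add_smul, add_neg_cancel, zero_smul]
  · rintro ⟨i, j⟩ _ _ h
    exact Fin.succAbove_ne i j (congrArg Prod.fst h)
  · intros
    exact Finset.mem_univ _
  · rintro ⟨i, j⟩ _
    simp [Fin.succAbove_succAbove_predAbove, Fin.predAbove_predAbove_succAbove]

/-- Deleting the leading `0` gives `(1, …, 1)`, and deleting any of the `1`s gives the same tuple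
`(0, 1, …, 1)`, so the coboundary is an alternating sum of equal terms, governed by parity. -/
theorem cechD_cons_ones {q : ℕ} (c : X.CechCochains U p q) {V : X.X.Opens}
    (hV : V ≤ X.cechOpen U (Fin.cons 0 (ones (q + 1)) : Fin (q + 2) → Fin 2))
    (hV1 : V ≤ X.cechOpen U (ones (q + 1)))
    (hV0 : V ≤ X.cechOpen U (Fin.cons 0 (ones q) : Fin (q + 1) → Fin 2)) :
    X.restrictForms p hV (X.cechD U p q c (Fin.cons 0 (ones (q + 1)))) =
      X.restrictForms p hV1 (c (ones (q + 1))) + ∑ j : Fin (q + 1), (-1 : ℂ) ^ ((j : ℕ) + 1) •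
        X.restrictForms p hV0 (c (Fin.cons 0 (ones q))) := by
  have hj : ∀ j : Fin (q + 1), (Fin.cons 0 (ones (q + 1)) : Fin (q + 2) → Fin 2) ∘
      j.succ.succAbove = Fin.cons 0 (ones q) := by
    intro j
    cases q with
    | zero =>
      funext i
      fin_cases i
      fin_cases j
      rfl
    | succ q => exact cons_comp_succAbove 0 (ones (q + 2)) j
  rw [cechD_cons c (ones (q + 1)) hV hV1 fun j => by rw [hj]; exact hV0]
  congr 1
  refine Finset.sum_congr rfl fun j _ => ?_
  rw [X.restrictForms_congr p c (hj j) _ hV0]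

theorem cechOpen_cons_zero_ones (k : ℕ) :
    X.cechOpen U (Fin.cons 0 (ones (k + 1)) : Fin (k + 2) → Fin 2) = U 0 ⊓ U 1 := by
  ext x
  simp only [SetLike.mem_coe, mem_cechOpen, Opens.mem_inf]
  constructor
  · intro h
    exact ⟨by simpa using h 0, by simpa using h 1⟩
  · rintro ⟨h0, h1⟩ i
    refine Fin.cases ?_ (fun i => ?_) i
    · simpa using h0
    · simpa using h1

theorem cechOpen_ones (k : ℕ) : X.cechOpen U (ones (k + 1)) = U 1 := by
  ext x
  simp only [SetLike.mem_coe, mem_cechOpen]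
  exact ⟨fun h => h 0, fun h _ => h⟩

theorem cons_zero_ne_ones (k : ℕ) : (Fin.cons 0 (ones k) : Fin (k + 1) → Fin 2) ≠ ones (k + 1) :=
  fun h => by simpa using congrFun h 0

set_option maxHeartbeats 800000 in
/-- The Čech cohomology of a cover by two open subsets vanishes in degrees at least two. -/
theorem ker_cechD_le_range {k : ℕ} :
    LinearMap.ker (X.cechD U p (k + 2)) ≤ LinearMap.range (X.cechD U p (k + 1)) := by
  classical
  intro c hc
  rw [LinearMap.mem_ker] at hc
  have hone : X.cechOpen U (ones (k + 2)) ≤ X.cechOpen U (ones (k + 3)) := by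
    rw [cechOpen_ones, cechOpen_ones]
  have hcons : X.cechOpen U (Fin.cons 0 (ones (k + 1)) : Fin (k + 2) → Fin 2) ≤
      X.cechOpen U (Fin.cons 0 (ones (k + 2)) : Fin (k + 3) → Fin 2) := by
    rw [cechOpen_cons_zero_ones, cechOpen_cons_zero_ones]
  -- The complex uses all index tuples, not only alternating cochains, so a cocycle must first be
  -- corrected by a coboundary to vanish at the two tuples where the cone construction breaks down.
  suffices h : ∃ e : X.CechCochains U p (k + 1),
      (c + X.cechD U p (k + 1) e) (ones (k + 3)) = 0 ∧
      (c + X.cechD U p (k + 1) e) (Fin.cons 0 (ones (k + 2))) = 0 by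
    obtain ⟨e, h1, h0⟩ := h
    have h := mem_range_of_vanish (c + X.cechD U p (k + 1) e)
      (by rw [map_add, hc, cechD_cechD, add_zero]) h1 h0
    exact (Submodule.add_mem_iff_left _ (LinearMap.mem_range_self _ e)).1 h
  have hle : X.cechOpen U (Fin.cons 0 (ones (k + 2)) : Fin (k + 3) → Fin 2) ≤
      X.cechOpen U (Fin.cons 0 (ones (k + 1)) : Fin (k + 2) → Fin 2) := by
    rw [cechOpen_cons_zero_ones, cechOpen_cons_zero_ones]
  have hle1 : X.cechOpen U (Fin.cons 0 (ones (k + 2)) : Fin (k + 3) → Fin 2) ≤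
      X.cechOpen U (ones (k + 2)) := by
    rw [cechOpen_cons_zero_ones, cechOpen_ones]
    exact inf_le_right
  by_cases hk : Even (k + 3)
  -- Even case: the cocycle relation at `(1, …, 1)` has an odd number of equal terms and gives
  -- vanishing there. A correction supported at `(0, 1, …, 1)` removes the other value.
  · have h1 : c (ones (k + 3)) = 0 := by
      have h := congrFun hc (ones (k + 4))
      rw [cechD_ones, sum_neg_one_pow_smul_odd (by simpa [parity_simps] using hk)] at h
      have h2 := X.restrictForms_restrictForms p (X.cechOpen_le U (ones (k + 4)) 0)
        (le_of_eq (by rw [cechOpen_ones, cechOpen_ones]) :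
          X.cechOpen U (ones (k + 3)) ≤ X.cechOpen U (ones (k + 4))) (c (ones (k + 3)))
      rw [h, Pi.zero_apply, map_zero] at h2
      exact (h2.trans (X.restrictForms_self p _ _)).symm
    let e : X.CechCochains U p (k + 1) := fun s =>
      if hs : s = Fin.cons 0 (ones (k + 1)) then
        X.restrictForms p (hs ▸ hcons) (c (Fin.cons 0 (ones (k + 2)))) else 0
    have he1 : e (ones (k + 2)) = 0 := dif_neg (cons_zero_ne_ones _).symm
    have he0 : e (Fin.cons 0 (ones (k + 1))) =
      X.restrictForms p hcons (c (Fin.cons 0 (ones (k + 2)))) := dif_pos rfl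
    refine ⟨e, ?_, ?_⟩
    · rw [Pi.add_apply, cechD_ones, he1, h1]
      simp only [map_zero, smul_zero, Finset.sum_const_zero, add_zero]
    · have h := cechD_cons_ones e le_rfl hle1 hle
      rw [restrictForms_self, he1, map_zero, he0, restrictForms_restrictForms,
        restrictForms_self] at h
      rw [Pi.add_apply, h, zero_add, sum_neg_one_pow_succ_smul_odd (by simpa [parity_simps] using hk),
        add_neg_one_smul]
  -- Odd case: the correction is supported at `(1, …, 1)`. The cocycle relation at `(0, 1, …, 1)`
  -- identifies the two values of `c` on the overlap, so this correction removes both.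
  · let e : X.CechCochains U p (k + 1) := fun s =>
      if hs : s = ones (k + 2) then
        (-1 : ℂ) • X.restrictForms p (hs ▸ hone) (c (ones (k + 3))) else 0
    have he1 : e (ones (k + 2)) = (-1 : ℂ) • X.restrictForms p hone (c (ones (k + 3))) :=
      dif_pos rfl
    have he0 : e (Fin.cons 0 (ones (k + 1))) = 0 := dif_neg (cons_zero_ne_ones _)
    refine ⟨e, ?_, ?_⟩
    · rw [Pi.add_apply, cechD_ones, he1, sum_neg_one_pow_smul_odd hk, map_smul,
        restrictForms_restrictForms, restrictForms_self, add_neg_one_smul]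
    · have h := cechD_cons_ones e le_rfl hle1 hle
      rw [restrictForms_self, he0, map_zero, he1, map_smul, restrictForms_restrictForms] at h
      have hle3 : X.cechOpen U (Fin.cons 0 (ones (k + 2)) : Fin (k + 3) → Fin 2) ≤
          X.cechOpen U (Fin.cons 0 (ones (k + 3)) : Fin (k + 4) → Fin 2) := by
        rw [cechOpen_cons_zero_ones, cechOpen_cons_zero_ones]
      have h' := cechD_cons_ones c hle3 (hle1.trans hone) le_rfl
      rw [hc, Pi.zero_apply, map_zero] at h'
      have h'' := eq_sum_of_add_sum_eq_zero _ _ h'.symm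
      rw [sum_neg_one_pow_smul_odd hk, restrictForms_self] at h''
      rw [Pi.add_apply, h, h'', add_sum_smul_zero, add_neg_one_smul]

end CVariety

end Stringy

namespace Stringy

namespace CVariety

/-! ### Čech cohomology of a cover by two open subsets in degrees zero and one -/

variable {X : CVariety} {U : Fin 2 → X.X.Opens} {p : ℕ}

theorem inf_le_cechOpen {q : ℕ} (s : Fin (q + 1) → Fin 2) : U 0 ⊓ U 1 ≤ X.cechOpen U s := by
  intro x hx
  rw [mem_cechOpen]
  intro k
  generalize s k = i
  fin_cases i
  · exact hx.1
  · exact hx.2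

theorem cechOpen_const {q : ℕ} (i : Fin 2) : X.cechOpen U (fun _ : Fin (q + 1) => i) = U i := by
  ext x
  simp only [SetLike.mem_coe, mem_cechOpen]
  exact ⟨fun h => h 0, fun h _ => h⟩

theorem cechOpen_ne {s : Fin 2 → Fin 2} (h : s 0 ≠ s 1) :
    X.cechOpen U s = U 0 ⊓ U 1 := by
  refine le_antisymm (fun x hx => ?_) (inf_le_cechOpen s)
  rw [mem_cechOpen] at hx
  have hx0 := hx 0
  have hx1 := hx 1
  revert h hx0 hx1
  generalize s 0 = i
  generalize s 1 = j
  intro h hi hj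
  fin_cases i <;> fin_cases j <;> first | exact absurd rfl h | exact ⟨hi, hj⟩ | exact ⟨hj, hi⟩

theorem cechOpen_eq_or {q : ℕ} (s : Fin (q + 1) → Fin 2) :
    (∃ i, X.cechOpen U s = U i) ∨ X.cechOpen U s = U 0 ⊓ U 1 := by
  by_cases h : s = fun _ => s 0
  · refine Or.inl ⟨s 0, ?_⟩
    rw [h]
    exact cechOpen_const _
  · refine Or.inr (le_antisymm (fun x hx => ?_) (inf_le_cechOpen s))
    obtain ⟨j, hj⟩ := Function.ne_iff.mp h
    rw [mem_cechOpen] at hx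
    have h0 := hx 0
    have h1 := hx j
    revert hj h0 h1
    generalize s 0 = i
    generalize s j = k
    intro h hi hj
    fin_cases i <;> fin_cases k <;>
      first | exact absurd rfl h | exact ⟨hi, hj⟩ | exact ⟨hj, hi⟩

variable {L : Type*} [AddCommGroup L] [Module ℂ L] (κ : X.Forms p (U 0 ⊓ U 1) →ₗ[ℂ] L)

/-- The coefficients of the restriction of a form to `U 0 ⊓ U 1`. -/
noncomputable def coeffOn {V : X.X.Opens} (hV : U 0 ⊓ U 1 ≤ V) : X.Forms p V →ₗ[ℂ] L :=
  κ ∘ₗ X.restrictForms p hV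

theorem coeffOn_restrictForms {V W : X.X.Opens} (hV : U 0 ⊓ U 1 ≤ V) (h : V ≤ W)
    (ω : X.Forms p W) :
    coeffOn κ hV (X.restrictForms p h ω) = coeffOn κ (hV.trans h) ω := by
  rw [coeffOn, LinearMap.comp_apply, restrictForms_restrictForms]
  rfl

/-- Measured by coefficients on `U 0 ∩ U 1`, all groups of forms map to one space `L` and
restrictions become invisible; the differential is a plain alternating sum of vectors of `L`. -/
theorem coeffOn_cechD {q : ℕ} (c : X.CechCochains U p q) (s : Fin (q + 2) → Fin 2) :
    coeffOn κ (inf_le_cechOpen s) (X.cechD U p q c s) = ∑ j : Fin (q + 2), (-1 : ℂ) ^ (j : ℕ) •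
      coeffOn κ (inf_le_cechOpen (s ∘ j.succAbove)) (c (s ∘ j.succAbove)) := by
  rw [cechD_apply, map_sum]
  refine Finset.sum_congr rfl fun j _ => ?_
  rw [map_smul, coeffOn_restrictForms]

variable {κ} {W : Fin 2 → Submodule ℂ L} (hκ : Function.Bijective κ)
  (hle : ∀ i, U 0 ⊓ U 1 ≤ U i)
  (hinj : ∀ i, Function.Injective (coeffOn κ (hle i)))
  (hW : ∀ i, LinearMap.range (coeffOn κ (hle i)) = W i)

include hinj in
theorem coeffOn_injective_of_eq {V : X.X.Opens} (hV : U 0 ⊓ U 1 ≤ V) (i : Fin 2) (h : V = U i) :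
    Function.Injective (coeffOn κ hV) := by
  subst h
  exact hinj i

include hW in
theorem range_coeffOn_of_eq {V : X.X.Opens} (hV : U 0 ⊓ U 1 ≤ V) (i : Fin 2) (h : V = U i) :
    LinearMap.range (coeffOn κ hV) = W i := by
  subst h
  exact hW i

include hκ in
theorem coeffOn_bijective_of_eq {V : X.X.Opens} (hV : U 0 ⊓ U 1 ≤ V) (h : V = U 0 ⊓ U 1) :
    Function.Bijective (coeffOn κ hV) := by
  subst h
  have : coeffOn κ hV = κ := LinearMap.ext fun ω => congrArg κ (X.restrictForms_self p _ ω)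
  rw [this]
  exact hκ

include hκ hinj in
theorem coeffOn_injective_pair (s : Fin 2 → Fin 2) :
    Function.Injective (coeffOn κ (inf_le_cechOpen (U := U) s)) := by
  by_cases h : s 0 = s 1
  · have hs : s = fun _ => s 0 := by
      funext i
      fin_cases i
      · rfl
      · exact h.symm
    refine coeffOn_injective_of_eq hle hinj _ (s 0) ?_
    rw [hs]
    exact cechOpen_const _
  · exact (coeffOn_bijective_of_eq hκ _ (cechOpen_ne h)).1

theorem single_eq (s : Fin 1 → Fin 2) : s = fun _ => s 0 := by
  funext i
  rw [Subsingleton.elim i 0]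

include hinj in
theorem coeffOn_injective_single (s : Fin 1 → Fin 2) :
    Function.Injective (coeffOn κ (inf_le_cechOpen (U := U) s)) := by
  refine coeffOn_injective_of_eq hle hinj _ (s 0) ?_
  conv_lhs => rw [single_eq s]
  exact cechOpen_const _

theorem coeffOn_cechD_zero (b : X.CechCochains U p 0) (s : Fin 2 → Fin 2) :
    coeffOn κ (inf_le_cechOpen s) (X.cechD U p 0 b s) =
      coeffOn κ (inf_le_cechOpen _) (b fun _ => s 1) -
        coeffOn κ (inf_le_cechOpen _) (b fun _ => s 0) := by
  have h : ∀ (t t' : Fin 1 → Fin 2), t = t' → coeffOn κ (inf_le_cechOpen t) (b t) =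
      coeffOn κ (inf_le_cechOpen t') (b t') := by
    rintro t _ rfl
    rfl
  rw [coeffOn_cechD, Fin.sum_univ_two,
    h (s ∘ Fin.succAbove 0) (fun _ => s 1) (by funext i; rw [Subsingleton.elim i 0]; rfl),
    h (s ∘ Fin.succAbove 1) (fun _ => s 0) (by funext i; rw [Subsingleton.elim i 0]; rfl)]
  simp [sub_eq_add_neg]

theorem coeffOn_cechD_one (c : X.CechCochains U p 1) (s : Fin 3 → Fin 2) :
    coeffOn κ (inf_le_cechOpen s) (X.cechD U p 1 c s) =
      coeffOn κ (inf_le_cechOpen _) (c ![s 1, s 2]) -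
        coeffOn κ (inf_le_cechOpen _) (c ![s 0, s 2]) +
        coeffOn κ (inf_le_cechOpen _) (c ![s 0, s 1]) := by
  have h : ∀ (t t' : Fin 2 → Fin 2), t = t' → coeffOn κ (inf_le_cechOpen t) (c t) =
      coeffOn κ (inf_le_cechOpen t') (c t') := by
    rintro t _ rfl
    rfl
  rw [coeffOn_cechD, Fin.sum_univ_three,
    h (s ∘ Fin.succAbove 0) ![s 1, s 2] (by funext i; fin_cases i <;> rfl),
    h (s ∘ Fin.succAbove 1) ![s 0, s 2] (by funext i; fin_cases i <;> rfl),
    h (s ∘ Fin.succAbove 2) ![s 0, s 1] (by funext i; fin_cases i <;> rfl)]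
  simp [sub_eq_add_neg]

include hW in
theorem coeffOn_single_mem (s : Fin 1 → Fin 2) (ω : X.Forms p (X.cechOpen U s)) :
    coeffOn κ (inf_le_cechOpen s) ω ∈ W (s 0) := by
  rw [← range_coeffOn_of_eq hle hW (inf_le_cechOpen s) (s 0) (by
    conv_lhs => rw [single_eq s]
    exact cechOpen_const _)]
  exact LinearMap.mem_range_self _ _

include hW in
theorem exists_cochain_zero (w : Fin 2 → L) (hw : ∀ i, w i ∈ W i) :
    ∃ b : X.CechCochains U p 0, ∀ s, coeffOn κ (inf_le_cechOpen s) (b s) = w (s 0) := by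
  have h : ∀ s : Fin 1 → Fin 2, ∃ ω : X.Forms p (X.cechOpen U s),
      coeffOn κ (inf_le_cechOpen s) ω = w (s 0) := by
    intro s
    have := hw (s 0)
    rwa [← range_coeffOn_of_eq hle hW (inf_le_cechOpen s) (s 0) (by
      conv_lhs => rw [single_eq s]
      exact cechOpen_const _)] at this
  choose b hb using h
  exact ⟨b, hb⟩

include hκ hinj in
theorem mem_ker_cechD_zero (b : X.CechCochains U p 0) :
    b ∈ LinearMap.ker (X.cechD U p 0) ↔
      coeffOn κ (inf_le_cechOpen _) (b fun _ => 1) =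
        coeffOn κ (inf_le_cechOpen _) (b fun _ => 0) := by
  rw [LinearMap.mem_ker]
  constructor
  · intro h
    have := coeffOn_cechD_zero (κ := κ) b ![0, 1]
    rw [h, Pi.zero_apply, map_zero, eq_comm, sub_eq_zero] at this
    exact this
  · intro h
    funext s
    refine coeffOn_injective_pair hκ hle hinj s ?_
    rw [coeffOn_cechD_zero, Pi.zero_apply, map_zero, sub_eq_zero]
    generalize s 0 = i
    generalize s 1 = j
    fin_cases i <;> fin_cases j
    · rfl
    · exact h
    · exact h.symm
    · rfl

include hκ hinj hW in
-- A `0`-cocycle is a pair of forms on the two open sets with the same coefficients, that is, one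
-- vector of `W 0 ∩ W 1`.
theorem hodgeNumber_zero_of_coeff : X.hodgeNumber U p 0 = Module.finrank ℂ ↥(W 0 ⊓ W 1) := by
  have h0 : X.hodgeNumber U p 0 = Module.finrank ℂ (LinearMap.ker (X.cechD U p 0)) := by
    refine (LinearEquiv.finrank_eq (Submodule.equivMapOfInjective _ ?_ _)).symm
    rw [← LinearMap.ker_eq_bot, Submodule.ker_mkQ]
    rfl
  rw [h0]
  let θ : X.CechCochains U p 0 →ₗ[ℂ] L :=
    coeffOn κ (inf_le_cechOpen (fun _ => 0)) ∘ₗ LinearMap.proj (fun _ => 0)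
  have hθ : ∀ b ∈ LinearMap.ker (X.cechD U p 0), θ b ∈ W 0 ⊓ W 1 := by
    intro b hb
    refine ⟨coeffOn_single_mem hle hW (fun _ => 0) (b fun _ => 0), ?_⟩
    have h := (mem_ker_cechD_zero hκ hle hinj b).1 hb
    change coeffOn κ _ (b fun _ => 0) ∈ W 1
    rw [← h]
    exact coeffOn_single_mem hle hW (fun _ => 1) (b fun _ => 1)
  refine LinearEquiv.finrank_eq (LinearEquiv.ofBijective (θ.restrict hθ) ⟨?_, ?_⟩)
  · rintro ⟨b, hb⟩ ⟨b', hb'⟩ h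
    have h : θ b = θ b' := congrArg Subtype.val h
    refine Subtype.ext (funext fun s => ?_)
    refine coeffOn_injective_single hle hinj s ?_
    have h1 := (mem_ker_cechD_zero hκ hle hinj b).1 hb
    have h2 := (mem_ker_cechD_zero hκ hle hinj b').1 hb'
    rw [single_eq s]
    generalize s 0 = i
    fin_cases i
    · exact h
    · exact h1.trans (Eq.trans h h2.symm)
  · rintro ⟨w, hw⟩
    obtain ⟨b, hb⟩ := exists_cochain_zero hle hW (fun _ => w) (by
      intro i
      fin_cases i
      · exact hw.1
      · exact hw.2)
    exact ⟨⟨b, (mem_ker_cechD_zero hκ hle hinj b).2 ((hb _).trans (hb _).symm)⟩,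
      Subtype.ext (hb _)⟩

include hκ hinj in
-- The cocycle relation at `(i, i, i)` gives `c(i, i) = 0`, and at `(0, 1, 0)` it gives `c(1, 0) =
-- -c(0, 1)`; the entry at `(0, 1)` determines the rest.
theorem eq_of_mem_ker_cechD_one {c c' : X.CechCochains U p 1}
    (hc : c ∈ LinearMap.ker (X.cechD U p 1)) (hc' : c' ∈ LinearMap.ker (X.cechD U p 1))
    (h : coeffOn κ (inf_le_cechOpen _) (c ![0, 1]) =
      coeffOn κ (inf_le_cechOpen _) (c' ![0, 1])) : c = c' := by
  have key : ∀ c ∈ LinearMap.ker (X.cechD U p 1), (∀ i : Fin 2,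
      coeffOn κ (inf_le_cechOpen _) (c ![i, i]) = 0) ∧
      coeffOn κ (inf_le_cechOpen _) (c ![1, 0]) =
        - coeffOn κ (inf_le_cechOpen _) (c ![0, 1]) := by
    intro c hc
    rw [LinearMap.mem_ker] at hc
    have hi : ∀ i : Fin 2, coeffOn κ (inf_le_cechOpen _) (c ![i, i]) = 0 := by
      intro i
      have := coeffOn_cechD_one (κ := κ) c ![i, i, i]
      rw [hc, Pi.zero_apply, map_zero] at this
      have h2 : (0 : L) = coeffOn κ (inf_le_cechOpen _) (c ![i, i]) -
        coeffOn κ (inf_le_cechOpen _) (c ![i, i]) +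
        coeffOn κ (inf_le_cechOpen _) (c ![i, i]) := this
      rw [sub_self, zero_add] at h2
      exact h2.symm
    refine ⟨hi, ?_⟩
    have := coeffOn_cechD_one (κ := κ) c ![0, 1, 0]
    rw [hc, Pi.zero_apply, map_zero] at this
    have h2 : (0 : L) = coeffOn κ (inf_le_cechOpen _) (c ![1, 0]) -
        coeffOn κ (inf_le_cechOpen _) (c ![0, 0]) +
        coeffOn κ (inf_le_cechOpen _) (c ![0, 1]) := this
    rw [hi, sub_zero] at h2
    exact eq_neg_of_add_eq_zero_left h2.symm
  obtain ⟨h1, h2⟩ := key c hc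
  obtain ⟨h1', h2'⟩ := key c' hc'
  funext s
  refine coeffOn_injective_pair hκ hle hinj s ?_
  have hs : s = ![s 0, s 1] := by
    funext i
    fin_cases i <;> rfl
  rw [hs]
  generalize s 0 = i
  generalize s 1 = j
  fin_cases i <;> fin_cases j
  · exact (h1 0).trans (h1' 0).symm
  · exact h
  · exact h2.trans ((congrArg _ h).trans h2'.symm)
  · exact (h1 1).trans (h1' 1).symm

include hκ hinj in
theorem exists_mem_ker_cechD_one (w : L) : ∃ c ∈ LinearMap.ker (X.cechD U p 1),
    coeffOn κ (inf_le_cechOpen _) (c ![0, 1]) = w := by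
  let a : Fin 2 → Fin 2 → L := fun i j => if i = j then 0 else if i = 0 then w else -w
  have h : ∀ s : Fin 2 → Fin 2, ∃ ω : X.Forms p (X.cechOpen U s),
      coeffOn κ (inf_le_cechOpen s) ω = a (s 0) (s 1) := by
    intro s
    by_cases h : s 0 = s 1
    · exact ⟨0, by rw [map_zero]; exact (if_pos h).symm⟩
    · exact (coeffOn_bijective_of_eq hκ _ (cechOpen_ne h)).2 _
  choose c hc using h
  refine ⟨c, ?_, hc _⟩
  rw [LinearMap.mem_ker]
  funext s
  have hinj3 : Function.Injective (coeffOn κ (inf_le_cechOpen (U := U) s)) := by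
    obtain ⟨i, hi⟩ | hi := cechOpen_eq_or (U := U) s
    · exact coeffOn_injective_of_eq hle hinj _ i hi
    · exact (coeffOn_bijective_of_eq hκ _ hi).1
  refine hinj3 ?_
  rw [coeffOn_cechD_one, hc, hc, hc, Pi.zero_apply, map_zero]
  change a (s 1) (s 2) - a (s 0) (s 2) + a (s 0) (s 1) = 0
  generalize s 0 = i
  generalize s 1 = j
  generalize s 2 = k
  fin_cases i <;> fin_cases j <;> fin_cases k <;> simp [a]

theorem finrank_map_mkQ {C Q : Type*} [AddCommGroup C] [Module ℂ C] [AddCommGroup Q] [Module ℂ Q]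
    (K B : Submodule ℂ C) (f : C →ₗ[ℂ] Q) (hB : B ≤ LinearMap.ker f)
    (hK : ∀ c ∈ K, f c = 0 → c ∈ B) (hf : ∀ w, ∃ c ∈ K, f c = w) :
    Module.finrank ℂ (K.map B.mkQ) = Module.finrank ℂ Q := by
  refine LinearEquiv.finrank_eq (LinearEquiv.ofBijective
    ((B.liftQ f hB).domRestrict _) ⟨?_, fun w => ?_⟩)
  · rw [← LinearMap.ker_eq_bot, LinearMap.ker_eq_bot']
    rintro ⟨_, c, hc, rfl⟩ h
    exact Subtype.ext ((Submodule.Quotient.mk_eq_zero B).2 (hK c hc h))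
  · obtain ⟨c, hc, rfl⟩ := hf w
    exact ⟨⟨_, c, hc, rfl⟩, rfl⟩

include hκ hinj hW in
-- A `1`-cocycle is an arbitrary vector of `L`, its entry at `(0, 1)`, and coboundaries change it by
-- differences of elements of `W 1` and `W 0`.
theorem hodgeNumber_one_of_coeff : X.hodgeNumber U p 1 = Module.finrank ℂ (L ⧸ (W 0 ⊔ W 1)) := by
  let f : X.CechCochains U p 1 →ₗ[ℂ] L ⧸ (W 0 ⊔ W 1) :=
    (W 0 ⊔ W 1).mkQ ∘ₗ coeffOn κ (inf_le_cechOpen ![0, 1]) ∘ₗ LinearMap.proj ![0, 1]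
  have hf : ∀ c, f c = (W 0 ⊔ W 1).mkQ (coeffOn κ (inf_le_cechOpen ![0, 1]) (c ![0, 1])) :=
    fun _ => rfl
  have hB : X.cechBoundaries U p 1 ≤ LinearMap.ker f := by
    rintro _ ⟨b, rfl⟩
    rw [LinearMap.mem_ker, hf, coeffOn_cechD_zero, ← LinearMap.mem_ker, Submodule.ker_mkQ]
    exact sub_mem (Submodule.mem_sup_right (coeffOn_single_mem hle hW (fun _ => 1) _))
      (Submodule.mem_sup_left (coeffOn_single_mem hle hW (fun _ => 0) _))
  refine finrank_map_mkQ _ _ f hB (fun c hc h => ?_) fun w => ?_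
  · rw [hf, ← LinearMap.mem_ker, Submodule.ker_mkQ, Submodule.mem_sup] at h
    obtain ⟨w0, hw0, w1, hw1, h⟩ := h
    -- The coboundary at `(0, 1)` is the second entry minus the first, hence the sign of `w0`.
    obtain ⟨b, hb⟩ := exists_cochain_zero hle hW ![-w0, w1] (by
      intro i
      fin_cases i
      · exact neg_mem hw0
      · exact hw1)
    refine ⟨b, (eq_of_mem_ker_cechD_one hκ hle hinj hc (cechD_cechD b) ?_).symm⟩
    rw [coeffOn_cechD_zero, hb, hb, ← h]
    change w0 + w1 = w1 - -w0
    rw [sub_neg_eq_add, add_comm]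
  · obtain ⟨w, rfl⟩ := Submodule.mkQ_surjective _ w
    obtain ⟨c, hc, hcw⟩ := exists_mem_ker_cechD_one hκ hle hinj w
    exact ⟨c, hc, congrArg _ hcw⟩

theorem hodgeNumber_eq_zero_of_two_le {q : ℕ} (hq : 2 ≤ q) : X.hodgeNumber U p q = 0 := by
  obtain ⟨k, rfl⟩ := Nat.exists_eq_add_of_le' hq
  have h : (LinearMap.ker (X.cechD U p (k + 2))).map (X.cechBoundaries U p (k + 2)).mkQ = ⊥ := by
    rw [eq_bot_iff, Submodule.map_le_iff_le_comap]
    intro c hc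
    rw [Submodule.mem_comap, Submodule.mem_bot, ← LinearMap.mem_ker, Submodule.ker_mkQ]
    exact ker_cechD_le_range hc
  rw [hodgeNumber, h, finrank_bot]

end CVariety

end Stringy

namespace Stringy

/-! ### Differential forms on the affine line and the punctured affine line -/

/-- A spanning family sent to nonzero multiples of distinct basis vectors is linearly independent.
This yields freeness of the forms and their exponents at once, without computing modules of
differentials. -/
theorem injective_and_range_of_apply_single {I V : Type*} [AddCommGroup V] [Module ℂ V]
    (v : I → V) (hv : Submodule.span ℂ (Set.range v) = ⊤) (g : V →ₗ[ℂ] (ℤ →₀ ℂ)) (ι : I → ℤ)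
    (hι : Function.Injective ι) (u : ℂ) (hu : u ≠ 0)
    (hg : ∀ i, g (v i) = u • Finsupp.single (ι i) 1) :
    Function.Injective g ∧ LinearMap.range g = Finsupp.supported ℂ ℂ (Set.range ι) := by
  have hsurj : ∀ x, ∃ a, Finsupp.linearCombination ℂ v a = x := by
    intro x
    have : x ∈ LinearMap.range (Finsupp.linearCombination ℂ v) := by
      rw [Finsupp.range_linearCombination, hv]
      trivial
    exact this
  have hcomp : g ∘ₗ Finsupp.linearCombination ℂ v = u • Finsupp.lmapDomain ℂ ℂ ι := by
    refine Finsupp.lhom_ext' fun i => LinearMap.ext_ring ?_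
    simp [hg]
  constructor
  · rw [← LinearMap.ker_eq_bot, LinearMap.ker_eq_bot']
    intro x hx
    obtain ⟨a, rfl⟩ := hsurj x
    have h := LinearMap.congr_fun hcomp a
    rw [LinearMap.comp_apply, hx, LinearMap.smul_apply, eq_comm, smul_eq_zero] at h
    have h2 := h.resolve_left hu
    rw [Finsupp.lmapDomain_apply, ← Finsupp.mapDomain_zero (f := ι)] at h2
    rw [Finsupp.mapDomain_injective hι h2, map_zero]
  · rw [Finsupp.supported_eq_span_single, LinearMap.range_eq_map, ← hv, Submodule.map_span,
      ← Set.range_comp, ← Set.range_comp]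
    refine le_antisymm (Submodule.span_le.2 ?_) (Submodule.span_le.2 ?_)
    · rintro _ ⟨i, rfl⟩
      rw [Function.comp_apply, hg]
      exact Submodule.smul_mem _ _ (Submodule.subset_span ⟨i, rfl⟩)
    · rintro _ ⟨i, rfl⟩
      have : (Finsupp.single (ι i) 1 : ℤ →₀ ℂ) = u⁻¹ • (g ∘ v) i := by
        rw [Function.comp_apply, hg, smul_smul, inv_mul_cancel₀ hu, one_smul]
      rw [Function.comp_apply, this]
      exact Submodule.smul_mem _ _ (Submodule.subset_span ⟨i, rfl⟩)

section

variable {A : Type} [CommRing A] [Algebra ℂ A]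

theorem span_D_eq_top_of_adjoin {s : Set A} (h : Algebra.adjoin ℂ s = ⊤) :
    Submodule.span A (KaehlerDifferential.D ℂ A '' s) = ⊤ := by
  rw [← top_le_iff, ← KaehlerDifferential.span_range_derivation, Submodule.span_le]
  rintro _ ⟨x, rfl⟩
  have hx : x ∈ Algebra.adjoin ℂ s := h ▸ trivial
  induction hx using Algebra.adjoin_induction with
  | mem x hx => exact Submodule.subset_span ⟨x, hx, rfl⟩
  | algebraMap r => simp
  | add x y _ _ hx hy => rw [map_add]; exact add_mem hx hy
  | mul x y _ _ hx hy =>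
    rw [Derivation.leibniz]
    exact add_mem (Submodule.smul_mem _ _ hy) (Submodule.smul_mem _ _ hx)

/-- The form `ω ∧ ⋯ ∧ ω`, of interest for `p ≤ 1`. -/
noncomputable abbrev formGen (p : ℕ) (ω : Ω[A⁄ℂ]) : ⋀[A]^p Ω[A⁄ℂ] :=
  exteriorPower.ιMulti A p fun _ => ω

theorem ιMulti_smul_const (p : ℕ) (ω : Ω[A⁄ℂ]) (h : Submodule.span A {ω} = ⊤)
    (v : Fin p → Ω[A⁄ℂ]) : ∃ a : A, exteriorPower.ιMulti A p v = a • formGen p ω := by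
  have hv : ∀ i, ∃ a : A, a • ω = v i := fun i =>
    Submodule.mem_span_singleton.1 (h ▸ trivial)
  choose a ha using hv
  refine ⟨∏ i, a i, ?_⟩
  have : v = fun i => a i • (fun _ => ω : Fin p → Ω[A⁄ℂ]) i := funext fun i => (ha i).symm
  rw [this]
  exact AlternatingMap.map_smul_univ _ _ _

theorem span_formGen {ω : Ω[A⁄ℂ]} (h : Submodule.span A {ω} = ⊤) (p : ℕ) :
    Submodule.span A {formGen p ω} = ⊤ := by
  rw [← top_le_iff, ← exteriorPower.ιMulti_span, Submodule.span_le]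
  rintro _ ⟨v, rfl⟩
  obtain ⟨a, ha⟩ := ιMulti_smul_const p ω h v
  rw [ha]
  exact Submodule.smul_mem _ _ (Submodule.subset_span rfl)

/-- All `p`-forms are multiples of `ω ∧ ⋯ ∧ ω`, which vanishes as soon as a factor is repeated. -/
theorem subsingleton_forms {ω : Ω[A⁄ℂ]} (h : Submodule.span A {ω} = ⊤) {p : ℕ} (hp : 2 ≤ p) :
    Subsingleton (⋀[A]^p Ω[A⁄ℂ]) := by
  rw [← Submodule.subsingleton_iff A, ← subsingleton_iff_bot_eq_top, ← span_formGen h p]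
  have : formGen p ω = 0 :=
    AlternatingMap.map_eq_zero_of_eq _ _ (i := ⟨0, by omega⟩) (j := ⟨1, by omega⟩) rfl (by simp)
  rw [this, Submodule.span_zero_singleton]

theorem span_smul_formGen {ω : Ω[A⁄ℂ]} (h : Submodule.span A {ω} = ⊤) (p : ℕ) {I : Type*}
    (a : I → A) (ha : Submodule.span ℂ (Set.range a) = ⊤) :
    Submodule.span ℂ (Set.range fun i => a i • formGen p ω) = ⊤ := by
  have h1 := Submodule.span_smul_of_span_eq_top ha {formGen p ω}
  rw [span_formGen h, Submodule.restrictScalars_top, Set.smul_singleton, ← Set.range_comp] at h1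
  exact h1

end

section

open LaurentPolynomial

/-- The linear map `Tⁿ ↦ n Tⁿ`. -/
noncomputable def eulerMap : ℂ[T;T⁻¹] →ₗ[ℂ] ℂ[T;T⁻¹] :=
  (Finsupp.linearCombination ℂ fun n : ℤ => (n : ℂ) • (T n : ℂ[T;T⁻¹])) ∘ₗ
    (AddMonoidAlgebra.coeffLinearEquiv ℂ).toLinearMap

theorem eulerMap_T (n : ℤ) : eulerMap (T n) = (n : ℂ) • T n := by
  change Finsupp.linearCombination ℂ _ (Finsupp.single n 1) = _
  rw [Finsupp.linearCombination_single, one_smul]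

/-- Linear maps from Laurent polynomials that agree on the powers of the variable are equal. -/
theorem laurent_hom_ext {M : Type*} [AddCommMonoid M] [Module ℂ M] {f g : ℂ[T;T⁻¹] →ₗ[ℂ] M}
    (h : ∀ n : ℤ, f (T n) = g (T n)) : f = g :=
  AddMonoidAlgebra.lhom_ext' fun n => LinearMap.ext_ring (h n)

/-- The derivation `T d/dT` of the ring of Laurent polynomials. -/
noncomputable def eulerDerivation : Derivation ℂ ℂ[T;T⁻¹] ℂ[T;T⁻¹] :=
  Derivation.mk' eulerMap fun a b => by
    have h : eulerMap ∘ₗ LinearMap.mulLeft ℂ a =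
        LinearMap.mulLeft ℂ a ∘ₗ eulerMap + LinearMap.mulRight ℂ (eulerMap a) := by
      refine laurent_hom_ext fun n => ?_
      have h' : eulerMap ∘ₗ LinearMap.mulRight ℂ (T n) =
          (n : ℂ) • LinearMap.mulRight ℂ (T n) + LinearMap.mulRight ℂ (T n) ∘ₗ eulerMap := by
        refine laurent_hom_ext fun m => ?_
        simp only [LinearMap.comp_apply, LinearMap.mulRight_apply, LinearMap.add_apply,
          LinearMap.smul_apply, eulerMap_T, ← T_add, smul_mul_assoc]
        rw [← add_smul]
        push_cast
        rw [add_comm (n : ℂ)]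
      have h2 := LinearMap.congr_fun h' a
      simp only [LinearMap.comp_apply, LinearMap.mulRight_apply, LinearMap.add_apply,
          LinearMap.smul_apply] at h2
      simp only [LinearMap.comp_apply, LinearMap.mulRight_apply, LinearMap.mulLeft_apply,
        LinearMap.add_apply, eulerMap_T, h2, mul_smul_comm]
      rw [mul_comm (T n)]
    have h2 := LinearMap.congr_fun h b
    simpa only [LinearMap.comp_apply, LinearMap.mulRight_apply, LinearMap.mulLeft_apply,
        LinearMap.add_apply, smul_eq_mul] using h2

theorem eulerDerivation_T (n : ℤ) : eulerDerivation (T n) = (n : ℂ) • T n :=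
  eulerMap_T n

theorem adjoin_T : Algebra.adjoin ℂ {(T 1 : ℂ[T;T⁻¹]), T (-1)} = ⊤ := by
  rw [← top_le_iff]
  intro f _
  induction f using LaurentPolynomial.induction_on' with
  | add p q hp hq => exact add_mem (hp trivial) (hq trivial)
  | C_mul_T n a =>
    rw [← smul_eq_C_mul]
    refine Subalgebra.smul_mem _ ?_ a
    have h1 : (T 1 : ℂ[T;T⁻¹]) ∈ Algebra.adjoin ℂ {(T 1 : ℂ[T;T⁻¹]), T (-1)} :=
      Algebra.subset_adjoin (by simp)
    have h2 : (T (-1) : ℂ[T;T⁻¹]) ∈ Algebra.adjoin ℂ {(T 1 : ℂ[T;T⁻¹]), T (-1)} :=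
      Algebra.subset_adjoin (by simp)
    obtain ⟨k, rfl | rfl⟩ := Int.eq_nat_or_neg n
    · have := T_pow (R := ℂ) 1 k
      rw [mul_one] at this
      rw [← this]
      exact Subalgebra.pow_mem _ h1 k
    · have := T_pow (R := ℂ) (-1) k
      rw [mul_neg_one] at this
      rw [← this]
      exact Subalgebra.pow_mem _ h2 k

variable {A B : Type} [CommRing A] [CommRing B] [Algebra ℂ A] [Algebra ℂ B]

/-- The ring is generated by `T` and `T⁻¹`, and the differential of an inverse is a multiple of the
differential. -/
theorem span_D_laurent (e : ℂ[T;T⁻¹] ≃ₐ[ℂ] B) :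
    Submodule.span B {KaehlerDifferential.D ℂ B (e (T 1))} = ⊤ := by
  have h : Algebra.adjoin ℂ ({e (T 1), e (T (-1))} : Set B) = ⊤ := by
    have := congrArg (Subalgebra.map e.toAlgHom) adjoin_T
    rw [AlgHom.map_adjoin, Algebra.map_top, (AlgHom.range_eq_top e.toAlgHom).2 e.surjective] at this
    rw [← this, Set.image_pair]
    rfl
  rw [← top_le_iff, ← span_D_eq_top_of_adjoin h, Submodule.span_le, Set.image_pair]
  rintro _ (rfl | rfl)
  · exact Submodule.subset_span rfl
  · have hm : e (T (-1)) * e (T 1) = 1 := by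
      rw [← map_mul, ← T_add]
      exact map_one e
    rw [Derivation.leibniz_of_mul_eq_one _ hm]
    exact Submodule.smul_mem _ _ (Submodule.subset_span rfl)

theorem span_D_polynomial (e : Polynomial ℂ →ₐ[ℂ] A) (he : Function.Surjective e) :
    Submodule.span A {KaehlerDifferential.D ℂ A (e Polynomial.X)} = ⊤ := by
  have h : Algebra.adjoin ℂ ({e Polynomial.X} : Set A) = ⊤ := by
    have := congrArg (Subalgebra.map e) (Polynomial.adjoin_X (R := ℂ))
    rw [AlgHom.map_adjoin, Algebra.map_top, (AlgHom.range_eq_top e).2 he, Set.image_singleton]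
      at this
    exact this
  rw [← span_D_eq_top_of_adjoin h, Set.image_singleton]

/-- The coefficient of a form of degree at most one on the punctured line with respect to
`(dT/T)ᵖ`. -/
theorem exists_formCoeff (e : ℂ[T;T⁻¹] ≃ₐ[ℂ] B) (p : ℕ) (hp : p ≤ 1) :
    ∃ κ : ⋀[B]^p Ω[B⁄ℂ] →ₗ[B] B, ∀ n : ℤ,
      κ (formGen p (KaehlerDifferential.D ℂ B (e (T n)))) = e ((n : ℂ) ^ p • T (n * p)) := by
  obtain rfl | rfl : p = 0 ∨ p = 1 := by omega
  · refine ⟨(exteriorPower.zeroEquiv B _).toLinearMap, fun n => ?_⟩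
    refine (exteriorPower.zeroEquiv_ιMulti _).trans ?_
    simp
  -- For `p = 1` the coefficient with respect to `dT/T` is the linear form on differentials induced
  -- by `T d/dT`, transported along `e`.
  · let D : Derivation ℂ B B := Derivation.mk'
      (e.toLinearMap ∘ₗ eulerDerivation.toLinearMap ∘ₗ e.symm.toLinearMap) fun a b => by
        change e (eulerDerivation (e.symm (a * b))) =
          a • e (eulerDerivation (e.symm b)) + b • e (eulerDerivation (e.symm a))
        rw [map_mul, Derivation.leibniz, map_add, smul_eq_mul, smul_eq_mul, map_mul, map_mul,
          e.apply_symm_apply, e.apply_symm_apply]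
        rfl
    refine ⟨D.liftKaehlerDifferential ∘ₗ (exteriorPower.oneEquiv B _).toLinearMap, fun n => ?_⟩
    have h1 := exteriorPower.oneEquiv_ιMulti (R := B) (M := Ω[B⁄ℂ])
      (fun _ => KaehlerDifferential.D ℂ B (e (T n)))
    change D.liftKaehlerDifferential (exteriorPower.oneEquiv B _ (exteriorPower.ιMulti B 1 _)) = _
    rw [h1, Derivation.liftKaehlerDifferential_comp_D]
    change e (eulerDerivation (e.symm (e (T n)))) = _
    rw [e.symm_apply_apply, eulerDerivation_T]
    simp

/-- The coefficients of the forms of degree at most one on the punctured line, and of their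
restrictions from the two lines with coordinates `T` and `T⁻¹`. -/
theorem exists_forms_coeff (e : ℂ[T;T⁻¹] ≃ₐ[ℂ] B) (p : ℕ) (hp : p ≤ 1) :
    ∃ κ : ⋀[B]^p Ω[B⁄ℂ] →ₗ[ℂ] (ℤ →₀ ℂ), Function.Bijective κ ∧
      ∀ (A : Type) [CommRing A] [Algebra ℂ A] [Algebra A B] [IsScalarTower ℂ A B]
        (f : Polynomial ℂ →ₐ[ℂ] A) (_ : Function.Surjective f) (ε : ℤ) (_ : ε ≠ 0)
        (_ : algebraMap A B (f Polynomial.X) = e (T ε)),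
        Function.Injective (κ ∘ₗ (formMap A B p).restrictScalars ℂ) ∧
        LinearMap.range (κ ∘ₗ (formMap A B p).restrictScalars ℂ) =
          Finsupp.supported ℂ ℂ (Set.range fun n : ℕ => ε * (n + p)) := by
  obtain ⟨κ, hκ⟩ := exists_formCoeff e p hp
  let κ' : ⋀[B]^p Ω[B⁄ℂ] →ₗ[ℂ] (ℤ →₀ ℂ) := (AddMonoidAlgebra.coeffLinearEquiv ℂ).toLinearMap ∘ₗ
    e.symm.toLinearMap ∘ₗ κ.restrictScalars ℂ
  -- This is `Tᵐ (dTⁿ)ᵖ = nᵖ T^{m + np} (dT/T)ᵖ`. With the coordinate `T^ε` of a line, the forms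
  -- `(T^ε)ⁿ (dT^ε)ᵖ` have exponents `ε(n + p)`.
  have key : ∀ m n : ℤ, κ' (e (T m) • formGen p (KaehlerDifferential.D ℂ B (e (T n)))) =
      ((n : ℂ) ^ p) • Finsupp.single (m + n * p) 1 := by
    intro m n
    change (AddMonoidAlgebra.coeffLinearEquiv ℂ) (e.symm (κ _)) = _
    rw [κ.map_smul, hκ, smul_eq_mul, ← map_mul, e.symm_apply_apply, mul_smul_comm, ← T_add,
      map_smul]
    rfl
  have hspanT : Submodule.span ℂ (Set.range fun m : ℤ => e (T m)) = ⊤ := by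
    have h := congrArg (Submodule.map e.toLinearMap) (AddMonoidAlgebra.basis ℤ ℂ).span_eq
    rw [Submodule.map_span, Submodule.map_top, LinearMap.range_eq_top.2 e.surjective,
      ← Set.range_comp] at h
    exact h
  refine ⟨κ', ?_, ?_⟩
  · obtain ⟨h1, h2⟩ := injective_and_range_of_apply_single _
      (span_smul_formGen (span_D_laurent e) p _ hspanT) κ' (fun m => m + 1 * p)
      (add_left_injective _) _ (pow_ne_zero p (by simp : ((1 : ℤ) : ℂ) ≠ 0)) (fun m => key m 1)
    refine ⟨h1, LinearMap.range_eq_top.1 ?_⟩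
    rw [h2, ← Finsupp.supported_univ]
    congr 1
    exact (add_right_surjective _).range_eq
  · intro A _ _ _ _ f hf ε hε hfε
    have hspanX : Submodule.span ℂ (Set.range fun n : ℕ => f (Polynomial.X ^ n)) = ⊤ := by
      have h := congrArg (Submodule.map f.toLinearMap) (Polynomial.basisMonomials ℂ).span_eq
      rw [Submodule.map_span, Submodule.map_top, LinearMap.range_eq_top.2 hf,
        ← Set.range_comp] at h
      rw [← h]
      congr 2
      funext n
      simp [Polynomial.monomial_one_right_eq_X_pow]
    have hg : ∀ n : ℕ, (κ' ∘ₗ (formMap A B p).restrictScalars ℂ)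
        (f (Polynomial.X ^ n) • formGen p (KaehlerDifferential.D ℂ A (f Polynomial.X))) =
        ((ε : ℂ) ^ p) • Finsupp.single (ε * (n + p)) 1 := by
      intro n
      change κ' (formMap A B p _) = _
      rw [(formMap A B p).map_smul, formMap_ιMulti, ← algebraMap_smul B, map_pow, map_pow, hfε,
        ← map_pow, T_pow]
      have hm : (fun _ : Fin p => KaehlerDifferential.map ℂ ℂ A B
          (KaehlerDifferential.D ℂ A (f Polynomial.X))) =
          fun _ => KaehlerDifferential.D ℂ B (e (T ε)) := by
        rw [KaehlerDifferential.map_D, hfε]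
      rw [hm]
      refine (key _ _).trans ?_
      rw [mul_comm (n : ℤ), ← mul_add]
    exact injective_and_range_of_apply_single _
      (span_smul_formGen (span_D_polynomial f hf) p _ hspanX) _ _
      (fun m n h => by simpa [hε] using h) _ (pow_ne_zero p (Int.cast_ne_zero.2 hε)) hg

end

end Stringy

/-! ### Hodge numbers of two affine lines glued along the punctured line -/

namespace Stringy

theorem finrank_supported (s : Set ℤ) :
    Module.finrank ℂ (Finsupp.supported ℂ ℂ s) = Nat.card s := by
  rw [LinearEquiv.finrank_eq (Finsupp.supportedEquivFinsupp s)]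
  rcases finite_or_infinite s with h | h
  · have := Fintype.ofFinite s
    rw [Module.finrank_finsupp_self, Nat.card_eq_fintype_card]
  -- For infinite `s` both `finrank` and `Nat.card` take the default value `0`.
  · rw [Nat.card_eq_zero_of_infinite, Module.finrank, rank_finsupp_self, Cardinal.toNat_lift,
      Cardinal.mk_toNat_of_infinite]

theorem finrank_quotient_supported (s : Set ℤ) :
    Module.finrank ℂ ((ℤ →₀ ℂ) ⧸ Finsupp.supported ℂ ℂ s) = Nat.card ↥sᶜ := by
  have h : IsCompl (Finsupp.supported ℂ ℂ s) (Finsupp.supported ℂ ℂ sᶜ) := by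
    constructor
    · exact Finsupp.disjoint_supported_supported disjoint_compl_right
    · rw [codisjoint_iff, ← Finsupp.supported_union, Set.union_compl_self, Finsupp.supported_univ]
  rw [LinearEquiv.finrank_eq (Submodule.quotientEquivOfIsCompl _ _ h), finrank_supported]

namespace CVariety

open LaurentPolynomial

variable {X : CVariety} {U : Fin 2 → X.X.Opens}

theorem restrictForms_eq (p : ℕ) {U V : X.X.Opens} (h : V ≤ U)
    [i : Algebra Γ(X.X, U) Γ(X.X, V)] [IsScalarTower ℂ Γ(X.X, U) Γ(X.X, V)]
    (hi : algebraMap Γ(X.X, U) Γ(X.X, V) = (X.X.presheaf.map (homOfLE h).op).hom) :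
    X.restrictForms p h = (formMap Γ(X.X, U) Γ(X.X, V) p).restrictScalars ℂ := by
  obtain rfl : i = (X.X.presheaf.map (homOfLE h).op).hom.toAlgebra :=
    Algebra.algebra_ext _ _ fun r => RingHom.congr_fun hi r
  rfl

/-- The Hodge numbers of a variety covered by two affine lines with coordinates `T` and `T⁻¹`. -/
theorem hodgeNumber_of_charts (f : ∀ i, Polynomial ℂ →ₐ[ℂ] Γ(X.X, U i))
    (hf : ∀ i, Function.Surjective (f i)) (e : ℂ[T;T⁻¹] ≃ₐ[ℂ] Γ(X.X, U 0 ⊓ U 1))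
    (hle : ∀ i, U 0 ⊓ U 1 ≤ U i)
    (h0 : X.X.presheaf.map (homOfLE (hle 0)).op (f 0 Polynomial.X) = e (T 1))
    (h1 : X.X.presheaf.map (homOfLE (hle 1)).op (f 1 Polynomial.X) = e (T (-1))) (p q : ℕ) :
    X.hodgeNumber U p q = if p = q ∧ p ≤ 1 then 1 else 0 := by
  by_cases hq : 2 ≤ q
  · rw [hodgeNumber_eq_zero_of_two_le hq, if_neg (by omega)]
  -- The exponents of `dT/T`-coefficients on the two lines: those `≥ p` and those `≤ -p`. `H⁰`
  -- counts their intersection and `H¹` the integers in neither; for `p ≤ 1` each count is `0` or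
  -- `1`.
  let S : Fin 2 → Set ℤ := ![Set.range fun n : ℕ => 1 * ((n : ℤ) + p),
    Set.range fun n : ℕ => -1 * ((n : ℤ) + p)]
  by_cases hp : 2 ≤ p
  · have hsub : ∀ s : Fin (q + 1) → Fin 2, Subsingleton (X.Forms p (X.cechOpen U s)) := by
      intro s
      obtain ⟨i, h⟩ | h := cechOpen_eq_or (U := U) s
      · rw [h]
        exact subsingleton_forms (span_D_polynomial (f i) (hf i)) hp
      · rw [h]
        exact subsingleton_forms (span_D_laurent e) hp
    have hC : Subsingleton (X.CechCochains U p q) := inferInstance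
    rw [if_neg (by omega), hodgeNumber,
      (Subsingleton.elim (LinearMap.ker (X.cechD U p q)) ⊥), Submodule.map_bot, finrank_bot]
  obtain ⟨κ, hκ, hκ'⟩ := exists_forms_coeff e p (by omega)
  have key : ∀ i, Function.Injective (coeffOn κ (hle i)) ∧
      LinearMap.range (coeffOn κ (hle i)) = Finsupp.supported ℂ ℂ (S i) := by
    intro i
    let i1 : Algebra Γ(X.X, U i) Γ(X.X, U 0 ⊓ U 1) :=
      (X.X.presheaf.map (homOfLE (hle i)).op).hom.toAlgebra
    have tower : IsScalarTower ℂ Γ(X.X, U i) Γ(X.X, U 0 ⊓ U 1) :=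
      IsScalarTower.of_algebraMap_eq' <| by
        change (X.X.presheaf.map (homOfLE le_top : U 0 ⊓ U 1 ⟶ ⊤).op).hom.comp X.toGlobal =
          (X.X.presheaf.map (homOfLE (hle i)).op).hom.comp
            ((X.X.presheaf.map (homOfLE le_top : U i ⟶ ⊤).op).hom.comp X.toGlobal)
        rw [← RingHom.comp_assoc, ← CommRingCat.hom_comp, ← Functor.map_comp]
        rfl
    have hr := restrictForms_eq (X := X) p (hle i) rfl
    rw [coeffOn, hr]
    have hk := hκ' Γ(X.X, U i) (f i) (hf i)
    fin_cases i
    · exact hk 1 one_ne_zero h0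
    · exact hk (-1) (by simp) h1
  have hq' : q = 0 ∨ q = 1 := by omega
  have hp' : p = 0 ∨ p = 1 := by omega
  obtain rfl | rfl := hq'
  · rw [hodgeNumber_zero_of_coeff (W := fun i => Finsupp.supported ℂ ℂ (S i)) hκ hle
      (fun i => (key i).1) (fun i => (key i).2), ← Finsupp.supported_inter, finrank_supported]
    obtain rfl | rfl := hp'
    · have : S 0 ∩ S 1 = {0} := by
        ext x
        simp only [S, Matrix.cons_val_zero, Matrix.cons_val_one, Set.mem_inter_iff, Set.mem_range,
          Set.mem_singleton_iff]
        exact ⟨fun ⟨⟨m, hm⟩, ⟨n, hn⟩⟩ => by omega, fun h => ⟨⟨0, by simp [h]⟩, ⟨0, by simp [h]⟩⟩⟩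
      rw [this]
      simp
    · have : S 0 ∩ S 1 = ∅ := by
        ext x
        simp only [S, Matrix.cons_val_zero, Matrix.cons_val_one, Set.mem_inter_iff, Set.mem_range,
          Set.mem_empty_iff_false, iff_false]
        rintro ⟨⟨m, hm⟩, ⟨n, hn⟩⟩
        omega
      rw [this]
      simp
  · rw [hodgeNumber_one_of_coeff (W := fun i => Finsupp.supported ℂ ℂ (S i)) hκ hle
      (fun i => (key i).1) (fun i => (key i).2), ← Finsupp.supported_union,
      finrank_quotient_supported]
    have hmem : ∀ x : ℤ, x ∈ S 0 ∪ S 1 ↔ (p : ℤ) ≤ |x| := by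
      intro x
      simp only [S, Matrix.cons_val_zero, Matrix.cons_val_one, Set.mem_union, Set.mem_range]
      constructor
      · rintro (⟨n, hn⟩ | ⟨n, hn⟩)
        · rw [le_abs]
          omega
        · rw [le_abs]
          omega
      · rw [le_abs]
        rintro (h | h)
        · exact Or.inl ⟨(x - p).toNat, by omega⟩
        · exact Or.inr ⟨(-x - p).toNat, by omega⟩
    obtain rfl | rfl := hp'
    · have : (S 0 ∪ S 1)ᶜ = ∅ := by
        ext x
        rw [Set.mem_compl_iff, hmem]
        simp
      rw [this]
      simp
    · have : (S 0 ∪ S 1)ᶜ = {0} := by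
        ext x
        rw [Set.mem_compl_iff, hmem, Set.mem_singleton_iff, Nat.cast_one]
        constructor
        · intro h
          by_contra hx
          exact h (Int.one_le_abs hx)
        · rintro rfl
          simp
      rw [this]
      simp

end CVariety

end Stringy

namespace Stringy

namespace CVariety

/-! ### Sections over an affine chart -/

variable {X : CVariety} {R S : Type} [CommRing R] [Algebra ℂ R] [CommRing S] [Algebra ℂ S]

/-- The restriction of sections of `X` to an affine scheme over `X`. -/
noncomputable def chartHom (j : Spec (CommRingCat.of R) ⟶ X.X)
    (hj : j ≫ X.str = Spec.map (CommRingCat.ofHom (algebraMap ℂ R))) (U : X.X.Opens)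
    (hU : ⊤ ≤ j ⁻¹ᵁ U) : Γ(X.X, U) →ₐ[ℂ] R where
  toRingHom := (j.appLE U ⊤ hU ≫ (Scheme.ΓSpecIso (CommRingCat.of R)).hom).hom
  commutes' c := by
    have h1 : X.X.presheaf.map (homOfLE le_top : U ⟶ ⊤).op ≫ j.appLE U ⊤ hU = j.appTop := by
      rw [Scheme.Hom.map_appLE]
      exact (Scheme.Hom.appLE_eq_app j).trans rfl
    have h2 : (Scheme.ΓSpecIso (CommRingCat.of ℂ)).inv ≫ X.str.appTop ≫
        X.X.presheaf.map (homOfLE le_top : U ⟶ ⊤).op ≫ j.appLE U ⊤ hU ≫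
          (Scheme.ΓSpecIso (CommRingCat.of R)).hom = CommRingCat.ofHom (algebraMap ℂ R) := by
      rw [reassoc_of% h1, ← Scheme.Hom.comp_appTop_assoc, hj, Scheme.ΓSpecIso_naturality,
        Iso.inv_hom_id_assoc]
    exact RingHom.congr_fun (congrArg CommRingCat.Hom.hom h2) c

theorem chartHom_map (j : Spec (CommRingCat.of R) ⟶ X.X)
    (hj : j ≫ X.str = Spec.map (CommRingCat.ofHom (algebraMap ℂ R))) {U V : X.X.Opens}
    (h : V ≤ U) (hV : ⊤ ≤ j ⁻¹ᵁ V) (s : Γ(X.X, U)) :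
    chartHom j hj V hV (X.X.presheaf.map (homOfLE h).op s) =
      chartHom j hj U (hV.trans fun _ hx => h hx) s := by
  have h1 := Scheme.Hom.map_appLE j hV (homOfLE h).op
  exact congrArg (Scheme.ΓSpecIso (CommRingCat.of R)).hom.hom
    (RingHom.congr_fun (congrArg CommRingCat.Hom.hom h1) s)

theorem chartHom_comp (j : Spec (CommRingCat.of R) ⟶ X.X)
    (hj : j ≫ X.str = Spec.map (CommRingCat.ofHom (algebraMap ℂ R)))
    (g : R →ₐ[ℂ] S) (k : Spec (CommRingCat.of S) ⟶ X.X)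
    (hk : k ≫ X.str = Spec.map (CommRingCat.ofHom (algebraMap ℂ S)))
    (hkj : k = Spec.map (CommRingCat.ofHom g.toRingHom) ≫ j) {U : X.X.Opens}
    (hU : ⊤ ≤ j ⁻¹ᵁ U) (hU' : ⊤ ≤ k ⁻¹ᵁ U) (s : Γ(X.X, U)) :
    chartHom k hk U hU' s = g (chartHom j hj U hU s) := by
  subst hkj
  have h1 : (Spec.map (CommRingCat.ofHom g.toRingHom) ≫ j).appLE U ⊤ hU' =
      j.appLE U ⊤ hU ≫ (Spec.map (CommRingCat.ofHom g.toRingHom)).appTop := by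
    have := Scheme.Hom.appLE_comp_appLE (Spec.map (CommRingCat.ofHom g.toRingHom)) j U ⊤ ⊤ hU
      (le_refl _)
    rw [← this]
    congr 1
  have h2 : (Spec.map (CommRingCat.ofHom g.toRingHom) ≫ j).appLE U ⊤ hU' ≫
      (Scheme.ΓSpecIso (CommRingCat.of S)).hom =
      (j.appLE U ⊤ hU ≫ (Scheme.ΓSpecIso (CommRingCat.of R)).hom) ≫
        CommRingCat.ofHom g.toRingHom := by
    rw [h1, Category.assoc, Scheme.ΓSpecIso_naturality, Category.assoc]
  exact RingHom.congr_fun (congrArg CommRingCat.Hom.hom h2) s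

theorem chartHom_bijective (j : Spec (CommRingCat.of R) ⟶ X.X) [IsOpenImmersion j]
    (hj : j ≫ X.str = Spec.map (CommRingCat.ofHom (algebraMap ℂ R))) (U : X.X.Opens)
    (hU : ⊤ ≤ j ⁻¹ᵁ U) (hUj : U = j.opensRange) : Function.Bijective (chartHom j hj U hU) := by
  subst hUj
  have h1 : IsIso (j.appLE j.opensRange ⊤ hU) := by
    have h2 := j.isIso_app j.opensRange le_rfl
    have h3 : IsIso (homOfLE hU) := ⟨homOfLE le_top, rfl, rfl⟩
    rw [Scheme.Hom.appLE]
    infer_instance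
  exact ConcreteCategory.bijective_of_isIso
    (j.appLE j.opensRange ⊤ hU ≫ (Scheme.ΓSpecIso (CommRingCat.of R)).hom)

end CVariety

open LaurentPolynomial

/-- The Hodge numbers of a variety glued from two affine lines with coordinates `T` and `T⁻¹`. -/
theorem hodgeNumber_of_gluing {X : CVariety}
    (j : Fin 2 → (Spec (CommRingCat.of (Polynomial ℂ)) ⟶ X.X)) (hj : ∀ i, IsOpenImmersion (j i))
    (hstr : ∀ i, j i ≫ X.str = Spec.map (CommRingCat.ofHom (algebraMap ℂ (Polynomial ℂ))))
    (k : Spec (CommRingCat.of ℂ[T;T⁻¹]) ⟶ X.X) (hk : IsOpenImmersion k)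
    (hkstr : k ≫ X.str = Spec.map (CommRingCat.ofHom (algebraMap ℂ ℂ[T;T⁻¹])))
    (h0 : k = Spec.map (CommRingCat.ofHom (Polynomial.aeval (R := ℂ) (T 1 : ℂ[T;T⁻¹])).toRingHom) ≫ j 0)
    (h1 : k = Spec.map (CommRingCat.ofHom (Polynomial.aeval (R := ℂ) (T (-1) : ℂ[T;T⁻¹])).toRingHom) ≫ j 1)
    (hrange : (j 0).opensRange ⊓ (j 1).opensRange = k.opensRange)
    (p q : ℕ) :
    X.hodgeNumber (fun i => (j i).opensRange) p q = if p = q ∧ p ≤ 1 then 1 else 0 := by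
  have hU : ∀ i, ⊤ ≤ j i ⁻¹ᵁ (j i).opensRange := fun i x _ => ⟨x, rfl⟩
  have hle : ∀ i, (j 0).opensRange ⊓ (j 1).opensRange ≤ (j i).opensRange := by
    intro i
    fin_cases i
    · exact inf_le_left
    · exact inf_le_right
  have hkU : ⊤ ≤ k ⁻¹ᵁ ((j 0).opensRange ⊓ (j 1).opensRange) := by
    rw [hrange]
    exact fun x _ => ⟨x, rfl⟩
  have hbij := fun i => CVariety.chartHom_bijective (j i) (hstr i) _ (hU i) rfl
  have hbijk := CVariety.chartHom_bijective k hkstr _ hkU hrange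
  let f : ∀ i, Γ(X.X, (j i).opensRange) ≃ₐ[ℂ] Polynomial ℂ := fun i => AlgEquiv.ofBijective _ (hbij i)
  let e : Γ(X.X, (j 0).opensRange ⊓ (j 1).opensRange) ≃ₐ[ℂ] ℂ[T;T⁻¹] := AlgEquiv.ofBijective _ hbijk
  refine CVariety.hodgeNumber_of_charts (U := fun i => (j i).opensRange)
    (fun i => (f i).symm.toAlgHom) (fun i => (f i).symm.surjective) e.symm hle ?_ ?_ p q
  · refine e.injective ?_
    rw [e.apply_symm_apply]
    refine (CVariety.chartHom_map k hkstr _ hkU _).trans ?_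
    rw [CVariety.chartHom_comp (j 0) (hstr 0) _ k hkstr h0 (hU 0)]
    refine (congrArg _ ((f 0).apply_symm_apply Polynomial.X)).trans ?_
    simp
  · refine e.injective ?_
    rw [e.apply_symm_apply]
    refine (CVariety.chartHom_map k hkstr _ hkU _).trans ?_
    rw [CVariety.chartHom_comp (j 1) (hstr 1) _ k hkstr h1 (hU 1)]
    refine (congrArg _ ((f 1).apply_symm_apply Polynomial.X)).trans ?_
    simp

end Stringy

namespace Stringy

open LaurentPolynomial HomogeneousLocalization

/-! ### The projective line -/

/-- The grading of `ℂ[X₀, X₁]`. -/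
noncomputable abbrev lineGrading : ℕ → Submodule ℂ (MvPolynomial (Fin 2) ℂ) :=
  MvPolynomial.homogeneousSubmodule (Fin 2) ℂ

noncomputable instance : GradedAlgebra lineGrading :=
  MvPolynomial.gradedAlgebra

variable {R : Type} [CommRing R] [Algebra ℂ R]

/-- Evaluation of functions on the complement of a hypersurface at an `R`-valued point. -/
noncomputable def evalPoint (c : Fin 2 → R) (f : MvPolynomial (Fin 2) ℂ)
    (hf : IsUnit (MvPolynomial.aeval c f)) : Away lineGrading f →+* R :=
  (Localization.awayLift (MvPolynomial.aeval c).toRingHom f hf).comp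
    (algebraMap (Away lineGrading f) (Localization.Away f))

theorem evalPoint_mk (c : Fin 2 → R) (f : MvPolynomial (Fin 2) ℂ)
    (hf : IsUnit (MvPolynomial.aeval c f)) {d : ℕ} (hfd : f ∈ lineGrading d) (n : ℕ)
    (a : MvPolynomial (Fin 2) ℂ) (ha : a ∈ lineGrading (n • d)) :
    evalPoint c f hf (Away.mk lineGrading hfd n a ha) * MvPolynomial.aeval c f ^ n =
      MvPolynomial.aeval c a := by
  have hl : ∀ x, Localization.awayLift (MvPolynomial.aeval c).toRingHom f hf
      (algebraMap _ (Localization.Away f) x) = MvPolynomial.aeval c x := fun x =>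
    IsLocalization.Away.lift_eq f hf x
  rw [← map_pow, ← hl (f ^ n), ← hl a]
  refine (map_mul (Localization.awayLift (MvPolynomial.aeval c).toRingHom f hf)
    (Localization.mk a (⟨f ^ n, n, rfl⟩ : Submonoid.powers f)) _).symm.trans (congrArg _ ?_)
  rw [Localization.mk_eq_mk']
  exact IsLocalization.mk'_spec (Localization.Away f) a (⟨f ^ n, n, rfl⟩ : Submonoid.powers f)

theorem evalPoint_fromZero (c : Fin 2 → R) (f : MvPolynomial (Fin 2) ℂ)
    (hf : IsUnit (MvPolynomial.aeval c f)) (z : ℂ) :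
    evalPoint c f hf (fromZeroRingHom lineGrading _ (algebraMap ℂ (lineGrading 0) z)) =
      algebraMap ℂ R z := by
  change Localization.awayLift (MvPolynomial.aeval c).toRingHom f hf
    (Localization.mk (MvPolynomial.C z) 1) = _
  rw [Localization.mk_one_eq_algebraMap, Localization.awayLift, IsLocalization.Away.lift_eq]
  exact MvPolynomial.aeval_C _ _

theorem prod_fin_two_add {M : Type*} [CommMonoid M] (i : Fin 2) (g : Fin 2 → M) :
    ∏ j, g j = g i * g (i + 1) := by
  fin_cases i
  · simp
  · simp [mul_comm]

theorem add_fin_two (i : Fin 2) (g : Fin 2 → ℕ) : ∑ j, g j = g i + g (i + 1) := by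
  fin_cases i
  · simp
  · simp [add_comm]

/-- Dehomogenization loses nothing in a fixed degree: the exponent of the remaining variable
determines the other one. -/
theorem eq_zero_of_aeval_eq_zero (i : Fin 2) (c : Fin 2 → Polynomial ℂ) (h1 : c i = 1)
    (hT : c (i + 1) = Polynomial.X) (n : ℕ) (a : MvPolynomial (Fin 2) ℂ) (ha : a ∈ lineGrading n)
    (h : MvPolynomial.aeval c a = 0) : a = 0 := by
  ext d
  by_contra hd
  rw [MvPolynomial.coeff_zero] at hd
  have hdeg : ∀ e : Fin 2 →₀ ℕ, a.coeff e ≠ 0 → e i + e (i + 1) = n := by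
    intro e he
    have := ha he
    rw [Finsupp.weight_apply, Finsupp.sum_fintype _ _ (by simp)] at this
    rw [← this, ← add_fin_two]
    simp
  have hc := congrArg (fun q => Polynomial.coeff q (d (i + 1))) h
  simp only [MvPolynomial.aeval_def, MvPolynomial.eval₂_eq', Polynomial.finsetSum_coeff,
    prod_fin_two_add i, h1, hT, one_pow, one_mul, Polynomial.coeff_zero] at hc
  rw [Finset.sum_eq_single d] at hc
  · rw [Polynomial.algebraMap_eq, Polynomial.coeff_C_mul, Polynomial.coeff_X_pow_self,
      mul_one] at hc
    exact hd hc
  · intro e he hne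
    rw [Polynomial.algebraMap_eq, Polynomial.coeff_C_mul, Polynomial.coeff_X_pow, if_neg, mul_zero]
    intro h2
    have h3 := hdeg e (MvPolynomial.mem_support_iff.1 he)
    have h4 := hdeg d hd
    refine hne (Finsupp.ext fun j => ?_)
    have hj : j = i ∨ j = i + 1 := by omega
    rcases hj with rfl | rfl
    · omega
    · exact h2.symm
  · intro h
    exact absurd (MvPolynomial.mem_support_iff.2 hd) h

theorem X_mem_lineGrading (i : Fin 2) : (MvPolynomial.X i : MvPolynomial (Fin 2) ℂ) ∈ lineGrading 1 :=
  MvPolynomial.isHomogeneous_X ℂ i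

/-- The coordinate `X_{i + 1} / X_i`. -/
noncomputable abbrev lineCoord (i : Fin 2) : Away lineGrading (MvPolynomial.X i) :=
  Away.mk lineGrading (X_mem_lineGrading i) 1 (MvPolynomial.X (i + 1)) (X_mem_lineGrading (i + 1))

theorem evalPoint_lineCoord (i : Fin 2) (c : Fin 2 → R) (h1 : c i = 1)
    (h : IsUnit (MvPolynomial.aeval c (MvPolynomial.X i))) :
    evalPoint c (MvPolynomial.X i) h (lineCoord i) = c (i + 1) := by
  have h2 := evalPoint_mk c _ h (X_mem_lineGrading i) 1 (MvPolynomial.X (i + 1))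
    (X_mem_lineGrading (i + 1))
  rwa [MvPolynomial.aeval_X, MvPolynomial.aeval_X, h1, one_pow, mul_one] at h2

/-- Degree-zero fractions over a power of `X i` are the polynomials in `X (i + 1) / X i`. -/
theorem evalPoint_bijective (i : Fin 2) (c : Fin 2 → Polynomial ℂ) (h1 : c i = 1)
    (hT : c (i + 1) = Polynomial.X) (h : IsUnit (MvPolynomial.aeval c (MvPolynomial.X i))) :
    Function.Bijective (evalPoint c (MvPolynomial.X i) h) := by
  constructor
  · rw [injective_iff_map_eq_zero]
    intro x hx
    obtain ⟨n, a, ha, rfl⟩ := Away.mk_surjective lineGrading (X_mem_lineGrading i) x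
    have h2 := evalPoint_mk c _ h (X_mem_lineGrading i) n a ha
    rw [hx, zero_mul] at h2
    have h3 := eq_zero_of_aeval_eq_zero i c h1 hT _ a ha h2.symm
    subst h3
    exact mk_eq_zero_of_num _ rfl
  · intro q
    induction q using Polynomial.induction_on' with
    | add p q hp hq =>
      obtain ⟨x, rfl⟩ := hp
      obtain ⟨y, rfl⟩ := hq
      exact ⟨x + y, map_add _ _ _⟩
    | monomial n z =>
      refine ⟨fromZeroRingHom lineGrading _ (algebraMap ℂ (lineGrading 0) z) * lineCoord i ^ n, ?_⟩
      rw [map_mul, map_pow, evalPoint_lineCoord i c h1 h, hT, evalPoint_fromZero, ← Polynomial.C_mul_X_pow_eq_monomial]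
      rfl

omit [Algebra ℂ R] in
/-- Functions on a chart of the projective line are polynomials in the coordinate. -/
theorem lineAway_hom_ext (i : Fin 2) {g g' : Away lineGrading (MvPolynomial.X i) →+* R}
    (hC : ∀ z, g (fromZeroRingHom lineGrading _ (algebraMap ℂ (lineGrading 0) z)) =
      g' (fromZeroRingHom lineGrading _ (algebraMap ℂ (lineGrading 0) z)))
    (hX : g (lineCoord i) = g' (lineCoord i)) : g = g' := by
  let c : Fin 2 → Polynomial ℂ := fun j => if j = i then 1 else Polynomial.X
  have h1 : c i = 1 := if_pos rfl
  have hT : c (i + 1) = Polynomial.X := if_neg (by fin_cases i <;> simp)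
  have h : IsUnit (MvPolynomial.aeval c (MvPolynomial.X i : MvPolynomial (Fin 2) ℂ)) := by
    rw [MvPolynomial.aeval_X, h1]
    exact isUnit_one
  let E := RingEquiv.ofBijective _ (evalPoint_bijective i c h1 hT h)
  have hE : g.comp E.symm.toRingHom = g'.comp E.symm.toRingHom := by
    refine Polynomial.ringHom_ext (fun z => ?_) ?_
    · have : E.symm (Polynomial.C z) =
          fromZeroRingHom lineGrading _ (algebraMap ℂ (lineGrading 0) z) := by
        rw [RingEquiv.symm_apply_eq]
        exact (evalPoint_fromZero c _ h z).symm
      change g (E.symm _) = g' (E.symm _)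
      rw [this, hC]
    · have : E.symm Polynomial.X = lineCoord i := by
        rw [RingEquiv.symm_apply_eq]
        exact hT.symm.trans (evalPoint_lineCoord i c h1 h).symm
      change g (E.symm _) = g' (E.symm _)
      rw [this, hX]
  ext x
  have := RingHom.congr_fun hE (E x)
  change g (E.symm (E x)) = g' (E.symm (E x)) at this
  rwa [E.symm_apply_apply] at this

instance : IsScalarTower ℂ (lineGrading 0) (MvPolynomial (Fin 2) ℂ) :=
  ⟨fun z a p => smul_mul_assoc z (a : MvPolynomial (Fin 2) ℂ) p⟩

/-- Finite generation over the degree-zero part is what makes `Proj` proper over its spectrum; that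
spectrum is then identified with `SpecC`. -/
instance : Algebra.FiniteType (lineGrading 0) (MvPolynomial (Fin 2) ℂ) :=
  Algebra.FiniteType.of_restrictScalars_finiteType ℂ _ _

theorem algebraMap_lineGrading_bijective : Function.Bijective (algebraMap ℂ (lineGrading 0)) := by
  constructor
  · intro x y h
    exact MvPolynomial.C_injective (Fin 2) ℂ (congrArg Subtype.val h)
  · rintro ⟨a, ha⟩
    refine ⟨a.coeff 0, Subtype.ext ?_⟩
    exact ((MvPolynomial.totalDegree_eq_zero_iff_eq_C).1
      (Nat.le_zero.1 ((MvPolynomial.mem_homogeneousSubmodule 0 a).1 ha).totalDegree_le)).symm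

/-- The structure morphism of the projective line. -/
noncomputable abbrev lineStr : Proj lineGrading ⟶ SpecC :=
  Proj.toSpecZero lineGrading ≫ Spec.map (CommRingCat.ofHom (algebraMap ℂ (lineGrading 0)))

instance isIso_specMap_lineGrading :
    IsIso (Spec.map (CommRingCat.ofHom (algebraMap ℂ (lineGrading 0)))) := by
  have : IsIso (CommRingCat.ofHom (algebraMap ℂ (lineGrading 0))) :=
    (ConcreteCategory.isIso_iff_bijective _).2 algebraMap_lineGrading_bijective
  infer_instance

instance isProper_lineStr : IsProper lineStr := inferInstance

/-- The affine charts of the projective line. -/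
theorem exists_lineChart (c : Fin 2 → R) (f : MvPolynomial (Fin 2) ℂ)
    (hf : IsUnit (MvPolynomial.aeval c f)) {d : ℕ} (hfd : f ∈ lineGrading d) (hd : 0 < d) :
    (Spec.map (CommRingCat.ofHom (evalPoint c f hf)) ≫ Proj.awayι lineGrading f hfd hd) ≫ lineStr =
      Spec.map (CommRingCat.ofHom (algebraMap ℂ R)) := by
  rw [lineStr, Category.assoc, Proj.awayι_toSpecZero_assoc, ← Spec.map_comp, ← Spec.map_comp]
  congr 1
  ext z
  exact evalPoint_fromZero c f hf z

/-- The two points with coordinates `(1, T)` and `(T, 1)`. -/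
noncomputable abbrev linePoint (i : Fin 2) : Fin 2 → Polynomial ℂ :=
  fun j => if j = i then 1 else Polynomial.X

theorem linePoint_add_one (i : Fin 2) : linePoint i (i + 1) = Polynomial.X :=
  if_neg (by fin_cases i <;> simp)

theorem isUnit_aeval_linePoint (i : Fin 2) :
    IsUnit (MvPolynomial.aeval (linePoint i) (MvPolynomial.X i : MvPolynomial (Fin 2) ℂ)) := by
  rw [MvPolynomial.aeval_X, linePoint, if_pos rfl]
  exact isUnit_one

/-- The chart of the projective line with coordinate `X_{i + 1} / X_i`. -/
noncomputable abbrev lineChart (i : Fin 2) :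
    Spec (CommRingCat.of (Polynomial ℂ)) ⟶ Proj lineGrading :=
  Spec.map (CommRingCat.ofHom (evalPoint (linePoint i) _ (isUnit_aeval_linePoint i))) ≫
    Proj.awayι lineGrading _ (X_mem_lineGrading i) one_pos

instance isIso_specMap_evalPoint (i : Fin 2) : IsIso (Spec.map
    (CommRingCat.ofHom (evalPoint (linePoint i) _ (isUnit_aeval_linePoint i)))) := by
  have : IsIso (CommRingCat.ofHom (evalPoint (linePoint i) _ (isUnit_aeval_linePoint i))) :=
    (ConcreteCategory.isIso_iff_bijective _).2
      (evalPoint_bijective i (linePoint i) (if_pos rfl) (linePoint_add_one i) _)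
  infer_instance

instance isOpenImmersion_lineChart (i : Fin 2) : IsOpenImmersion (lineChart i) := inferInstance

theorem opensRange_lineChart (i : Fin 2) :
    (lineChart i).opensRange = Proj.basicOpen lineGrading (MvPolynomial.X i) := by
  rw [← Proj.opensRange_awayι lineGrading _ (X_mem_lineGrading i) one_pos]
  exact Scheme.Hom.opensRange_comp_of_isIso _ _

theorem iSup_opensRange_lineChart : ⨆ i, (lineChart i).opensRange = ⊤ := by
  simp only [opensRange_lineChart]
  refine Proj.iSup_basicOpen_eq_top' lineGrading _ (fun i => ⟨1, X_mem_lineGrading i⟩) ?_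
  rw [← top_le_iff]
  intro a _
  induction a using MvPolynomial.induction_on with
  | C z => exact Subalgebra.algebraMap_mem _ (algebraMap ℂ (lineGrading 0) z)
  | add p q hp hq => exact add_mem (hp trivial) (hq trivial)
  | mul_X p i hp => exact mul_mem (hp trivial) (Algebra.subset_adjoin ⟨i, rfl⟩)

/-- The cover of the projective line by two affine lines. -/
noncomputable abbrev lineCover : (Proj lineGrading).OpenCover :=
  Scheme.Cover.mkOfCovers (Fin 2) (fun _ => Spec (CommRingCat.of (Polynomial ℂ))) lineChart
    (fun x => by
      have h : x ∈ (⊤ : (Proj lineGrading).Opens) := trivial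
      rw [← iSup_opensRange_lineChart] at h
      obtain ⟨i, y, hy⟩ := Opens.mem_iSup.1 h
      exact ⟨i, y, hy⟩)
    isOpenImmersion_lineChart

/-- The projective line. -/
noncomputable abbrev projectiveLine : CVariety where
  X := Proj lineGrading
  str := lineStr
  isReduced := by
    have : ∀ i, AlgebraicGeometry.IsReduced (lineCover.X i) := fun i =>
      inferInstanceAs (AlgebraicGeometry.IsReduced (Spec (CommRingCat.of (Polynomial ℂ))))
    exact IsReduced.of_openCover _ lineCover
  isSeparated := inferInstance
  locallyOfFiniteType := inferInstance
  quasiCompact := inferInstance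

open MvPolynomial in
theorem isUnit_aeval_mul : IsUnit (MvPolynomial.aeval ![(1 : ℂ[T;T⁻¹]), T 1] (X 0 * X 1 : MvPolynomial (Fin 2) ℂ)) := by
  simp only [map_mul, MvPolynomial.aeval_X]
  simpa using isUnit_T 1

theorem X_mul_X_mem : (MvPolynomial.X 0 * MvPolynomial.X 1 : MvPolynomial (Fin 2) ℂ) ∈ lineGrading 2 :=
  SetLike.mul_mem_graded (X_mem_lineGrading 0) (X_mem_lineGrading 1)

/-- The intersection of the two charts of the projective line. -/
noncomputable abbrev lineOverlap : Spec (CommRingCat.of ℂ[T;T⁻¹]) ⟶ Proj lineGrading :=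
  Spec.map (CommRingCat.ofHom (evalPoint ![(1 : ℂ[T;T⁻¹]), T 1] _ isUnit_aeval_mul)) ≫
    Proj.awayι lineGrading _ X_mul_X_mem two_pos

theorem lineOverlap_eq (i : Fin 2) (n : ℤ) (hn : n = if i = 0 then 1 else -1) :
    lineOverlap = Spec.map (CommRingCat.ofHom
      (Polynomial.aeval (R := ℂ) (T n : ℂ[T;T⁻¹])).toRingHom) ≫ lineChart i := by
  have hx : (MvPolynomial.X 0 * MvPolynomial.X 1 : MvPolynomial (Fin 2) ℂ) =
      MvPolynomial.X i * MvPolynomial.X (i + 1) := by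
    fin_cases i
    · rfl
    · exact mul_comm _ _
  rw [lineOverlap, lineChart, ← Proj.SpecMap_awayMap_awayι lineGrading (X_mem_lineGrading i) one_pos
    (X_mem_lineGrading (i + 1)) hx, ← Category.assoc, ← Category.assoc, ← Spec.map_comp,
    ← Spec.map_comp]
  congr 2
  refine CommRingCat.hom_ext (lineAway_hom_ext i (fun z => ?_) ?_)
  · change evalPoint _ _ isUnit_aeval_mul (awayMap lineGrading (X_mem_lineGrading (i + 1)) hx _) =
      Polynomial.aeval _ (evalPoint _ _ _ _)
    rw [awayMap_fromZeroRingHom, evalPoint_fromZero, evalPoint_fromZero]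
    simp
  · change evalPoint _ _ isUnit_aeval_mul (awayMap lineGrading (X_mem_lineGrading (i + 1)) hx _) =
      Polynomial.aeval _ (evalPoint _ _ _ _)
    rw [evalPoint_lineCoord i (linePoint i) (if_pos rfl), linePoint_add_one, lineCoord, awayMap_mk]
    have h := evalPoint_mk ![(1 : ℂ[T;T⁻¹]), T 1] _ isUnit_aeval_mul
      (d := 1 + 1) (hx ▸ SetLike.mul_mem_graded (X_mem_lineGrading i) (X_mem_lineGrading (i + 1))) 1
      (MvPolynomial.X (i + 1) * MvPolynomial.X (i + 1) ^ 1)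
      (by
        rw [pow_one]
        exact SetLike.mul_mem_graded (X_mem_lineGrading (i + 1)) (X_mem_lineGrading (i + 1)))
    -- `evalPoint_mk` determines the value only after multiplication by the value `T` of `X₀X₁`, a
    -- unit that can be cancelled.
    refine (isUnit_T (R := ℂ) 1).mul_right_cancel (Eq.trans ?_ (h.trans ?_))
    · simp
    · rw [hn]
      fin_cases i
      · simp
      · have e : (T (-1) * T 1 : ℂ[T;T⁻¹]) = 1 := by
          rw [← T_add]
          exact T_zero
        simp [e]

/-- In the chart with coordinate `x = X₁/X₀` the locus `X₁ ≠ 0` is `D(x)`, and `ℂ[T;T⁻¹]` is the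
localization of `ℂ[x]` at `x`. -/
theorem opensRange_lineOverlap (h : IsOpenImmersion lineOverlap) :
    (lineChart 0).opensRange ⊓ (lineChart 1).opensRange = lineOverlap.opensRange := by
  rw [opensRange_lineChart 1]
  have h1 : lineChart 0 ⁻¹ᵁ Proj.basicOpen lineGrading (MvPolynomial.X 1) =
      PrimeSpectrum.basicOpen (Polynomial.X : Polynomial ℂ) := by
    rw [lineChart, Scheme.Hom.comp_preimage,
      Proj.awayι_preimage_basicOpen lineGrading (X_mem_lineGrading 0) one_pos (X_mem_lineGrading 1)
        one_pos]
    have h2 : Away.isLocalizationElem (X_mem_lineGrading 0) (X_mem_lineGrading 1) =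
        lineCoord 0 := by
      ext
      simp
    rw [h2]
    have h3 := evalPoint_lineCoord 0 (linePoint 0) (if_pos rfl) (isUnit_aeval_linePoint 0)
    rw [linePoint_add_one] at h3
    rw [← h3]
    rfl
  have h2 : Set.range (PrimeSpectrum.comap
      (Polynomial.aeval (R := ℂ) (T 1 : ℂ[T;T⁻¹])).toRingHom) =
      (PrimeSpectrum.basicOpen (Polynomial.X : Polynomial ℂ) : Set (PrimeSpectrum (Polynomial ℂ))) := by
    rw [← PrimeSpectrum.localization_away_comap_range ℂ[T;T⁻¹] (Polynomial.X : Polynomial ℂ)]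
    have h3 : (Polynomial.aeval (R := ℂ) (T 1 : ℂ[T;T⁻¹])).toRingHom =
        algebraMap (Polynomial ℂ) ℂ[T;T⁻¹] := by
      refine Polynomial.ringHom_ext (fun z => ?_) ?_
      · simp [algebraMap_eq_toLaurent]
      · simp [algebraMap_eq_toLaurent]
    rw [h3]
  have h3 : ∀ z, lineOverlap z = lineChart 0 (Spec.map (CommRingCat.ofHom
      (Polynomial.aeval (R := ℂ) (T 1 : ℂ[T;T⁻¹])).toRingHom) z) := fun z => by
    rw [lineOverlap_eq 0 1 rfl]
    rfl
  ext x
  constructor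
  · rintro ⟨⟨y, rfl⟩, hy⟩
    have hy' : y ∈ lineChart 0 ⁻¹ᵁ Proj.basicOpen lineGrading (MvPolynomial.X 1) := hy
    rw [h1] at hy'
    obtain ⟨z, rfl⟩ := h2.ge hy'
    exact ⟨z, h3 z⟩
  · rintro ⟨z, rfl⟩
    rw [h3 z]
    refine ⟨⟨_, rfl⟩, ?_⟩
    have : Spec.map (CommRingCat.ofHom
      (Polynomial.aeval (R := ℂ) (T 1 : ℂ[T;T⁻¹])).toRingHom) z ∈
        lineChart 0 ⁻¹ᵁ Proj.basicOpen lineGrading (MvPolynomial.X 1) := by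
      rw [h1]
      exact h2.le ⟨z, rfl⟩
    exact this

theorem isOpenImmersion_lineOverlap : IsOpenImmersion lineOverlap := by
  rw [lineOverlap_eq 0 1 rfl]
  have : (Polynomial.aeval (R := ℂ) (T 1 : ℂ[T;T⁻¹])).toRingHom =
      algebraMap (Polynomial ℂ) ℂ[T;T⁻¹] := by
    refine Polynomial.ringHom_ext (fun z => ?_) ?_
    · simp [algebraMap_eq_toLaurent]
    · simp [algebraMap_eq_toLaurent]
  rw [this]
  have h := IsOpenImmersion.of_isLocalization (S := ℂ[T;T⁻¹]) (Polynomial.X : Polynomial ℂ)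
  infer_instance

/-- Smoothness is local on the source, and both charts are affine lines over `ℂ`. -/
theorem smooth_lineStr : Smooth lineStr := by
  have hZ : IsZariskiLocalAtSource (@Smooth.{0}) :=
    HasRingHomProperty.instIsZariskiLocalAtSource (P := @Smooth) (Q := RingHom.Smooth)
  rw [IsZariskiLocalAtSource.iff_of_openCover (P := @Smooth) lineCover]
  intro i
  change Smooth (lineChart i ≫ lineStr)
  rw [exists_lineChart, HasRingHomProperty.Spec_iff (P := @Smooth)]
  have h : Algebra.Smooth ℂ (MvPolynomial (Fin 1) ℂ) := ⟨inferInstance, inferInstance⟩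
  exact (RingHom.smooth_algebraMap (R := ℂ) (S := Polynomial ℂ)).2
    (Algebra.Smooth.of_equiv (MvPolynomial.uniqueAlgEquiv ℂ (Fin 1)))

theorem hodgeNumber_projectiveLine (p q : ℕ) :
    projectiveLine.hodgeNumber (fun i => (lineChart i).opensRange) p q =
      if p = q ∧ p ≤ 1 then 1 else 0 :=
  hodgeNumber_of_gluing (X := projectiveLine) lineChart isOpenImmersion_lineChart
    (fun _ => exists_lineChart _ _ _ _ _) lineOverlap isOpenImmersion_lineOverlap
    (exists_lineChart _ _ _ _ _) (lineOverlap_eq 0 1 rfl) (lineOverlap_eq 1 (-1) rfl)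
    (opensRange_lineOverlap _) p q

end Stringy

/-! ### The `E`-polynomial of the point and of a product with the affine line -/

namespace Stringy

open LaurentPolynomial

theorem K0.of_point : K0.of CVariety.point = K0.of (affineVar ℂ) :=
  K0.of_eq_of_iso (X := CVariety.point) (Y := affineVar ℂ) (Iso.refl _)
    ((Category.id_comp _).trans (Spec.map_id _))

/-- Two affine lines overlap in a punctured line, so `[ℙ¹] = 2[𝔸¹] - [𝔾_m]`, while `[𝔸¹] = [pt] +
[𝔾_m]`. -/
theorem K0.of_projectiveLine :
    K0.of projectiveLine = K0.of (CVariety.point.prodAffine 1) + K0.of CVariety.point := by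
  have hft : Algebra.FiniteType ℂ ℂ[T;T⁻¹] :=
    inferInstanceAs (Algebra.FiniteType ℂ (AddMonoidAlgebra ℂ ℤ))
  have : IsScalarTower ℂ (Polynomial ℂ) ℂ[T;T⁻¹] :=
    IsScalarTower.of_algebraMap_eq fun x => (Polynomial.toLaurent_C _).symm
  have h1 : K0.of (CVariety.point.prodAffine 1) = K0.of (affineVar (Polynomial ℂ)) := by
    rw [← lefschetz_of, K0.of_point, lefschetz_of_affineVar]
  have h2 : K0.of (affineVar (Polynomial ℂ)) = K0.of (affineVar ℂ) + K0.of (affineVar ℂ[T;T⁻¹]) := by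
    refine K0.of_affineVar_eq_add (R := Polynomial ℂ) (S := ℂ) (A := ℂ[T;T⁻¹])
      Polynomial.X (Polynomial.aeval (0 : ℂ)) (fun r => ⟨Polynomial.C r, by simp⟩) ?_
    ext p
    rw [Ideal.mem_span_singleton, Polynomial.X_dvd_iff, RingHom.mem_ker]
    simp [Polynomial.coeff_zero_eq_aeval_zero]
  have h3 : ∀ i, K0.of (projectiveLine.restrict (lineChart i).opensRange) =
      K0.of (affineVar (Polynomial ℂ)) := fun i =>
    (K0.of_eq_restrict (U := affineVar (Polynomial ℂ)) (Y := projectiveLine) (lineChart i)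
      (exists_lineChart _ _ _ _ _)).symm
  have h4 := isOpenImmersion_lineOverlap
  have h5 := K0.of_eq_restrict (U := affineVar ℂ[T;T⁻¹]) (Y := projectiveLine) lineOverlap
      (exists_lineChart _ _ _ _ _)
  have h6 := K0.of_restrict_sup_add_inf projectiveLine (lineChart 0).opensRange
    (lineChart 1).opensRange
  have h7 : (lineChart 0).opensRange ⊔ (lineChart 1).opensRange = ⊤ := by
    rw [← iSup_opensRange_lineChart]
    exact le_antisymm (sup_le (le_iSup (fun i => (lineChart i).opensRange) 0)
      (le_iSup (fun i => (lineChart i).opensRange) 1))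
      (iSup_le fun i => by fin_cases i; exacts [le_sup_left, le_sup_right])
  rw [h3, h3, opensRange_lineOverlap h4, ← h5, h7, K0.of_restrict_top] at h6
  rw [h1, K0.of_point]
  rw [← eq_sub_iff_add_eq] at h6
  rw [h6]
  nth_rw 2 [h2]
  abel

variable {E : K0 →+ MvPolynomial (Fin 2) ℤ} (hE : IsEPolynomial E)

include hE

theorem IsEPolynomial.mul_point (X : CVariety) :
    E (K0.of X) = E (K0.of X) * E (K0.of CVariety.point) :=
  hE.map_prod X CVariety.point X (𝟙 X.X) X.str (by
    refine IsPullback.flip ?_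
    change IsPullback X.str (𝟙 X.X) (𝟙 SpecC) X.str
    exact IsPullback.of_vert_isIso ⟨by simp⟩) (Category.id_comp _)

theorem IsEPolynomial.projectiveLine :
    E (K0.of projectiveLine) = 1 + MvPolynomial.X 0 * MvPolynomial.X 1 := by
  ext m
  have hm : m = Finsupp.single 0 (m 0) + Finsupp.single 1 (m 1) := by
    ext i
    fin_cases i <;> simp
  rw [hm]
  generalize m 0 = p
  generalize m 1 = q
  rw [hE.smooth_proper Stringy.projectiveLine smooth_lineStr isProper_lineStr 2
    (fun i => (lineChart i).opensRange) (fun i => isAffineOpen_opensRange (lineChart i))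
    iSup_opensRange_lineChart, hodgeNumber_projectiveLine]
  have h1 : (MvPolynomial.X 0 * MvPolynomial.X 1 : MvPolynomial (Fin 2) ℤ) =
      MvPolynomial.monomial (Finsupp.single 0 1 + Finsupp.single 1 1) 1 := by
    rw [MvPolynomial.X, MvPolynomial.X, MvPolynomial.monomial_mul, one_mul]
  have h0 : (1 : MvPolynomial (Fin 2) ℤ) =
      MvPolynomial.monomial (Finsupp.single 0 0 + Finsupp.single 1 0) 1 := by
    simp
  have hinj : ∀ a b c d : ℕ, (Finsupp.single (0 : Fin 2) a + Finsupp.single 1 b =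
      Finsupp.single 0 c + Finsupp.single 1 d) ↔ a = c ∧ b = d := by
    intro a b c d
    constructor
    · intro h
      have h2 := DFunLike.congr_fun h 0
      have h3 := DFunLike.congr_fun h 1
      simp at h2 h3
      exact ⟨h2, h3⟩
    · rintro ⟨rfl, rfl⟩
      rfl
  rw [h1, h0, MvPolynomial.coeff_add, MvPolynomial.coeff_monomial, MvPolynomial.coeff_monomial]
  simp only [hinj]
  by_cases h : p = q ∧ p ≤ 1
  · obtain ⟨rfl, h⟩ := h
    rw [if_pos ⟨rfl, h⟩, ← two_mul, pow_mul]
    obtain rfl | rfl : p = 0 ∨ p = 1 := by omega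
    · simp
    · simp
  · rw [if_neg h, if_neg (by omega), if_neg (by omega)]
    simp

/-- Multiplicativity makes `E(pt)` an idempotent in a domain. It is not `0`, for otherwise every
`E(X) = E(X) E(pt)` would vanish, contrary to `E(ℙ¹) = 1 + uv`. -/
theorem IsEPolynomial.point : E (K0.of CVariety.point) = 1 := by
  have h1 := hE.mul_point CVariety.point
  have h2 : E (K0.of CVariety.point) * (E (K0.of CVariety.point) - 1) = 0 := by
    rw [mul_sub, mul_one, ← h1, sub_self]
  rcases mul_eq_zero.1 h2 with h | h
  · have h3 := hE.mul_point Stringy.projectiveLine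
    rw [h, mul_zero, hE.projectiveLine] at h3
    have h4 := congrArg (MvPolynomial.eval 0) h3
    simp at h4
  · exact sub_eq_zero.1 h

/-- `E(𝔸¹) = E(ℙ¹) - E(pt) = uv`, and `X × 𝔸¹` is a fibre product over `Spec ℂ`. -/
theorem IsEPolynomial.prodAffine_one (X : CVariety) : E (K0.of (X.prodAffine 1)) =
    MvPolynomial.X 0 * MvPolynomial.X 1 * E (K0.of X) := by
  have h1 := hE.projectiveLine
  rw [K0.of_projectiveLine, map_add, hE.point, add_comm, add_left_cancel_iff] at h1
  have h2 := AffineSpace.isPullback_map (n := Fin 1) X.str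
  rw [hE.map_prod X (CVariety.point.prodAffine 1) (X.prodAffine 1) (𝔸(Fin 1; X.X) ↘ X.X)
    (AffineSpace.map (Fin 1) X.str) ?_ rfl, h1, mul_comm]
  change IsPullback _ _ _ ((𝔸(Fin 1; SpecC) ↘ SpecC) ≫ 𝟙 SpecC)
  rw [Category.comp_id]
  exact h2.flip

end Stringy

/-! ### Discrepancies of regular toric resolutions exceed `-1` -/

namespace Stringy

/-! ### Logarithmic forms -/

section Forms

/-- The exterior power is spanned by wedges of the generators. A wedge with a repeated generator
vanishes; the others are permutations of the full one and differ from it by a sign. -/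
theorem span_ιMulti_eq_top {R M : Type*} [CommRing R] [AddCommGroup M] [Module R M] {n : ℕ}
    {v : Fin n → M} (hv : Submodule.span R (Set.range v) = ⊤) :
    Submodule.span R {exteriorPower.ιMulti R n v} = ⊤ := by
  rw [eq_top_iff, ← exteriorPower.ιMulti_span_of_span R n M hv, Submodule.span_le]
  rintro _ ⟨a, ha, rfl⟩
  choose f hf using fun i => ha ⟨i, rfl⟩
  obtain rfl : v ∘ f = a := funext hf
  by_cases hinj : Function.Injective f
  · let e := Equiv.ofBijective f (Finite.injective_iff_bijective.mp hinj)
    have h1 : v ∘ f = v ∘ e := rfl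
    rw [h1, AlternatingMap.map_perm]
    exact zsmul_mem (Submodule.mem_span_singleton_self _) _
  · rw [AlternatingMap.map_eq_zero_of_not_injective _ _ fun h => hinj h.of_comp]
    exact zero_mem _

variable {d : ℕ} {O : Type*} [CommRing O] [Algebra ℂ O]

/-- The differentials of coordinates generate. -/
theorem span_D_eq_top (x : Fin d → O) (S : Submonoid (MvPolynomial (Fin d) ℂ))
    (hS : letI := (MvPolynomial.aeval x : MvPolynomial (Fin d) ℂ →ₐ[ℂ] O).toRingHom.toAlgebra
      IsLocalization S O) :
    Submodule.span O (Set.range fun i => KaehlerDifferential.D ℂ O (x i)) = ⊤ := by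
  let := (MvPolynomial.aeval x : MvPolynomial (Fin d) ℂ →ₐ[ℂ] O).toRingHom.toAlgebra
  have : IsScalarTower ℂ (MvPolynomial (Fin d) ℂ) O := IsScalarTower.of_algebraMap_eq'
    (MvPolynomial.aeval x : MvPolynomial (Fin d) ℂ →ₐ[ℂ] O).comp_algebraMap.symm
  have := hS
  have h := span_eq_top_of_isLocalizedModule O S (KaehlerDifferential.map ℂ ℂ (MvPolynomial (Fin d) ℂ) O)
    (v := Set.range (KaehlerDifferential.mvPolynomialBasis ℂ (Fin d))) (Module.Basis.span_eq _)
  rw [← Set.range_comp] at h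
  convert h using 3
  funext i
  simp only [Function.comp_apply, KaehlerDifferential.mvPolynomialBasis_apply,
    KaehlerDifferential.map_D]
  congr 1
  exact (MvPolynomial.aeval_X x i).symm

theorem finrank_kaehlerDifferential {K : Type*} [Field K] [Algebra ℂ K] (x : Fin d → K)
    (hx : letI := (MvPolynomial.aeval x : MvPolynomial (Fin d) ℂ →ₐ[ℂ] K).toRingHom.toAlgebra
      IsFractionRing (MvPolynomial (Fin d) ℂ) K) :
    Module.finrank K Ω[K⁄ℂ] = d := by
  let := (MvPolynomial.aeval x : MvPolynomial (Fin d) ℂ →ₐ[ℂ] K).toRingHom.toAlgebra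
  have : IsScalarTower ℂ (MvPolynomial (Fin d) ℂ) K := IsScalarTower.of_algebraMap_eq'
    (MvPolynomial.aeval x : MvPolynomial (Fin d) ℂ →ₐ[ℂ] K).comp_algebraMap.symm
  have := hx
  have b := (KaehlerDifferential.mvPolynomialBasis ℂ (Fin d)).ofIsLocalizedModule K
    (nonZeroDivisors (MvPolynomial (Fin d) ℂ))
    (KaehlerDifferential.map ℂ ℂ (MvPolynomial (Fin d) ℂ) K)
  rw [Module.finrank_eq_card_basis b, Fintype.card_fin]

/-- Two generators of the top forms over a local ring differ by a unit. -/
theorem exists_unit_smul_eq {O K M N : Type*} [CommRing O] [IsDomain O] [Field K] [Algebra O K]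
    [FaithfulSMul O K] [AddCommGroup M] [Module O M] [AddCommGroup N] [Module O N] [Module K N]
    [IsScalarTower O K N]
    (F : M →ₗ[O] N) {θ η : M} (hθ : Submodule.span O {θ} = ⊤) (hη : Submodule.span O {η} = ⊤)
    {t g : K} (h : t • F θ = g • F η) (h0 : t • F θ ≠ 0) : ∃ u : Oˣ, t = algebraMap O K u * g := by
  obtain ⟨u, hu⟩ := Submodule.mem_span_singleton.mp (hθ ▸ Submodule.mem_top : η ∈ Submodule.span O {θ})
  obtain ⟨v, hv⟩ := Submodule.mem_span_singleton.mp (hη ▸ Submodule.mem_top : θ ∈ Submodule.span O {η})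
  have hF : F θ ≠ 0 := fun h => h0 (by rw [h, smul_zero])
  have huv : v * u = 1 := by
    have h1 : (algebraMap O K (v * u) - 1) • F θ = 0 := by
      rw [sub_smul, algebraMap_smul, mul_smul, ← map_smul, hu, ← map_smul, hv, one_smul, sub_self]
    have h2 := (smul_eq_zero.mp h1).resolve_right hF
    exact FaithfulSMul.algebraMap_injective O K (by rw [map_one, sub_eq_zero.mp h2])
  refine ⟨⟨u, v, by rw [mul_comm, huv], huv⟩, ?_⟩
  rw [← hu, map_smul, ← algebraMap_smul K u, smul_smul] at h
  have h1 : (t - g * algebraMap O K u) • F θ = 0 := by rw [sub_smul, h, sub_self]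
  rw [sub_eq_zero.mp ((smul_eq_zero.mp h1).resolve_right hF), mul_comm]

variable {K : Type*} [Field K] [Algebra ℂ K]

/-- The logarithmic derivative of a homomorphism to the units of a field. -/
noncomputable def dlog (χ : Multiplicative (Fin d → ℤ) →* K) : (Fin d → ℤ) →ₗ[ℤ] Ω[K⁄ℂ] :=
  AddMonoidHom.toIntLinearMap
    { toFun := fun m => (χ (Multiplicative.ofAdd m))⁻¹ • KaehlerDifferential.D ℂ K (χ (Multiplicative.ofAdd m))
      map_zero' := by simp
      map_add' := fun m n => by
        have hm : χ (Multiplicative.ofAdd m) ≠ 0 := ((Group.isUnit _).map χ).ne_zero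
        have hn : χ (Multiplicative.ofAdd n) ≠ 0 := ((Group.isUnit _).map χ).ne_zero
        rw [ofAdd_add, map_mul, Derivation.leibniz, smul_add, smul_smul, smul_smul, add_comm]
        congr 2 <;> field_simp }

theorem dlog_apply (χ : Multiplicative (Fin d → ℤ) →* K) (m : Fin d → ℤ) :
    dlog χ m = (χ (Multiplicative.ofAdd m))⁻¹ • KaehlerDifferential.D ℂ K (χ (Multiplicative.ofAdd m)) :=
  rfl

/-- The logarithmic top form attached to a family of characters. -/
noncomputable def dlogForm (χ : Multiplicative (Fin d → ℤ) →* K) (m : Fin d → Fin d → ℤ) :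
    ⋀[K]^d Ω[K⁄ℂ] :=
  exteriorPower.ιMulti K d fun i => dlog χ (m i)

/-- An alternating map on the lattice is its value on a basis times the determinant, and the
determinant of a change of basis of `ℤᵈ` is `±1`. Hence the logarithmic top form is, up to sign, the
same on all charts. -/
theorem dlogForm_basis (χ : Multiplicative (Fin d → ℤ) →* K)
    (b c : Module.Basis (Fin d) ℤ (Fin d → ℤ)) :
    ∃ u : ℤˣ, dlogForm χ c = (u : ℤ) • dlogForm χ b := by
  let F : (Fin d → ℤ) [⋀^Fin d]→ₗ[ℤ] ⋀[K]^d Ω[K⁄ℂ] :=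
    { (((exteriorPower.ιMulti K d).toMultilinearMap.restrictScalars ℤ).compLinearMap
        fun _ => dlog χ) with
      map_eq_zero_of_eq' := fun v i j h hij =>
        (exteriorPower.ιMulti K d).map_eq_zero_of_eq _ (congrArg (dlog χ) h) hij }
  have h : F = (LinearMap.toSpanSingleton ℤ _ (F b)).compAlternatingMap b.det := by
    refine Module.Basis.ext_alternating b fun v hv => ?_
    let e := Equiv.ofBijective v (Finite.injective_iff_bijective.mp hv)
    have h1 : (fun i => b (v i)) = b ∘ e := rfl
    rw [h1, AlternatingMap.map_perm, AlternatingMap.map_perm, LinearMap.compAlternatingMap_apply,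
      b.det_self, LinearMap.toSpanSingleton_apply, one_smul]
  refine ⟨(b.isUnit_det c).unit, ?_⟩
  change F c = _ • F b
  conv_lhs => rw [h]
  simp

theorem ιMulti_D_eq (χ : Multiplicative (Fin d → ℤ) →* K) (m : Fin d → Fin d → ℤ) :
    exteriorPower.ιMulti K d (fun i => KaehlerDifferential.D ℂ K (χ (Multiplicative.ofAdd (m i)))) =
      (∏ i, χ (Multiplicative.ofAdd (m i))) • dlogForm χ m := by
  rw [dlogForm, ← AlternatingMap.map_smul_univ]
  congr 1
  funext i
  have : χ (Multiplicative.ofAdd (m i)) ≠ 0 := ((Group.isUnit _).map χ).ne_zero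
  rw [dlog_apply, smul_smul, mul_inv_cancel₀ this, one_smul]

end Forms

end Stringy

namespace Stringy

/-! ### Functions on affine charts -/

section Chart

variable {Y : Scheme.{0}} {R : CommRingCat.{0}} (c : Spec R ⟶ Y) [IsOpenImmersion c]

instance isPrime_asIdeal (p : Spec R) : p.asIdeal.IsPrime := PrimeSpectrum.isPrime p

/-- The functions on an affine chart as sections over its image. -/
noncomputable def chartSection : R ⟶ Γ(Y, c ''ᵁ ⊤) :=
  (Scheme.ΓSpecIso R).inv ≫ (c.appIso ⊤).inv

theorem mem_chart (p : Spec R) : c p ∈ c ''ᵁ ⊤ := ⟨p, trivial, rfl⟩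

/-- The germs of functions on an affine chart. -/
noncomputable def chartGerm (p : Spec R) : R ⟶ Y.presheaf.stalk (c p) :=
  chartSection c ≫ Y.presheaf.germ (c ''ᵁ ⊤) (c p) (mem_chart c p)

theorem chartGerm_stalkMap (p : Spec R) :
    chartGerm c p ≫ c.stalkMap p = StructureSheaf.toStalk R p := by
  rw [chartGerm, chartSection, Category.assoc, Category.assoc,
    Scheme.Hom.germ_stalkMap c _ p (mem_chart c p), Scheme.Hom.appIso_inv_app_assoc]
  exact congrArg ((Scheme.ΓSpecIso R).inv ≫ ·)
    (TopCat.Presheaf.germ_res (Spec R).presheaf _ p _)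

theorem isLocalization_chartGerm (p : Spec R) :
    letI := (chartGerm c p).hom.toAlgebra
    IsLocalization.AtPrime (Y.presheaf.stalk (c p)) p.asIdeal := by
  let := (chartGerm c p).hom.toAlgebra
  let q : PrimeSpectrum R := p
  let e : (Spec.structureSheaf R).presheaf.stalk q ≃+* Y.presheaf.stalk (c p) :=
    (asIso (c.stalkMap p)).commRingCatIsoToRingEquiv.symm
  have he : ∀ b, e (algebraMap R _ b) = algebraMap R _ b := fun b => by
    refine (RingEquiv.symm_apply_eq _).mpr ?_
    exact (RingHom.congr_fun (congrArg CommRingCat.Hom.hom (chartGerm_stalkMap c p)) b).symm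
  exact IsLocalization.isLocalization_of_algEquiv q.asIdeal.primeCompl
    (AlgEquiv.ofRingEquiv (R := R) (f := e) he)

theorem isUnit_chartGerm_iff (p : Spec R) (b : R) : IsUnit (chartGerm c p b) ↔ b ∉ p.asIdeal := by
  let := (chartGerm c p).hom.toAlgebra
  have := isLocalization_chartGerm c p
  exact IsLocalization.AtPrime.isUnit_to_map_iff (Y.presheaf.stalk (c p)) p.asIdeal b

variable [IrreducibleSpace Y]

instance nonempty_chart [Nontrivial R] : Nonempty (c ''ᵁ ⊤ : Y.Opens) :=
  ⟨⟨_, mem_chart c (Classical.arbitrary (PrimeSpectrum R))⟩⟩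

/-- The functions on an affine chart as rational functions. -/
noncomputable def chartRat [Nontrivial R] : R →+* Y.functionField :=
  (chartSection c ≫ Y.germToFunctionField (c ''ᵁ ⊤)).hom

theorem algebraMap_chartGerm [Nontrivial R] (p : Spec R) (b : R) :
    algebraMap (Y.presheaf.stalk (c p)) Y.functionField (chartGerm c p b) = chartRat c b :=
  Scheme.algebraMap_germ_eq_germToFunctionField _ _ (chartSection c b)

theorem chartRat_comp [Nontrivial R] {R' : CommRingCat.{0}} [Nontrivial R']
    (c' : Spec R' ⟶ Y) [IsOpenImmersion c'] (g : R ⟶ R') (h : Spec.map g ≫ c = c') (b : R) :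
    chartRat c' (g b) = chartRat c b := by
  have hle : c' ''ᵁ ⊤ ≤ c ''ᵁ ⊤ := by
    subst h
    rintro _ ⟨p, -, rfl⟩
    exact mem_chart c (Spec.map g p)
  have h2 : g ≫ chartSection c' = chartSection c ≫ Y.presheaf.map (homOfLE hle).op := by
    rw [chartSection, chartSection, ← cancel_mono (c'.appIso ⊤).hom, Category.assoc,
      Category.assoc, Iso.inv_hom_id, Category.comp_id, Category.assoc, Category.assoc,
      Scheme.Hom.appIso_hom', Scheme.Hom.map_appLE]
    subst h
    rw [← Scheme.Hom.appLE_comp_appLE _ _ (c ''ᵁ ⊤) ⊤ ⊤ (Scheme.Hom.preimage_image_eq c ⊤).ge le_top,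
      Scheme.Hom.appIso_inv_appLE_assoc]
    simp [Scheme.Hom.appLE]
    exact (Category.comp_id _).symm
  change (g ≫ chartSection c' ≫ Y.germToFunctionField (c' ''ᵁ ⊤)) b = _
  rw [← Category.assoc, h2, Category.assoc]
  refine congrArg (fun f => (chartSection c ≫ f).hom b) ?_
  exact TopCat.Presheaf.germ_res _ _ _ _

end Chart

section Order

variable {Y : Scheme.{0}} [AlgebraicGeometry.IsIntegral Y] {R : CommRingCat.{0}} [IsDomain R]
  (c : Spec R ⟶ Y) [IsOpenImmersion c]

theorem chartRat_injective : Function.Injective (chartRat c) := by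
  refine (Scheme.germToFunctionField_injective Y (c ''ᵁ ⊤)).comp ?_
  have : IsIso (chartSection c) := by unfold chartSection; infer_instance
  exact (ConcreteCategory.bijective_of_isIso (chartSection c)).1

theorem chartRat_surj (z : Y.functionField) :
    ∃ a b : R, b ≠ 0 ∧ z = chartRat c a / chartRat c b := by
  -- At the generic point of the chart the stalk is already a localization of `R`, so its elements
  -- are fractions of elements of `R`.
  let p : Spec R := ⟨⊥, Ideal.isPrime_bot⟩
  let := (chartGerm c p).hom.toAlgebra
  have := isLocalization_chartGerm c p
  have key : ∀ x : Y.presheaf.stalk (c p), ∃ a b : R, b ≠ 0 ∧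
      algebraMap _ Y.functionField x = chartRat c a / chartRat c b := fun x => by
    obtain ⟨⟨a, s⟩, ha⟩ := IsLocalization.surj p.asIdeal.primeCompl x
    have hs : (s : R) ≠ 0 := s.2
    refine ⟨a, s, hs, ?_⟩
    rw [eq_div_iff ((map_ne_zero_iff _ (chartRat_injective c)).mpr hs),
      ← algebraMap_chartGerm c p, ← algebraMap_chartGerm c p, ← map_mul]
    exact congrArg _ ha
  obtain ⟨x, y, hy, rfl⟩ := IsFractionRing.div_surjective (A := Y.presheaf.stalk (c p)) z
  obtain ⟨a, s, hs, ha⟩ := key x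
  obtain ⟨b, t, ht, hb⟩ := key y
  have hb0 : b ≠ 0 := by
    rintro rfl
    rw [map_zero, zero_div] at hb
    exact nonZeroDivisors.ne_zero hy ((map_eq_zero_iff _ (IsFractionRing.injective _ _)).mp hb)
  refine ⟨a * t, s * b, mul_ne_zero hs hb0, ?_⟩
  rw [ha, hb, div_div_div_eq, map_mul, map_mul]

theorem chartGerm_ne_zero {p : Spec R} {b : R} (hb : b ≠ 0) : chartGerm c p b ≠ 0 := fun h =>
  hb (chartRat_injective c (by rw [← algebraMap_chartGerm c p, h, map_zero, map_zero]))

variable [IsLocallyNoetherian Y]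

theorem ord_algebraMap_eq {y : Y} (hy : Order.coheight y = 1) {x : Y.presheaf.stalk y} (hx : x ≠ 0)
    {n : ℕ} (hn : Ring.ord (Y.presheaf.stalk y) x = n) :
    Scheme.ord (algebraMap _ Y.functionField x) y = n := by
  have : Ring.KrullDimLE 1 (Y.presheaf.stalk y) := krullDimLE_of_coheight_le hy.le
  rw [Scheme.ord_eq_iff hy ((map_ne_zero_iff _ (IsFractionRing.injective _ _)).mpr hx)]
  refine (Ring.ordFrac_eq_ord (Y.presheaf.stalk y) hx).trans ?_
  exact Ring.ordMonoidWithZeroHom_eq_coe _ (mem_nonZeroDivisors_of_ne_zero hx) hn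

theorem ord_algebraMap_of_isUnit {y : Y} {x : Y.presheaf.stalk y} (hx : IsUnit x) :
    Scheme.ord (algebraMap _ Y.functionField x) y = 0 := by
  by_cases hy : Order.coheight y = 1
  · exact ord_algebraMap_eq hy hx.ne_zero (Ring.ord_of_isUnit hx)
  · exact Scheme.ord_eq_zero_of_coheight_neq_one hy _

theorem ord_algebraMap_pos {y : Y} (hy : Order.coheight y = 1) {x : Y.presheaf.stalk y}
    (hx : x ≠ 0) (hu : ¬ IsUnit x) : 0 < Scheme.ord (algebraMap _ Y.functionField x) y := by
  have : Ring.KrullDimLE 1 (Y.presheaf.stalk y) := krullDimLE_of_coheight_le hy.le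
  obtain ⟨n, hn⟩ := ENat.ne_top_iff_exists.mp (Ring.ord_ne_top (a := x) (by simpa))
  rw [ord_algebraMap_eq hy hx hn.symm]
  have : n ≠ 0 := by
    rintro rfl
    rw [Ring.ord, Nat.cast_zero, eq_comm, Module.length_eq_zero_iff,
      Submodule.Quotient.subsingleton_iff, Ideal.span_singleton_eq_top] at hn
    exact hu hn
  omega

variable {p : Spec R}

theorem ord_chartRat_of_not_mem {b : R} (hb : b ∉ p.asIdeal) :
    Scheme.ord (chartRat c b) (c p) = 0 := by
  rw [← algebraMap_chartGerm c p]
  exact ord_algebraMap_of_isUnit ((isUnit_chartGerm_iff c p b).mpr hb)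

theorem ord_chartRat_pos (hp : Order.coheight (c p) = 1) {b : R} (hb : b ∈ p.asIdeal)
    (hb0 : b ≠ 0) : 0 < Scheme.ord (chartRat c b) (c p) := by
  rw [← algebraMap_chartGerm c p]
  exact ord_algebraMap_pos hp (chartGerm_ne_zero c hb0) fun h => (isUnit_chartGerm_iff c p b).mp h hb

/-- The image of `b` generates the maximal ideal of the local ring, and the quotient by the maximal
ideal has length one. -/
theorem ord_chartRat_eq_one (hp : Order.coheight (c p) = 1) {b : R} (hb0 : b ≠ 0)
    (hb : p.asIdeal = Ideal.span {b}) : Scheme.ord (chartRat c b) (c p) = 1 := by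
  rw [← algebraMap_chartGerm c p]
  refine ord_algebraMap_eq hp (chartGerm_ne_zero c hb0) ?_
  let := (chartGerm c p).hom.toAlgebra
  have := isLocalization_chartGerm c p
  have hm := IsLocalization.AtPrime.map_eq_maximalIdeal p.asIdeal (Y.presheaf.stalk (c p))
  rw [hb, Ideal.map_span, Set.image_singleton] at hm
  have hm' : Ideal.span {chartGerm c p b} = IsLocalRing.maximalIdeal _ := hm
  rw [Ring.ord, hm', Nat.cast_one, Module.length_eq_one_iff, isSimpleModule_iff_isCoatom]
  exact Ideal.isMaximal_def.mp inferInstance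

end Order

end Stringy

namespace Stringy

/-! ### Coordinates on smooth affine toric charts -/

section Coordinates

variable {d : ℕ}

/-- The basis of the character lattice dual to a basis of `N`. -/
noncomputable def dualBasis (b : Module.Basis (Fin d) ℤ (Fin d → ℤ)) :
    Module.Basis (Fin d) ℤ (Fin d → ℤ) :=
  (Pi.basisFun ℤ (Fin d)).map (dualCoords b).symm

theorem intPairing_dualBasis (b : Module.Basis (Fin d) ℤ (Fin d → ℤ)) (i j : Fin d) :
    intPairing (dualBasis b i) (b j) = (Pi.single i 1 : Fin d → ℤ) j := by
  rw [← dualCoords_apply, dualBasis, Module.Basis.map_apply, LinearEquiv.apply_symm_apply,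
    Pi.basisFun_apply]

theorem mem_dualMonoid_iff (b : Module.Basis (Fin d) ℤ (Fin d → ℤ)) (s : Set (Fin d))
    (m : Fin d → ℤ) :
    m ∈ dualMonoid (latticeCone (b '' s)) ↔ ∀ j ∈ s, 0 ≤ dualCoords b m j := by
  refine pairing_nonneg_on_latticeCone.trans ?_
  rw [Set.forall_mem_image]
  simp only [dualCoords_apply]

variable (b : Module.Basis (Fin d) ℤ (Fin d → ℤ)) (s : Set (Fin d))

/-- The inclusion of the monoid of effective monomials in the coordinates. -/
noncomputable def monomialHom : (Fin d →₀ ℕ) →+ dualMonoid (latticeCone (b '' s)) where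
  toFun e := ⟨(dualCoords b).symm fun j => (e j : ℤ), (mem_dualMonoid_iff b s _).mpr fun j _ => by
    rw [LinearEquiv.apply_symm_apply]
    exact Int.natCast_nonneg _⟩
  map_zero' := Subtype.ext (by
    refine (congrArg (dualCoords b).symm (funext fun j => ?_)).trans (map_zero _)
    simp)
  map_add' e f := Subtype.ext (by
    refine (congrArg (dualCoords b).symm (funext fun j => ?_)).trans (map_add _ _ _)
    simp)

theorem dualCoords_monomialHom (e : Fin d →₀ ℕ) (j : Fin d) :
    dualCoords b (monomialHom b s e : Fin d → ℤ) j = e j := by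
  simp [monomialHom]

theorem monomialHom_injective : Function.Injective (monomialHom b s) := fun e f h => by
  ext j
  have := congrArg (fun m : dualMonoid (latticeCone (b '' s)) => dualCoords b m j) h
  simpa [dualCoords_monomialHom] using this

/-- The inclusion of the polynomial ring in the coordinates. -/
noncomputable def coordHom : MvPolynomial (Fin d) ℂ →ₐ[ℂ] ConeRing (latticeCone (b '' s)) :=
  AddMonoidAlgebra.mapDomainAlgHom ℂ ℂ (monomialHom b s)

theorem coordHom_injective : Function.Injective (coordHom b s) :=
  AddMonoidAlgebra.mapDomain_injective (monomialHom_injective b s)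

theorem coordHom_monomial (e : Fin d →₀ ℕ) (a : ℂ) :
    coordHom b s (MvPolynomial.monomial e a) = AddMonoidAlgebra.single (monomialHom b s e) a :=
  AddMonoidAlgebra.mapDomain_single

/-- The characters forming the basis dual to `b`. -/
noncomputable def coordVec (j : Fin d) : dualMonoid (latticeCone (b '' s)) :=
  ⟨dualBasis b j, (mem_dualMonoid_iff b s _).mpr fun i _ => by
    rw [dualCoords_apply, intPairing_dualBasis]
    rw [Pi.single_apply]
    split_ifs <;> simp⟩

theorem coordHom_X (j : Fin d) : coordHom b s (MvPolynomial.X j) = chi (coordVec b s j) := by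
  rw [MvPolynomial.X, coordHom_monomial]
  congr 1
  refine Subtype.ext ((dualCoords b).injective (funext fun i => ?_))
  rw [dualCoords_monomialHom, coordVec, dualCoords_apply, intPairing_dualBasis]
  simp [Finsupp.single_apply, Pi.single_apply, eq_comm]

theorem isUnit_chi {σ : PointedCone ℝ (Fin d → ℝ)} (m : dualMonoid σ)
    (hm : -(m : Fin d → ℤ) ∈ dualMonoid σ) : IsUnit (chi m) := by
  refine IsUnit.of_mul_eq_one (chi ⟨_, hm⟩) ?_
  rw [AddMonoidAlgebra.single_mul_single, one_mul]
  have : m + ⟨-(m : Fin d → ℤ), hm⟩ = 0 := Subtype.ext (add_neg_cancel _)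
  rw [this]
  rfl

/-- Negative exponents occur only at indices outside `s`, where the coordinates are invertible; a
unit monomial clears them. So the ring is a localization of the polynomial ring in the coordinates,
inverting only elements that become units. -/
theorem exists_coordHom_mul_eq (f : ConeRing (latticeCone (b '' s))) :
    ∃ q a, IsUnit (coordHom b s q) ∧ coordHom b s q * f = coordHom b s a := by
  classical
  induction f using AddMonoidAlgebra.induction_linear with
  | zero => exact ⟨1, 0, by simp, by simp⟩
  | add f g hf hg =>
    obtain ⟨q, a, hq, h⟩ := hf
    obtain ⟨q', a', hq', h'⟩ := hg
    refine ⟨q * q', q' * a + q * a', by rw [map_mul]; exact hq.mul hq', ?_⟩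
    simp only [map_mul, map_add, ← h, ← h']
    ring
  | single m c =>
    let e : Fin d →₀ ℕ := Finsupp.equivFunOnFinite.symm fun j =>
      if j ∈ s then 0 else (dualCoords b (m : Fin d → ℤ) j).natAbs
    have he : ∀ j, e j = if j ∈ s then 0 else (dualCoords b (m : Fin d → ℤ) j).natAbs :=
      fun j => rfl
    refine ⟨MvPolynomial.monomial e 1, MvPolynomial.monomial (Finsupp.equivFunOnFinite.symm fun j =>
      (dualCoords b (m : Fin d → ℤ) j + e j).toNat) c, ?_, ?_⟩
    · rw [coordHom_monomial]
      refine isUnit_chi _ ((mem_dualMonoid_iff b s _).mpr fun j hj => ?_)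
      rw [map_neg, Pi.neg_apply, dualCoords_monomialHom, he, if_pos hj]
      simp
    · rw [coordHom_monomial, coordHom_monomial, AddMonoidAlgebra.single_mul_single, one_mul]
      congr 1
      refine Subtype.ext ((dualCoords b).injective (funext fun j => ?_))
      rw [dualCoords_monomialHom, AddSubmonoid.coe_add, map_add, Pi.add_apply,
        dualCoords_monomialHom, he]
      change _ = (((dualCoords b (m : Fin d → ℤ) j + e j).toNat : ℕ) : ℤ)
      rw [he]
      have hm := (mem_dualMonoid_iff b s _).mp m.2 j
      split_ifs with h
      · have := hm h
        omega
      · omega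

/-- A fraction over `B` is rewritten over `A` by clearing numerator and denominator with elements
whose images are units, which do not affect membership in `p`. For a toric chart it presents its
stalks as localizations of a polynomial ring. -/
theorem isLocalization_comp {A B O : Type*} [CommRing A] [CommRing B] [CommRing O] (φ : A →+* B)
    (hφ : Function.Injective φ) (h : ∀ f, ∃ q a, IsUnit (φ q) ∧ φ q * f = φ a) (p : Ideal B)
    [p.IsPrime] [Algebra B O] [IsLocalization.AtPrime O p] :
    letI := ((algebraMap B O).comp φ).toAlgebra
    IsLocalization (p.primeCompl.comap φ) O := by
  let := ((algebraMap B O).comp φ).toAlgebra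
  have hA : ∀ a : A, algebraMap A O a = algebraMap B O (φ a) := fun a => rfl
  have hu : ∀ {u t : B}, IsUnit u → t ∉ p → u * t ∉ p := fun hu ht h =>
    ht (((Ideal.unit_mul_mem_iff_mem p hu)).mp h)
  refine ⟨fun x => ?_, fun z => ?_, fun {x y} hxy => ?_⟩
  · exact IsLocalization.map_units O (⟨φ x, x.2⟩ : p.primeCompl)
  · obtain ⟨⟨f, t⟩, hz⟩ := IsLocalization.surj p.primeCompl z
    obtain ⟨q, a, hq, ha⟩ := h f
    obtain ⟨q', a', hq', ha'⟩ := h t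
    refine ⟨(q' * a, ⟨q * a', ?_⟩), ?_⟩
    · change φ (q * a') ∉ p
      rw [map_mul, ← ha', ← mul_assoc]
      exact hu (hq.mul hq') t.2
    · change z * algebraMap B O (φ (q * a')) = algebraMap B O (φ (q' * a))
      rw [map_mul φ, map_mul φ, ← ha', ← ha]
      simp only [map_mul]
      rw [← hz]
      ring
  · obtain ⟨t, ht⟩ := (IsLocalization.eq_iff_exists p.primeCompl O).mp hxy
    obtain ⟨q, a, hq, ha⟩ := h t
    refine ⟨⟨a, ?_⟩, hφ ?_⟩
    · change φ a ∉ p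
      rw [← ha]
      exact hu hq t.2
    · change φ (a * x) = φ (a * y)
      rw [map_mul, map_mul, ← ha, mul_assoc, mul_assoc, ht]

end Coordinates

end Stringy

namespace Stringy

/-! ### Orders of top forms along toric divisors -/

section OrdLemmas

variable {Y : Scheme.{0}} [AlgebraicGeometry.IsIntegral Y] [IsLocallyNoetherian Y]

theorem ord_one (y : Y) : Scheme.ord (1 : Y.functionField) y = 0 := by
  rw [← map_one (algebraMap (Y.presheaf.stalk y) Y.functionField)]
  exact ord_algebraMap_of_isUnit isUnit_one

theorem ord_inv {f : Y.functionField} (hf : f ≠ 0) (y : Y) :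
    Scheme.ord f⁻¹ y = -Scheme.ord f y := by
  have h := Scheme.ord_mul (x := y) hf (inv_ne_zero hf)
  rw [mul_inv_cancel₀ hf, ord_one] at h
  omega

theorem ord_div {f g : Y.functionField} (hf : f ≠ 0) (hg : g ≠ 0) (y : Y) :
    Scheme.ord (f / g) y = Scheme.ord f y - Scheme.ord g y := by
  rw [div_eq_mul_inv, Scheme.ord_mul hf (inv_ne_zero hg), ord_inv hg, sub_eq_add_neg]

theorem ord_prod {ι : Type*} (s : Finset ι) {f : ι → Y.functionField} (hf : ∀ i ∈ s, f i ≠ 0)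
    (y : Y) : Scheme.ord (∏ i ∈ s, f i) y = ∑ i ∈ s, Scheme.ord (f i) y := by
  classical
  induction s using Finset.induction_on with
  | empty => simpa using ord_one y
  | insert i s hi ih =>
    rw [Finset.prod_insert hi, Finset.sum_insert hi, Scheme.ord_mul (hf i (Finset.mem_insert_self i s))
      (Finset.prod_ne_zero_iff.mpr fun j hj => hf j (Finset.mem_insert_of_mem hj)),
      ih fun j hj => hf j (Finset.mem_insert_of_mem hj)]

theorem ord_pow {f : Y.functionField} (hf : f ≠ 0) (n : ℕ) (y : Y) :
    Scheme.ord (f ^ n) y = n * Scheme.ord f y := by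
  have := ord_prod (Finset.range n) (f := fun _ => f) (fun _ _ => hf) y
  simpa using this

end OrdLemmas

section FormOrder

variable {d : ℕ} {Y : CVariety} [AlgebraicGeometry.IsIntegral Y.X]

instance isDomain_coneRing {σ : PointedCone ℝ (Fin d → ℝ)} :
    IsDomain (CommRingCat.of (ConeRing σ)) :=
  inferInstanceAs (IsDomain (ConeRing σ))

omit [AlgebraicGeometry.IsIntegral Y.X] in
/-- Compatibility of the functions on a chart with the complex structure. -/
theorem chartGerm_algebraMap {R : Type} [CommRing R] [Algebra ℂ R]
    (c : Spec (CommRingCat.of R) ⟶ Y.X) [IsOpenImmersion c]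
    (hc : c ≫ Y.str = Spec.map (CommRingCat.ofHom (algebraMap ℂ R)))
    (p : Spec (CommRingCat.of R)) (z : ℂ) :
    chartGerm c p (algebraMap ℂ R z) = algebraMap ℂ (Y.X.presheaf.stalk (c p)) z := by
  have h1 : CommRingCat.ofHom (algebraMap ℂ R) ≫ chartSection c =
      (Scheme.ΓSpecIso (CommRingCat.of ℂ)).inv ≫ Y.str.appTop ≫
        Y.X.presheaf.map (homOfLE le_top).op := by
    rw [chartSection, ← cancel_mono (c.appIso ⊤).hom]
    simp only [Category.assoc, Iso.inv_hom_id, Category.comp_id]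
    have h2 := Scheme.ΓSpecIso_inv_naturality (CommRingCat.ofHom (algebraMap ℂ R))
    rw [← hc, Scheme.Hom.comp_appTop] at h2
    rw [Scheme.Hom.appIso_hom', Scheme.Hom.map_appLE, h2]
    simp [Scheme.Hom.appLE]
    rfl
  have h3 : CommRingCat.ofHom (algebraMap ℂ R) ≫ chartGerm c p =
      (Scheme.ΓSpecIso (CommRingCat.of ℂ)).inv ≫ Y.str.appTop ≫
        Y.X.presheaf.germ ⊤ (c p) trivial := by
    rw [chartGerm, reassoc_of% h1]
    congr 2
    exact TopCat.Presheaf.germ_res _ _ _ _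
  exact RingHom.congr_fun (congrArg CommRingCat.Hom.hom h3) z

variable (χ : Multiplicative (Fin d → ℤ) →* Y.X.functionField)

/-- `χ` gives the characters on the chart `c`. -/
def IsCharOn {σ : PointedCone ℝ (Fin d → ℝ)} (c : coneScheme σ ⟶ Y.X) [IsOpenImmersion c] : Prop :=
  ∀ m : dualMonoid σ, chartRat c (chi m) = χ (Multiplicative.ofAdd (m : Fin d → ℤ))

variable {χ}

theorem char_ne_zero (m : Fin d → ℤ) : χ (Multiplicative.ofAdd m) ≠ 0 :=
  ((Group.isUnit _).map χ).ne_zero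

variable (b : Module.Basis (Fin d) ℤ (Fin d → ℤ)) (s : Set (Fin d))
  (c : coneScheme (latticeCone (b '' s)) ⟶ Y.X) [IsOpenImmersion c]
  (hc : c ≫ Y.str = Spec.map (CommRingCat.ofHom (algebraMap ℂ (ConeRing (latticeCone (b '' s))))))

-- The stalk is a localization of `ℂ[x₁, …, x_d]`, whose differentials are free on the `dx_j`, and
-- differentials commute with localization.
include hc in
omit [AlgebraicGeometry.IsIntegral Y.X] in
theorem span_D_chartGerm (p : coneScheme (latticeCone (b '' s))) :
    Submodule.span (Y.X.presheaf.stalk (c p)) (Set.range fun j =>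
      KaehlerDifferential.D ℂ (Y.X.presheaf.stalk (c p)) (chartGerm c p (chi (coordVec b s j)))) = ⊤ := by
  have hp : p.asIdeal.IsPrime := PrimeSpectrum.isPrime p
  refine span_D_eq_top _ (p.asIdeal.primeCompl.comap (coordHom b s)) ?_
  let := (chartGerm c p).hom.toAlgebra
  have := isLocalization_chartGerm c p
  have h := isLocalization_comp (O := Y.X.presheaf.stalk (c p)) (coordHom b s).toRingHom
    (coordHom_injective b s) (exists_coordHom_mul_eq b s) p.asIdeal
  have e : (chartGerm c p).hom.comp (coordHom b s).toRingHom =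
      (MvPolynomial.aeval (R := ℂ) fun j => chartGerm c p (chi (coordVec b s j))).toRingHom := by
    refine MvPolynomial.ringHom_ext (fun z => ?_) fun j => ?_
    · refine Eq.trans ?_ (MvPolynomial.aeval_C _ z).symm
      refine Eq.trans ?_ (chartGerm_algebraMap c hc p z)
      exact congrArg (chartGerm c p) ((coordHom b s).commutes z)
    · refine Eq.trans ?_ (MvPolynomial.aeval_X _ j).symm
      exact congrArg (chartGerm c p) (coordHom_X b s j)
  rw [← e]
  exact h

include hc in
theorem isFractionRing_coord (hχ : IsCharOn χ c) :
    letI := (MvPolynomial.aeval (R := ℂ) fun j =>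
      χ (Multiplicative.ofAdd (dualBasis b j))).toRingHom.toAlgebra
    IsFractionRing (MvPolynomial (Fin d) ℂ) Y.X.functionField := by
  let := (MvPolynomial.aeval (R := ℂ) fun j =>
      χ (Multiplicative.ofAdd (dualBasis b j))).toRingHom.toAlgebra
  have e : (chartRat c).comp (coordHom b s).toRingHom = algebraMap _ Y.X.functionField := by
    refine MvPolynomial.ringHom_ext (fun z => ?_) fun j => ?_
    · refine Eq.trans ?_ (MvPolynomial.aeval_C _ z).symm
      let p : coneScheme (latticeCone (b '' s)) := Classical.arbitrary (PrimeSpectrum (ConeRing _))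
      rw [IsScalarTower.algebraMap_apply ℂ (Y.X.presheaf.stalk (c p)), ← chartGerm_algebraMap c hc p z,
        algebraMap_chartGerm]
      exact congrArg (chartRat c) ((coordHom b s).commutes z)
    · refine Eq.trans ?_ (MvPolynomial.aeval_X _ j).symm
      exact (congrArg (chartRat c) (coordHom_X b s j)).trans (hχ _)
  have e' : ∀ x, algebraMap _ Y.X.functionField x = chartRat c (coordHom b s x) := fun x =>
    (RingHom.congr_fun e x).symm
  have hinj : Function.Injective (algebraMap (MvPolynomial (Fin d) ℂ) Y.X.functionField) := by
    rw [← e]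
    exact (chartRat_injective c).comp (coordHom_injective b s)
  have : FaithfulSMul (MvPolynomial (Fin d) ℂ) Y.X.functionField :=
    (faithfulSMul_iff_algebraMap_injective _ _).mpr hinj
  refine IsFractionRing.of_field _ _ fun z => ?_
  obtain ⟨f, g, hg, rfl⟩ := chartRat_surj c z
  obtain ⟨q, a, hq, ha⟩ := exists_coordHom_mul_eq b s f
  obtain ⟨q', a', hq', ha'⟩ := exists_coordHom_mul_eq b s g
  refine ⟨q' * a, q * a', ?_⟩
  have h0 : ∀ {u : ConeRing (latticeCone (b '' s))}, u ≠ 0 → chartRat c u ≠ 0 := fun hu h =>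
    hu (chartRat_injective c (h.trans (map_zero _).symm))
  have h1 : chartRat c (coordHom b s q) ≠ 0 := h0 hq.ne_zero
  have h2 : chartRat c (coordHom b s q') ≠ 0 := h0 hq'.ne_zero
  have h3 : chartRat c g ≠ 0 := h0 hg
  rw [e', e', map_mul (coordHom b s), map_mul (coordHom b s), ← ha, ← ha']
  have h4 : ∀ u v : ConeRing (latticeCone (b '' s)), chartRat c (u * v) = chartRat c u * chartRat c v :=
    fun u v => map_mul (chartRat c) u v
  simp only [h4]
  field_simp

-- The function field is the fraction field of the polynomial ring in the coordinates, so the top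
-- forms are spanned by `dx₁ ∧ ⋯ ∧ dx_d`, which is `∏ x_j` times the logarithmic form.
include hc in
theorem exists_smul_dlogForm (hχ : IsCharOn χ c)
    (ω : ⋀[Y.X.functionField]^d Ω[Y.X.functionField⁄ℂ]) :
    ∃ g : Y.X.functionField, ω = g • dlogForm χ (dualBasis b) := by
  have h := span_D_eq_top _ _ (isFractionRing_coord b s c hc hχ)
  have h1 := span_ιMulti_eq_top h
  obtain ⟨g, hg⟩ := Submodule.mem_span_singleton.mp (h1 ▸ Submodule.mem_top (x := ω))
  rw [ιMulti_D_eq, smul_smul] at hg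
  exact ⟨_, hg.symm⟩

include hc in
/-- The order of a top form at a point of codimension one of a smooth toric chart. -/
theorem ord_eq_of_dlogForm (hχ : IsCharOn χ c) (p : coneScheme (latticeCone (b '' s)))
    {ω : ⋀[Y.X.functionField]^d Ω[Y.X.functionField⁄ℂ]} (hω : ω ≠ 0) {g t : Y.X.functionField}
    {e : Module.Basis (Fin d) ℤ (Fin d → ℤ)} (hg : ω = g • dlogForm χ e)
    {θ : ⋀[Y.X.presheaf.stalk (c p)]^d Ω[Y.X.presheaf.stalk (c p)⁄ℂ]}
    (hθ : Submodule.span (Y.X.presheaf.stalk (c p)) {θ} = ⊤)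
    (ht : ω = t • formMap (Y.X.presheaf.stalk (c p)) Y.X.functionField d θ) :
    Scheme.ord t (c p) =
      Scheme.ord g (c p) - ∑ j, Scheme.ord (χ (Multiplicative.ofAdd (dualBasis b j))) (c p) := by
  have hη := span_ιMulti_eq_top (span_D_chartGerm b s c hc p)
  obtain ⟨u, hu⟩ := dlogForm_basis χ (dualBasis b) e
  have hprod : ∏ j, χ (Multiplicative.ofAdd (dualBasis b j)) ≠ 0 :=
    Finset.prod_ne_zero_iff.mpr fun j _ => char_ne_zero _
  -- The local generator `dx₁ ∧ ⋯ ∧ dx_d` is `∏ x_j` times the logarithmic form, so `t` is `g`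
  -- divided by `∏ x_j`, up to a sign and a unit of the local ring.
  have hF : formMap (Y.X.presheaf.stalk (c p)) Y.X.functionField d
      (exteriorPower.ιMulti _ d fun j => KaehlerDifferential.D ℂ (Y.X.presheaf.stalk (c p))
        (chartGerm c p (chi (coordVec b s j)))) =
      (∏ j, χ (Multiplicative.ofAdd (dualBasis b j))) • dlogForm χ (dualBasis b) := by
    rw [← ιMulti_D_eq, formMap, exteriorPower.alternatingMapLinearEquiv_apply_ιMulti]
    refine congrArg (exteriorPower.ιMulti Y.X.functionField d) (funext fun j => ?_)
    refine (KaehlerDifferential.map_D ℂ ℂ _ _ _).trans ?_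
    rw [algebraMap_chartGerm]
    exact congrArg _ (hχ _)
  have hωη : ω = (g * (u : ℤ) * (∏ j, χ (Multiplicative.ofAdd (dualBasis b j)))⁻¹) •
      formMap (Y.X.presheaf.stalk (c p)) Y.X.functionField d
      (exteriorPower.ιMulti _ d fun j => KaehlerDifferential.D ℂ (Y.X.presheaf.stalk (c p))
        (chartGerm c p (chi (coordVec b s j)))) := by
    rw [hF, smul_smul, inv_mul_cancel_right₀ hprod, hg, hu, mul_smul, Int.cast_smul_eq_zsmul]
  obtain ⟨w, hw⟩ := exists_unit_smul_eq (formMap (Y.X.presheaf.stalk (c p)) Y.X.functionField d)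
    hθ hη (ht.symm.trans hωη) (ht ▸ hω)
  have hg0 : g ≠ 0 := by
    rintro rfl
    exact hω (by rw [hg, zero_smul])
  have hu0 : ((u : ℤ) : Y.X.functionField) = algebraMap (Y.X.presheaf.stalk (c p)) _ (u : ℤ) := by
    simp
  have hu1 : IsUnit ((u : ℤ) : Y.X.presheaf.stalk (c p)) := u.isUnit.map (Int.castRingHom _)
  have hu2 : ((u : ℤ) : Y.X.functionField) ≠ 0 := by
    rw [hu0]
    exact (hu1.map (algebraMap _ Y.X.functionField)).ne_zero
  have hw2 : algebraMap (Y.X.presheaf.stalk (c p)) Y.X.functionField w ≠ 0 :=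
    (w.isUnit.map (algebraMap _ Y.X.functionField)).ne_zero
  rw [hw, Scheme.ord_mul hw2 (mul_ne_zero (mul_ne_zero hg0 hu2) (inv_ne_zero hprod)),
    Scheme.ord_mul (mul_ne_zero hg0 hu2) (inv_ne_zero hprod), Scheme.ord_mul hg0 hu2,
    ord_inv hprod, ord_algebraMap_of_isUnit w.isUnit, hu0, ord_algebraMap_of_isUnit hu1,
    ord_prod _ fun j _ => char_ne_zero _]
  ring

end FormOrder

end Stringy

namespace Stringy

/-! ### Extremal rays -/

section Rays

variable {d : ℕ}

theorem pairing_add_right (m : Fin d → ℤ) (x y : Fin d → ℝ) :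
    pairing m (x + y) = pairing m x + pairing m y := by
  simp [pairing, mul_add, Finset.sum_add_distrib]

theorem pairing_smul_right (m : Fin d → ℤ) (c : {r : ℝ // 0 ≤ r}) (x : Fin d → ℝ) :
    pairing m (c • x) = c * pairing m x := by
  simp only [pairing, Finset.mul_sum]
  refine Finset.sum_congr rfl fun i _ => ?_
  change (m i : ℝ) * ((c : ℝ) * x i) = _
  ring

theorem latticeCone_mono {s t : Set (Fin d → ℤ)} (h : s ⊆ t) : latticeCone s ≤ latticeCone t :=
  Submodule.span_mono (Set.image_mono h)

/-- A face is generated by the generators it contains. -/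
theorem mem_latticeCone_of_pairing_eq_zero {s : Set (Fin d → ℤ)} {m : Fin d → ℤ}
    (hm : ∀ v ∈ s, 0 ≤ intPairing m v) {x : Fin d → ℝ} (hx : x ∈ latticeCone s)
    (h0 : pairing m x = 0) : x ∈ latticeCone {v ∈ s | intPairing m v = 0} := by
  have hpos := pairing_nonneg_on_latticeCone.mpr hm
  induction hx using Submodule.span_induction with
  | mem x hx =>
    obtain ⟨v, hv, rfl⟩ := hx
    change pairing m (toReal v) = 0 at h0
    rw [pairing_toReal] at h0
    exact toReal_mem_latticeCone (v := v) ⟨hv, by exact_mod_cast h0⟩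
  | zero => exact zero_mem _
  | add x y hx hy ihx ihy =>
    rw [pairing_add_right] at h0
    have h2 := hpos x hx
    have h3 := hpos y hy
    exact add_mem (ihx (by linarith)) (ihy (by linarith))
  | smul c x hx ih =>
    rw [pairing_smul_right, mul_eq_zero] at h0
    rcases h0 with h0 | h0
    · have : c = 0 := Subtype.ext h0
      rw [this, zero_smul]
      exact zero_mem _
    · exact Submodule.smul_mem _ _ (ih h0)

theorem isFace_latticeCone {s : Set (Fin d → ℤ)} {m : Fin d → ℤ}
    (hm : ∀ v ∈ s, 0 ≤ intPairing m v) :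
    IsFace (latticeCone {v ∈ s | intPairing m v = 0}) (latticeCone s) := by
  refine ⟨m, pairing_nonneg_on_latticeCone.mpr hm, fun x => ⟨fun hx => ⟨?_, ?_⟩, fun hx => ?_⟩⟩
  · exact latticeCone_mono (fun v hv => hv.1) hx
  · refine le_antisymm ?_ (pairing_nonneg_on_latticeCone.mpr hm x
      (latticeCone_mono (fun v hv => hv.1) hx))
    have h := pairing_nonneg_on_latticeCone (s := {v ∈ s | intPairing m v = 0}) (m := -m)
    have h1 := h.mpr (fun v hv => by
      have : intPairing (-m) v = - intPairing m v := by simp [intPairing]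
      rw [this, hv.2, neg_zero]) x hx
    have h2 : pairing (-m) x = -pairing m x := by simp [pairing]
    linarith
  · exact mem_latticeCone_of_pairing_eq_zero hm hx.1 hx.2

theorem exists_nonneg_combination {T : Finset (Fin d → ℤ)} {x : Fin d → ℝ}
    (hx : x ∈ latticeCone (T : Set (Fin d → ℤ))) :
    ∃ c : (Fin d → ℤ) → ℝ, (∀ w, 0 ≤ c w) ∧ x = ∑ w ∈ T, c w • toReal w := by
  classical
  induction hx using Submodule.span_induction with
  | mem x hx =>
    obtain ⟨v, hv, rfl⟩ := hx
    refine ⟨fun w => if w = v then 1 else 0, fun w => by positivity, ?_⟩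
    simp only [ite_smul, one_smul, zero_smul]
    rw [Finset.sum_ite_eq' T v, if_pos (Finset.mem_coe.mp hv)]
    rfl
  | zero => exact ⟨0, fun _ => le_rfl, by simp⟩
  | add x y _ _ hx hy =>
    obtain ⟨c, hc, rfl⟩ := hx
    obtain ⟨c', hc', rfl⟩ := hy
    exact ⟨c + c', fun w => add_nonneg (hc w) (hc' w), by
      simp only [Pi.add_apply, add_smul, Finset.sum_add_distrib]⟩
  | smul a x _ hx =>
    obtain ⟨c, hc, rfl⟩ := hx
    exact ⟨fun w => a * c w, fun w => mul_nonneg a.2 (hc w), by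
      simp only [mul_smul, ← Finset.smul_sum]
      rfl⟩

/-- The rays of a cone of the fan which are spanned by a part of a basis. -/
theorem isFace_singleton (b : Module.Basis (Fin d) ℤ (Fin d → ℤ)) {s : Set (Fin d)} {k : Fin d}
    (hk : k ∈ s) : IsFace (latticeCone {b k}) (latticeCone (b '' s)) := by
  classical
  -- The sum of the dual basis vectors other than the `k`-th vanishes on `b k` and equals `1` on the
  -- remaining vectors of `b`, so it cuts out the ray.
  have hp : ∀ i, intPairing (∑ j ∈ Finset.univ.erase k, dualBasis b j) (b i) =
      if i = k then 0 else 1 := fun i => by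
    rw [← dualCoords_apply, map_sum, Finset.sum_apply]
    simp only [dualCoords_apply, intPairing_dualBasis, Pi.single_apply]
    rw [Finset.sum_ite_eq]
    simp
  have h := isFace_latticeCone (s := b '' s) (m := ∑ j ∈ Finset.univ.erase k, dualBasis b j) (by
    rintro _ ⟨i, -, rfl⟩
    rw [hp]
    split_ifs <;> simp)
  have h2 : {v ∈ b '' s | intPairing (∑ j ∈ Finset.univ.erase k, dualBasis b j) v = 0} = {b k} := by
    ext v
    constructor
    · rintro ⟨⟨i, -, rfl⟩, hi⟩
      rw [hp] at hi
      by_contra hne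
      rw [if_neg (fun h => hne (by rw [h]; rfl))] at hi
      exact one_ne_zero hi
    · rintro rfl
      exact ⟨⟨k, hk, rfl⟩, by rw [hp, if_pos rfl]⟩
  rwa [h2] at h

/-- `w` generates a ray of `Δ`, and is a part of a basis of the lattice. -/
def Fan.IsPrimitiveRay (Δ : Fan d) (w : Fin d → ℤ) : Prop :=
  latticeCone {w} ∈ Δ.cones ∧ ∃ (b : Module.Basis (Fin d) ℤ (Fin d → ℤ)) (k : Fin d), b k = w

variable {Δ Δ' : Fan d}

/-- The rays of the subdivision generate each cone of the fan. -/
theorem Fan.IsRegularSubdivision.exists_generators (hΔ : Δ'.IsRegularSubdivision Δ)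
    {τ : PointedCone ℝ (Fin d → ℝ)} (hτ : τ ∈ Δ.cones) :
    ∃ T : Finset (Fin d → ℤ), latticeCone (T : Set (Fin d → ℤ)) = τ ∧
      ∀ w ∈ T, Δ'.IsPrimitiveRay w := by
  classical
  have := Δ'.finite.to_subtype
  choose b s hbs using fun σ' : Δ'.cones => hΔ.regular σ' σ'.2
  let G : Set (Fin d → ℤ) := ⋃ σ' : Δ'.cones, (b σ') '' (s σ')
  have hG : G.Finite := Set.finite_iUnion fun σ' => (Set.toFinite _).image _
  refine ⟨{w ∈ hG.toFinset | toReal w ∈ τ}, le_antisymm ?_ fun x hx => ?_, fun w hw => ?_⟩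
  · refine Submodule.span_le.mpr ?_
    rintro _ ⟨w, hw, rfl⟩
    exact (Finset.mem_filter.mp hw).2
  · obtain ⟨σ', hσ', hx'⟩ := hΔ.support τ hτ x hx
    obtain ⟨σ, hσ, hle⟩ := hΔ.le σ' hσ'
    -- `x` lies in a cone `σ'` of the subdivision contained in `σ`, and `σ ∩ τ` is the face of `σ`
    -- cut out by `m`. Then `x` is a combination of those generators of `σ'` on which `m` vanishes,
    -- and these lie in `τ`.
    obtain ⟨m, hm, hface⟩ := Δ.inf_isFace σ hσ τ hτ
    have hx0 := ((hface x).mp ⟨hle hx', hx⟩).2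
    have hbs' := hbs ⟨σ', hσ'⟩
    change σ' = _ at hbs'
    have hm' : ∀ v ∈ b ⟨σ', hσ'⟩ '' s ⟨σ', hσ'⟩, 0 ≤ intPairing m v := by
      rw [← pairing_nonneg_on_latticeCone, ← hbs']
      exact fun x hx => hm x (hle hx)
    refine latticeCone_mono ?_ (mem_latticeCone_of_pairing_eq_zero hm' (hbs' ▸ hx') hx0)
    rintro v ⟨hv, hv0⟩
    refine Finset.mem_coe.mpr (Finset.mem_filter.mpr ⟨hG.mem_toFinset.mpr
      (Set.mem_iUnion.mpr ⟨⟨σ', hσ'⟩, hv⟩), ?_⟩)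
    refine ((hface _).mpr ⟨hle ?_, ?_⟩).2
    · rw [hbs']
      exact toReal_mem_latticeCone hv
    · rw [pairing_toReal, hv0, Int.cast_zero]
  · obtain ⟨σ', k, hk, rfl⟩ := Set.mem_iUnion.mp (hG.mem_toFinset.mp (Finset.mem_filter.mp hw).1)
    refine ⟨Δ'.face_mem σ' σ'.2 _ ?_, b σ', k, rfl⟩
    have := isFace_singleton (b σ') hk
    rwa [← hbs σ'] at this

/-- Every cone of the fan is generated by common rays of the fan and the subdivision. -/
theorem Fan.IsRegularSubdivision.exists_extremal_generators (hΔ : Δ'.IsRegularSubdivision Δ)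
    {τ : PointedCone ℝ (Fin d → ℝ)} (hτ : τ ∈ Δ.cones) :
    ∃ T : Finset (Fin d → ℤ), latticeCone (T : Set (Fin d → ℤ)) = τ ∧
      ∀ w ∈ T, Δ'.IsPrimitiveRay w ∧ latticeCone {w} ∈ Δ.cones := by
  classical
  obtain ⟨T₀, hT₀, hray⟩ := hΔ.exists_generators hτ
  -- In a minimal set of generators every member spans an extremal ray, that is, a face of `τ`.
  obtain ⟨T, hTT₀, hTmin⟩ := Set.Finite.exists_le_minimal
    (s := {T : Finset (Fin d → ℤ) | T ⊆ T₀ ∧ latticeCone (T : Set (Fin d → ℤ)) = τ})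
    ((Finset.finite_toSet T₀.powerset).subset fun T hT => Finset.mem_coe.mpr
      (Finset.mem_powerset.mpr hT.1)) ⟨Finset.Subset.refl T₀, hT₀⟩
  have hT := hTmin.prop.2
  refine ⟨T, hT, fun w hw => ⟨hray w (hTT₀ hw), ?_⟩⟩
  have hmemτ : ∀ v ∈ T, toReal v ∈ τ := fun v hv => hT ▸ toReal_mem_latticeCone (Finset.mem_coe.mpr hv)
  have hsc := Δ.strongly_convex τ hτ
  obtain ⟨m, hmw, hm⟩ := exists_intPairing_pos (T.erase w) w fun c t hc hct v hv => by
    have hsmul : ∀ {r : ℝ} {x : Fin d → ℝ}, 0 ≤ r → ∀ {σ : PointedCone ℝ (Fin d → ℝ)}, x ∈ σ →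
      r • x ∈ σ := fun {r x} hr σ hx => Submodule.smul_mem σ (⟨r, hr⟩ : {r : ℝ // 0 ≤ r}) hx
    by_contra hne
    -- A nontrivial nonnegative combination equal to `t w` is impossible: for `t > 0` it makes `w`
    -- redundant, and for `t ≤ 0` it puts the negative of a nonzero vector of `τ` into `τ`.
    rcases lt_or_ge 0 t with ht | ht
    · have hwT : toReal w ∈ latticeCone ((T.erase w : Finset _) : Set (Fin d → ℤ)) := by
        have h1 : toReal w = t⁻¹ • ∑ v ∈ T.erase w, c v • toReal v := by
          rw [hct, smul_smul, inv_mul_cancel₀ ht.ne', one_smul]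
        rw [h1]
        exact hsmul (inv_nonneg.mpr ht.le) (sum_mem fun u hu =>
          hsmul (hc u hu) (toReal_mem_latticeCone (Finset.mem_coe.mpr hu)))
      have h2 : latticeCone ((T.erase w : Finset _) : Set (Fin d → ℤ)) = τ := by
        refine le_antisymm (hT ▸ latticeCone_mono (Finset.coe_subset.mpr (Finset.erase_subset w T)))
          (hT ▸ Submodule.span_le.mpr ?_)
        rintro _ ⟨u, hu, rfl⟩
        by_cases huw : u = w
        · rw [huw]
          exact hwT
        · exact toReal_mem_latticeCone (Finset.mem_coe.mpr (Finset.mem_erase.mpr ⟨huw, hu⟩))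
      exact Finset.notMem_erase w T (hTmin.le_of_le
        ⟨(Finset.erase_subset w T).trans hTmin.prop.1, h2⟩ (Finset.erase_subset w T) hw)
    · have h1 := hsc (c v • toReal v) (hsmul (hc v hv) (hmemτ v (Finset.mem_of_mem_erase hv))) (by
        have h2 : -(c v • toReal v) = ∑ u ∈ (T.erase w).erase v, c u • toReal u + (-t) • toReal w := by
          rw [← Finset.add_sum_erase _ _ hv] at hct
          rw [neg_smul, ← hct]
          abel
        rw [h2]
        exact add_mem (sum_mem fun u hu => hsmul (hc u (Finset.mem_of_mem_erase hu))
          (hmemτ u (Finset.mem_of_mem_erase (Finset.mem_of_mem_erase hu))))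
          (hsmul (neg_nonneg.mpr ht) (hmemτ w hw)))
      rcases smul_eq_zero.mp h1 with h2 | h2
      · exact hne h2
      · obtain ⟨-, b, k, hk⟩ := hray v (hTT₀ (Finset.mem_of_mem_erase hv))
        refine b.ne_zero k (hk.trans (toReal_injective (h2.trans ?_)))
        ext
        simp [toReal]
  have hm' : ∀ v ∈ (T : Set (Fin d → ℤ)), 0 ≤ intPairing m v := fun v hv => by
    by_cases hvw : v = w
    · rw [hvw, hmw]
    · exact (hm v (Finset.mem_erase.mpr ⟨hvw, hv⟩)).le
  have hface := isFace_latticeCone hm'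
  have h2 : {v ∈ (T : Set (Fin d → ℤ)) | intPairing m v = 0} = {w} := by
    ext v
    constructor
    · rintro ⟨hv, hv0⟩
      by_contra hvw
      have := hm v (Finset.mem_erase.mpr ⟨hvw, hv⟩)
      omega
    · rintro rfl
      exact ⟨hw, hmw⟩
  rw [h2, hT] at hface
  exact Δ.face_mem τ hτ _ hface

end Rays

end Stringy

namespace Stringy

/-! ### Toric divisors -/

section Divisor

variable {d : ℕ} {σ τ : PointedCone ℝ (Fin d → ℝ)} {v : Fin d → ℤ}

theorem intPairing_nonneg (hv : toReal v ∈ σ) (m : dualMonoid σ) : 0 ≤ intPairing m v := by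
  have := m.2 _ hv
  rw [pairing_toReal] at this
  exact_mod_cast this

/-- The endomorphism of the monoid algebra which kills the monomials positive on `v`. -/
noncomputable def killPositive (hv : toReal v ∈ σ) : ConeRing σ →ₐ[ℂ] ConeRing σ :=
  AddMonoidAlgebra.lift ℂ (ConeRing σ) (dualMonoid σ)
    { toFun := fun m => if 0 < intPairing m.toAdd v then 0 else chi m.toAdd
      map_one' := by
        have h1 : intPairing ((Multiplicative.toAdd (1 : Multiplicative (dualMonoid σ)) :
          dualMonoid σ) : Fin d → ℤ) v = 0 := by simp [intPairing]
        rw [h1, if_neg (lt_irrefl _)]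
        rfl
      map_mul' := fun m n => by
        have h1 : chi (m * n).toAdd = chi m.toAdd * chi n.toAdd := by
          rw [AddMonoidAlgebra.single_mul_single, one_mul]; rfl
        have h2 : intPairing ((m * n).toAdd : dualMonoid σ) v =
          intPairing m.toAdd v + intPairing n.toAdd v := pairing_toReal_right_add _ _ _
        have hm := intPairing_nonneg hv m.toAdd
        have hn := intPairing_nonneg hv n.toAdd
        rw [h1, h2]
        by_cases h : 0 < intPairing m.toAdd v
        · rw [if_pos h, if_pos (by omega), zero_mul]
        · by_cases h' : 0 < intPairing n.toAdd v
          · rw [if_pos h', if_pos (by omega), mul_zero]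
          · rw [if_neg h, if_neg h', if_neg (by omega)] }

theorem coeff_killPositive (hv : toReal v ∈ σ) (f : ConeRing σ) (m : dualMonoid σ) :
    (killPositive hv f).coeff m = if 0 < intPairing m v then 0 else f.coeff m := by
  classical
  induction f using AddMonoidAlgebra.induction_linear with
  | zero => simp
  | single n c =>
    have h1 : killPositive hv (AddMonoidAlgebra.single n c) =
        c • (if 0 < intPairing n v then (0 : ConeRing σ) else chi n) := by
      rw [killPositive, AddMonoidAlgebra.lift_single]
      rfl
    rw [h1]
    by_cases hn : 0 < intPairing n v
    · rw [if_pos hn, smul_zero]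
      split_ifs with h
      · simp
      · have : n ≠ m := fun h' => h (h' ▸ hn)
        simp [this]
    · rw [if_neg hn]
      split_ifs with h
      · have : n ≠ m := fun h' => hn (h' ▸ h)
        simp [this]
      · simp
  | add f g hf hg =>
    rw [map_add, AddMonoidAlgebra.coeff_add, Finsupp.add_apply, hf, hg]
    split_ifs <;> simp

/-- The generic point of the divisor (or the closed subset) of the chart `U_σ` attached to a
lattice vector of `σ`. -/
noncomputable def divPoint (hv : toReal v ∈ σ) : coneScheme σ :=
  ⟨RingHom.ker (killPositive hv), RingHom.ker_isPrime _⟩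

theorem mem_divPoint (hv : toReal v ∈ σ) {f : ConeRing σ} :
    f ∈ (divPoint hv).asIdeal ↔ ∀ m ∈ f.coeff.support, 0 < intPairing m v := by
  change killPositive hv f = 0 ↔ _
  constructor
  · intro h m hm
    by_contra hneg
    have := coeff_killPositive hv f m
    rw [h, if_neg hneg] at this
    exact Finsupp.mem_support_iff.mp hm (by rw [← this]; simp)
  · intro h
    ext m
    rw [coeff_killPositive]
    split_ifs with h'
    · simp
    · by_contra hne
      exact h' (h m (Finsupp.mem_support_iff.mpr fun h0 => hne (by rw [h0]; simp)))

theorem coeff_coneRingHom (h : τ ≤ σ) (f : ConeRing σ) (m : dualMonoid σ) :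
    (coneRingHom h f).coeff (AddSubmonoid.inclusion (dualMonoid_anti h) m) = f.coeff m :=
  Finsupp.mapDomain_apply (AddSubmonoid.inclusion_injective (dualMonoid_anti h)) f.coeff m

theorem mem_support_coneRingHom (h : τ ≤ σ) {f : ConeRing σ} {n : dualMonoid τ} :
    n ∈ (coneRingHom h f).coeff.support ↔
      ∃ m ∈ f.coeff.support, AddSubmonoid.inclusion (dualMonoid_anti h) m = n := by
  classical
  have : (coneRingHom h f).coeff.support =
      f.coeff.support.image (AddSubmonoid.inclusion (dualMonoid_anti h)) :=
    Finsupp.mapDomain_support_of_injective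
      (AddSubmonoid.inclusion_injective (dualMonoid_anti h)) f.coeff
  rw [this, Finset.mem_image]

theorem coneRingHom_mem_divPoint (h : τ ≤ σ) (hv : toReal v ∈ τ) {f : ConeRing σ} :
    coneRingHom h f ∈ (divPoint hv).asIdeal ↔ f ∈ (divPoint (h hv)).asIdeal := by
  rw [mem_divPoint, mem_divPoint]
  constructor
  · exact fun H m hm => H _ ((mem_support_coneRingHom h).mpr ⟨m, hm, rfl⟩)
  · intro H n hn
    obtain ⟨m, hm, rfl⟩ := (mem_support_coneRingHom h).mp hn
    exact H m hm

theorem coneMap_divPoint (h : τ ≤ σ) (hv : toReal v ∈ τ) :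
    coneMap h (divPoint hv) = divPoint (h hv) :=
  PrimeSpectrum.ext (Ideal.ext fun _ => coneRingHom_mem_divPoint h hv)

/-- An element of a monoid algebra whose exponents lie in a smaller monoid. -/
theorem exists_coneRingHom_eq (h : τ ≤ σ) {f : ConeRing τ}
    (hf : ∀ m ∈ f.coeff.support, (m : Fin d → ℤ) ∈ dualMonoid σ) : ∃ g, coneRingHom h g = f := by
  change f ∈ (coneRingHom h).range
  rw [← AddMonoidAlgebra.sum_coeff_single f]
  refine sum_mem fun m hm => ⟨AddMonoidAlgebra.single ⟨m, hf m hm⟩ (f.coeff m), ?_⟩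
  rw [coneRingHom_single]
  rfl

variable (b : Module.Basis (Fin d) ℤ (Fin d → ℤ)) {s : Set (Fin d)} {k : Fin d}

/-- A character with positive `k`-th coordinate stays in the dual monoid after subtracting the
`k`-th dual vector, so its monomial is divisible by the `k`-th coordinate. -/
theorem divPoint_asIdeal (hk : k ∈ s) :
    (divPoint (toReal_mem_latticeCone (Set.mem_image_of_mem b hk))).asIdeal =
      Ideal.span {chi (coordVec b s k)} := by
  refine le_antisymm (fun f hf => ?_) ((Ideal.span_singleton_le_iff_mem _).mpr ?_)
  · rw [mem_divPoint] at hf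
    refine sum_mem_of_chi fun m hm => ?_
    have hmem : (m : Fin d → ℤ) - dualBasis b k ∈ dualMonoid (latticeCone (b '' s)) := by
      refine (mem_dualMonoid_iff b s _).mpr fun j hj => ?_
      rw [map_sub, Pi.sub_apply, dualCoords_apply b (dualBasis b k), intPairing_dualBasis,
        Pi.single_apply]
      split_ifs with h
      · subst h
        have := hf m hm
        rw [← dualCoords_apply] at this
        omega
      · rw [sub_zero]
        exact (mem_dualMonoid_iff b s _).mp m.2 j hj
    have : chi m = chi (coordVec b s k) * chi ⟨_, hmem⟩ := by
      rw [AddMonoidAlgebra.single_mul_single, one_mul]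
      congr 1
      exact Subtype.ext (add_sub_cancel _ _).symm
    rw [this]
    exact Ideal.mul_mem_right _ _ (Ideal.mem_span_singleton_self _)
  · refine (mem_divPoint _).mpr fun m hm => ?_
    have : m = coordVec b s k := by
      by_contra hne
      exact Finsupp.mem_support_iff.mp hm (by
        simp [Ne.symm hne])
    rw [this, coordVec, intPairing_dualBasis, Pi.single_eq_same]
    exact one_pos

/-- A prime containing no coordinate contains no character. -/
theorem chi_not_mem {p : Ideal (ConeRing (latticeCone (b '' s)))} [p.IsPrime]
    (hp : ∀ k ∈ s, chi (coordVec b s k) ∉ p) (m : dualMonoid (latticeCone (b '' s))) :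
    chi m ∉ p := by
  have hx : ∀ k, chi (coordVec b s k) ∉ p := fun k => by
    by_cases hk : k ∈ s
    · exact hp k hk
    · refine fun h => Ideal.IsPrime.ne_top ‹_› (Ideal.eq_top_of_isUnit_mem _ h (isUnit_chi _ ?_))
      refine (mem_dualMonoid_iff b s _).mpr fun j hj => ?_
      have hjk : j ≠ k := fun h => hk (h ▸ hj)
      rw [map_neg, Pi.neg_apply, coordVec, dualCoords_apply, intPairing_dualBasis,
        Pi.single_eq_of_ne hjk, neg_zero]
  have hmon : ∀ e : Fin d →₀ ℕ, chi (monomialHom b s e) ∉ p := fun e h => by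
    change AddMonoidAlgebra.single (monomialHom b s e) (1 : ℂ) ∈ p at h
    rw [← coordHom_monomial, MvPolynomial.monomial_eq, map_one, one_mul, Finsupp.prod, map_prod] at h
    obtain ⟨j, -, hj⟩ := (Ideal.IsPrime.prod_mem_iff (p := p)).mp h
    rw [map_pow, coordHom_X] at hj
    exact hx j (Ideal.IsPrime.mem_of_pow_mem ‹_› _ hj)
  -- Adding the absolute values of the coordinates makes the character effective, so `χᵐ ∈ p` would
  -- put a product of coordinates into `p`.
  let e : Fin d →₀ ℕ := Finsupp.equivFunOnFinite.symm fun j =>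
    (dualCoords b (m : Fin d → ℤ) j).natAbs
  let e' : Fin d →₀ ℕ := Finsupp.equivFunOnFinite.symm fun j =>
    (dualCoords b (m : Fin d → ℤ) j + (dualCoords b (m : Fin d → ℤ) j).natAbs).toNat
  have he : m + monomialHom b s e = monomialHom b s e' := by
    refine Subtype.ext ((dualCoords b).injective (funext fun j => ?_))
    rw [AddSubmonoid.coe_add, map_add, Pi.add_apply, dualCoords_monomialHom, dualCoords_monomialHom]
    change _ + (((dualCoords b (m : Fin d → ℤ) j).natAbs : ℕ) : ℤ) =
      ((dualCoords b (m : Fin d → ℤ) j + (dualCoords b (m : Fin d → ℤ) j).natAbs).toNat : ℤ)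
    omega
  intro h
  refine hmon e' ?_
  rw [← he]
  have h2 : chi (m + monomialHom b s e) = chi m * chi (monomialHom b s e) := by
    rw [AddMonoidAlgebra.single_mul_single, one_mul]
  rw [h2]
  exact Ideal.mul_mem_right _ _ h

/-- The monoid algebra of a regular cone is a unique factorization domain. -/
theorem uniqueFactorizationMonoid_coneRing (s : Set (Fin d)) :
    UniqueFactorizationMonoid (ConeRing (latticeCone (b '' s))) := by
  let := (coordHom b s).toRingHom.toAlgebra
  have : IsLocalization ((IsUnit.submonoid (ConeRing (latticeCone (b '' s)))).comap (coordHom b s))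
      (ConeRing (latticeCone (b '' s))) := by
    refine ⟨fun x => x.2, fun f => ?_, fun {x y} hxy => ⟨1, ?_⟩⟩
    · obtain ⟨q, a, hq, ha⟩ := exists_coordHom_mul_eq b s f
      exact ⟨(a, ⟨q, hq⟩), (mul_comm _ _).trans ha⟩
    · rw [coordHom_injective b s hxy]
  exact UniqueFactorizationMonoid.of_isLocalization
    ((IsUnit.submonoid (ConeRing (latticeCone (b '' s)))).comap (coordHom b s)) _

theorem latticeCone_empty : latticeCone (∅ : Set (Fin d → ℤ)) = ⊥ := by
  rw [latticeCone, Set.image_empty, Submodule.span_empty]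

instance uniqueFactorizationMonoid_torus :
    UniqueFactorizationMonoid (ConeRing (⊥ : PointedCone ℝ (Fin d → ℝ))) := by
  have h := uniqueFactorizationMonoid_coneRing (Pi.basisFun ℤ (Fin d)) ∅
  have h2 : latticeCone ((Pi.basisFun ℤ (Fin d)) '' (∅ : Set (Fin d))) = ⊥ := by
    rw [Set.image_empty, latticeCone_empty]
  rwa [h2] at h

theorem mem_dualMonoid_bot (m : Fin d → ℤ) : m ∈ dualMonoid (⊥ : PointedCone ℝ (Fin d → ℝ)) := by
  intro x hx
  rw [Submodule.mem_bot] at hx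
  simp [hx, pairing]

end Divisor

end Stringy

namespace Stringy

/-! ### Orders along toric divisors -/

/-- Krull's principal ideal theorem; in a domain a nonzero prime has positive height. -/
theorem coheight_eq_one {Y : Scheme.{0}} {R : CommRingCat.{0}} [IsDomain R] [IsNoetherianRing R]
    (c : Spec R ⟶ Y) [IsOpenImmersion c] {p : Spec R} {x : R} (hp : p.asIdeal = Ideal.span {x})
    (hx : x ≠ 0) : Order.coheight (c p) = 1 := by
  rw [coheight_eq_of_isOpenImmersion, ← idealHeight_eq_coheight R p]
  refine le_antisymm ?_ (Order.one_le_iff_pos.mpr (pos_iff_ne_zero.mpr fun h => ?_))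
  · refine Ideal.height_le_one_of_isPrincipal_of_mem_minimalPrimes (Ideal.span {x}) _ ?_
    rw [← hp, Ideal.minimalPrimes_eq_subsingleton_self]
    rfl
  · rw [Ideal.height_eq_zero_iff_eq_bot, hp, Ideal.span_singleton_eq_bot] at h
    exact hx h

section Atlas

variable {d : ℕ} {Δ : Fan d} {Y : CVariety} (A : ToricAtlas Δ Y)

instance isOpenImmersion_chart (σ : PointedCone ℝ (Fin d → ℝ)) (hσ : σ ∈ Δ.cones) :
    IsOpenImmersion (A.chart σ hσ) := A.isOpenImmersion σ hσ

-- The chart is open in a locally noetherian scheme, so finite generation of the dual monoid need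
-- not be proved.
include A in
theorem isNoetherianRing_coneRing {σ : PointedCone ℝ (Fin d → ℝ)} (hσ : σ ∈ Δ.cones) :
    IsNoetherianRing (CommRingCat.of (ConeRing σ)) := by
  have : IsLocallyNoetherian (coneScheme σ) := isLocallyNoetherian_of_isOpenImmersion (A.chart σ hσ)
  exact isLocallyNoetherian_Spec.mp this

variable [AlgebraicGeometry.IsIntegral Y.X]

/-- The characters of the torus as rational functions. -/
noncomputable def torusChar : Multiplicative (Fin d → ℤ) →* Y.X.functionField where
  toFun m := chartRat (A.chart ⊥ Δ.bot_mem) (chi ⟨m.toAdd, mem_dualMonoid_bot _⟩)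
  map_one' := map_one (chartRat (A.chart ⊥ Δ.bot_mem))
  map_mul' m n := by
    rw [← map_mul]
    congr 1
    change _ = AddMonoidAlgebra.single _ _ * AddMonoidAlgebra.single _ _
    rw [AddMonoidAlgebra.single_mul_single, one_mul]
    rfl

theorem chartRat_coneRingHom {σ τ : PointedCone ℝ (Fin d → ℝ)} (hσ : σ ∈ Δ.cones)
    (hτ : τ ∈ Δ.cones) (h : τ ≤ σ) (f : ConeRing σ) :
    chartRat (A.chart τ hτ) (coneRingHom h f) = chartRat (A.chart σ hσ) f :=
  chartRat_comp (A.chart σ hσ) (A.chart τ hτ) (CommRingCat.ofHom (coneRingHom h))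
    (A.coneMap_chart σ hσ τ hτ h) f

theorem isCharOn_torusChar {σ : PointedCone ℝ (Fin d → ℝ)} (hσ : σ ∈ Δ.cones) :
    IsCharOn (torusChar A) (A.chart σ hσ) := fun m => by
  rw [← chartRat_coneRingHom A hσ Δ.bot_mem bot_le, coneRingHom_single]
  rfl

theorem ord_chartRat_nonneg {σ : PointedCone ℝ (Fin d → ℝ)} (hσ : σ ∈ Δ.cones)
    {p : coneScheme σ} {f : ConeRing σ} (hf : f ≠ 0) :
    0 ≤ Scheme.ord (chartRat (A.chart σ hσ) f) (A.chart σ hσ p) := by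
  by_cases hp : Order.coheight (A.chart σ hσ p) = 1
  · by_cases h : f ∈ p.asIdeal
    · exact (ord_chartRat_pos _ hp h hf).le
    · exact (ord_chartRat_of_not_mem (A.chart σ hσ) h).ge
  · rw [Scheme.ord_eq_zero_of_coheight_neq_one hp]

/-- A rational top form is a function times the logarithmic form; its order on a chart is determined
by the order of the function and the orders of the coordinates. -/
theorem exists_formOrder_eq (ω : TopForms Y) (hω : ω ≠ 0) :
    ∃ g : Y.X.functionField, g ≠ 0 ∧ ∀ (σ : PointedCone ℝ (Fin d → ℝ)) (hσ : σ ∈ Δ.cones)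
      (b : Module.Basis (Fin d) ℤ (Fin d → ℤ)) (s : Set (Fin d)), σ = latticeCone (b '' s) →
      ∀ (p : coneScheme σ) (m : ℤ), HasFormOrder Y (A.chart σ hσ p) ω m →
        m = Scheme.ord g (A.chart σ hσ p) -
          ∑ j, Scheme.ord (torusChar A (Multiplicative.ofAdd (dualBasis b j))) (A.chart σ hσ p) := by
  have h0 : (⊥ : PointedCone ℝ (Fin d → ℝ)) = latticeCone (Pi.basisFun ℤ (Fin d) '' ∅) := by
    rw [Set.image_empty, latticeCone_empty]
  have key : ∀ σ (hσ : σ ∈ Δ.cones) (b : Module.Basis (Fin d) ℤ (Fin d → ℤ)) (s : Set (Fin d)),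
      σ = latticeCone (b '' s) →
      letI := (MvPolynomial.aeval (R := ℂ) fun j =>
        torusChar A (Multiplicative.ofAdd (dualBasis b j))).toRingHom.toAlgebra
      IsFractionRing (MvPolynomial (Fin d) ℂ) Y.X.functionField := by
    rintro σ hσ b s rfl
    exact isFractionRing_coord b s _ (A.chart_str _ hσ) (isCharOn_torusChar A hσ)
  have hfin : Module.finrank Y.X.functionField Ω[Y.X.functionField⁄ℂ] = d :=
    finrank_kaehlerDifferential _ (key ⊥ Δ.bot_mem (Pi.basisFun ℤ (Fin d)) ∅ h0)
  -- The degree in `TopForms` is a `finrank`, only propositionally equal to `d`; generalizing it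
  -- first allows the replacement.
  suffices H : ∀ n, n = d → ∀ ω : ⋀[Y.X.functionField]^n Ω[Y.X.functionField⁄ℂ], ω ≠ 0 →
      ∃ g : Y.X.functionField, g ≠ 0 ∧ ∀ (σ : PointedCone ℝ (Fin d → ℝ)) (hσ : σ ∈ Δ.cones)
      (b : Module.Basis (Fin d) ℤ (Fin d → ℤ)) (s : Set (Fin d)), σ = latticeCone (b '' s) →
      ∀ (p : coneScheme σ) (m : ℤ), (∃ (θ : ⋀[Y.X.presheaf.stalk (A.chart σ hσ p)]^n
        Ω[Y.X.presheaf.stalk (A.chart σ hσ p)⁄ℂ]) (t : Y.X.functionField),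
        Submodule.span (Y.X.presheaf.stalk (A.chart σ hσ p)) {θ} = ⊤ ∧ t ≠ 0 ∧
        ω = t • formMap (Y.X.presheaf.stalk (A.chart σ hσ p)) Y.X.functionField _ θ ∧
        Scheme.ord t (A.chart σ hσ p) = m) →
        m = Scheme.ord g (A.chart σ hσ p) -
          ∑ j, Scheme.ord (torusChar A (Multiplicative.ofAdd (dualBasis b j))) (A.chart σ hσ p) from
    H _ hfin ω hω
  rintro n rfl ω hω
  have hex : ∀ σ (hσ : σ ∈ Δ.cones) (b : Module.Basis (Fin n) ℤ (Fin n → ℤ)) (s : Set (Fin n)),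
      σ = latticeCone (b '' s) →
      ∃ g : Y.X.functionField, ω = g • dlogForm (torusChar A) (dualBasis b) := by
    rintro σ hσ b s rfl
    exact exists_smul_dlogForm b s _ (A.chart_str _ hσ) (isCharOn_torusChar A hσ) ω
  -- The coefficient is taken with respect to the standard basis on the torus; the same `g` works on
  -- every chart since logarithmic forms of different bases agree up to sign.
  obtain ⟨g, hg⟩ := hex ⊥ Δ.bot_mem (Pi.basisFun ℤ (Fin n)) ∅ h0
  refine ⟨g, ?_, ?_⟩
  · rintro rfl
    exact hω (by rw [hg, zero_smul])
  · rintro σ hσ b s rfl p m ⟨θ, t, hθ, -, ht, rfl⟩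
    exact ord_eq_of_dlogForm b s _ (A.chart_str _ hσ) (isCharOn_torusChar A hσ) p hω hg hθ ht

theorem ord_torusChar_torus (p : coneScheme (⊥ : PointedCone ℝ (Fin d → ℝ))) (m : Fin d → ℤ) :
    Scheme.ord (torusChar A (Multiplicative.ofAdd m)) (A.chart ⊥ Δ.bot_mem p) = 0 :=
  ord_chartRat_of_not_mem (A.chart ⊥ Δ.bot_mem) fun h =>
    (PrimeSpectrum.isPrime p).ne_top (Ideal.eq_top_of_isUnit_mem _ h
      (isUnit_chi _ (mem_dualMonoid_bot _)))

theorem toReal_mem_ray (v : Fin d → ℤ) : toReal v ∈ latticeCone {v} :=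
  toReal_mem_latticeCone (Set.mem_singleton v)

omit [AlgebraicGeometry.IsIntegral Y.X] in
theorem coheight_rayPoint {σ : PointedCone ℝ (Fin d → ℝ)} (hσ : σ ∈ Δ.cones)
    (b : Module.Basis (Fin d) ℤ (Fin d → ℤ)) {k : Fin d} (hb : σ = latticeCone (b '' {k}))
    (hv : toReal (b k) ∈ σ) : Order.coheight (A.chart σ hσ (divPoint hv)) = 1 := by
  subst hb
  have := isNoetherianRing_coneRing A hσ
  refine coheight_eq_one (A.chart _ hσ) (divPoint_asIdeal b (Set.mem_singleton k)) ?_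
  exact fun h => one_ne_zero (AddMonoidAlgebra.single_eq_zero.mp h)

/-- Along the divisor of a ray one coordinate is a uniformizer and the others are units. The
logarithmic form therefore has a simple pole there, which is the origin of the `+1` added to the
discrepancies. -/
theorem sum_ord_torusChar_rayPoint {σ : PointedCone ℝ (Fin d → ℝ)} (hσ : σ ∈ Δ.cones)
    (b : Module.Basis (Fin d) ℤ (Fin d → ℤ)) {k : Fin d} (hb : σ = latticeCone (b '' {k}))
    (hv : toReal (b k) ∈ σ) :
    ∑ j, Scheme.ord (torusChar A (Multiplicative.ofAdd (dualBasis b j)))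
      (A.chart σ hσ (divPoint hv)) = 1 := by
  have h1 := coheight_rayPoint A hσ b hb hv
  subst hb
  have h2 := divPoint_asIdeal b (Set.mem_singleton k)
  have h3 : ∀ j, torusChar A (Multiplicative.ofAdd (dualBasis b j)) =
      chartRat (A.chart _ hσ) (chi (coordVec b {k} j)) := fun j =>
    (isCharOn_torusChar A hσ (coordVec b {k} j)).symm
  rw [Finset.sum_eq_single k]
  · rw [h3]
    exact ord_chartRat_eq_one (A.chart _ hσ) h1
      (fun h => one_ne_zero (AddMonoidAlgebra.single_eq_zero.mp h)) h2
  · intro j _ hjk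
    rw [h3]
    refine ord_chartRat_of_not_mem (A.chart _ hσ) fun h => ?_
    have h4 := (mem_divPoint hv).mp h (coordVec b {k} j) (by simp)
    rw [coordVec, intPairing_dualBasis, Pi.single_eq_of_ne hjk.symm] at h4
    exact lt_irrefl _ h4
  · exact fun h => (h (Finset.mem_univ k)).elim

/-- The order of a Laurent polynomial along a toric divisor is positive only if all its exponents
are positive. -/
theorem intPairing_pos_of_ord_pos {v : Fin d → ℤ} (hσ : latticeCone {v} ∈ Δ.cones)
    {P : ConeRing (⊥ : PointedCone ℝ (Fin d → ℝ))}
    (hP : 0 < Scheme.ord (chartRat (A.chart ⊥ Δ.bot_mem) P)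
      (A.chart _ hσ (divPoint (toReal_mem_ray v)))) :
    ∀ m ∈ P.coeff.support, 0 < intPairing m v := by
  have hmem : ∀ m : Fin d → ℤ, m ∈ dualMonoid (latticeCone {v}) ↔ 0 ≤ intPairing m v := fun m =>
    pairing_nonneg_on_latticeCone.trans (by simp)
  have hneg : ∀ m : Fin d → ℤ, intPairing (-m) v = - intPairing m v := fun m => by
    simp [intPairing]
  by_contra! hcon
  obtain ⟨m₁, hm₁, hm₁v⟩ := hcon
  -- Dividing by the monomial whose exponent is least on `v` gives a function regular along the
  -- divisor with nonzero constant term, so of order zero. If that least value were `≤ 0`, then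
  -- `χ^{-m₀}` would be regular and `P` would have order `≤ 0`.
  obtain ⟨m₀, hm₀, hmin⟩ := Finset.exists_min_image P.coeff.support
    (fun m => intPairing (m : Fin d → ℤ) v) ⟨m₁, hm₁⟩
  have hm₀v : intPairing (m₀ : Fin d → ℤ) v ≤ 0 := (hmin m₁ hm₁).trans hm₁v
  let n₀ : dualMonoid (⊥ : PointedCone ℝ (Fin d → ℝ)) := ⟨-m₀, mem_dualMonoid_bot _⟩
  have hn₀ : ∀ m : dualMonoid (⊥ : PointedCone ℝ (Fin d → ℝ)), (chi n₀ * P).coeff m =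
      P.coeff (m₀ + m) := fun m => by
    have : m = n₀ + (m₀ + m) := Subtype.ext (by
      rw [AddSubmonoid.coe_add, AddSubmonoid.coe_add]
      exact (neg_add_cancel_left _ _).symm)
    conv_lhs => rw [this]
    rw [AddMonoidAlgebra.coeff_single_mul_add, one_mul]
  obtain ⟨g, hg⟩ := exists_coneRingHom_eq (bot_le : ⊥ ≤ latticeCone {v}) (f := chi n₀ * P)
    fun m hm => by
      rw [Finsupp.mem_support_iff, hn₀, ← Finsupp.mem_support_iff] at hm
      have h1 := hmin _ hm
      rw [AddSubmonoid.coe_add, pairing_toReal_right_add] at h1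
      exact (hmem _).mpr (by omega)
  have hg0 : g ∉ (divPoint (toReal_mem_ray v)).asIdeal := fun h => by
    rw [mem_divPoint] at h
    have h1 : (0 : dualMonoid (latticeCone {v})) ∈ g.coeff.support := by
      rw [Finsupp.mem_support_iff, ← coeff_coneRingHom bot_le, hg, map_zero, hn₀, add_zero]
      exact Finsupp.mem_support_iff.mp hm₀
    have := h 0 h1
    simp [intPairing] at this
  have h1 := ord_chartRat_of_not_mem (A.chart _ hσ) hg0
  have hP0 : P ≠ 0 := by
    rintro rfl
    simp at hm₁
  have hchi : (chi n₀ : ConeRing (⊥ : PointedCone ℝ (Fin d → ℝ))) ≠ 0 :=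
    fun h => one_ne_zero (AddMonoidAlgebra.single_eq_zero.mp h)
  have hinj := chartRat_injective (A.chart ⊥ Δ.bot_mem)
  have h0 : ∀ {f : ConeRing (⊥ : PointedCone ℝ (Fin d → ℝ))}, f ≠ 0 →
      chartRat (A.chart ⊥ Δ.bot_mem) f ≠ 0 := fun hf h => hf (hinj (h.trans (map_zero _).symm))
  rw [← chartRat_coneRingHom A hσ Δ.bot_mem bot_le, hg] at h1
  have h2 : chartRat (A.chart ⊥ Δ.bot_mem) (chi n₀ * P) =
      chartRat (A.chart ⊥ Δ.bot_mem) (chi n₀) * chartRat (A.chart ⊥ Δ.bot_mem) P :=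
    map_mul (chartRat (A.chart ⊥ Δ.bot_mem)) _ _
  rw [h2, Scheme.ord_mul (h0 hchi) (h0 hP0)] at h1
  have h3 := ord_chartRat_nonneg A hσ (p := divPoint (toReal_mem_ray v))
    (f := chi ⟨-m₀, (hmem _).mpr (by rw [hneg]; omega)⟩)
    (fun h => one_ne_zero (AddMonoidAlgebra.single_eq_zero.mp h))
  rw [← chartRat_coneRingHom A hσ Δ.bot_mem bot_le, coneRingHom_single] at h3
  change 0 ≤ Scheme.ord (chartRat (A.chart ⊥ Δ.bot_mem) (chi n₀)) _ at h3
  omega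

end Atlas

end Stringy

namespace Stringy

/-! ### Log terminality of `ℚ`-Gorenstein toric varieties -/

/-- Clearing denominators: if no prime factor of the denominator of `h` lies over a prime contained
in `q`, then the denominator divides an element outside `q`. -/
theorem exists_mul_eq_of_forall_prime {R L K : Type*} [CommRing R] [CommRing L] [IsDomain L]
    [UniqueFactorizationMonoid L] [Field K] (κ : L →+* K) (hκ : Function.Injective κ)
    (ι : R →+* L) (q : Ideal R) [q.IsPrime] {h : K} (hex : ∃ P Q, Q ≠ 0 ∧ h = κ P / κ Q)
    (hh : ∀ π : L, Prime π → (∀ r, π ∣ ι r → r ∈ q) → ∀ P Q, Q ≠ 0 → h = κ P / κ Q → π ∣ Q → π ∣ P) :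
    ∃ G ∉ q, ∃ P, h * κ (ι G) = κ P := by
  have h0 : ∀ {f : L}, f ≠ 0 → κ f ≠ 0 := fun hf => (map_ne_zero_iff κ hκ).mpr hf
  obtain ⟨P, Q, hQ, rfl⟩ := hex
  obtain ⟨Q', P', c, hrel, rfl, rfl⟩ := UniqueFactorizationMonoid.exists_reduced_factors Q hQ P
  have hc : c ≠ 0 := left_ne_zero_of_mul hQ
  have hQ' : Q' ≠ 0 := right_ne_zero_of_mul hQ
  have hPQ : κ (c * P') / κ (c * Q') = κ P' / κ Q' := by
    rw [map_mul, map_mul, mul_div_mul_left _ _ (h0 hc)]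
  rw [hPQ] at hh ⊢
  have key : ∀ D : L, D ∣ Q' → ∃ G ∉ q, D ∣ ι G := fun D => by
    induction D using UniqueFactorizationMonoid.induction_on_prime with
    | h₁ => exact fun hD => (hQ' (zero_dvd_iff.mp hD)).elim
    | h₂ x hx => exact fun _ => ⟨1, (Ideal.ne_top_iff_one q).mp (Ideal.IsPrime.ne_top ‹_›), hx.dvd⟩
    | h₃ a π ha hπ ih =>
      intro hD
      obtain ⟨G, hG, haG⟩ := ih ((dvd_mul_left a π).trans hD)
      by_cases hπq : ∀ r, π ∣ ι r → r ∈ q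
      · have hπQ : π ∣ Q' := (dvd_mul_right π a).trans hD
        exact (hπ.not_isUnit (hrel hπQ (hh π hπ hπq P' Q' hQ' rfl hπQ))).elim
      · push Not at hπq
        obtain ⟨r, hr, hrq⟩ := hπq
        refine ⟨r * G, fun hmem => ?_, ?_⟩
        · rcases Ideal.IsPrime.mem_or_mem ‹_› hmem with h | h
          · exact hrq h
          · exact hG h
        · rw [map_mul]
          exact mul_dvd_mul hr haG
  obtain ⟨G, hG, D, hD⟩ := key Q' dvd_rfl
  refine ⟨G, hG, P' * D, ?_⟩
  rw [hD, map_mul, map_mul, ← mul_assoc, div_mul_cancel₀ _ (h0 hQ')]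

section

variable {d : ℕ} {Δ Δ' : Fan d} {X X' : CVariety} (A : ToricAtlas Δ X) (A' : ToricAtlas Δ' X')
  {ρ : X'.X ⟶ X.X}

include A A' in
theorem IsToricMorphism.apply_chart (hρ : IsToricMorphism A' A ρ)
    {σ' σ : PointedCone ℝ (Fin d → ℝ)} (hσ' : σ' ∈ Δ'.cones) (hσ : σ ∈ Δ.cones) (h : σ' ≤ σ)
    (p : coneScheme σ') : ρ (A'.chart σ' hσ' p) = A.chart σ hσ (coneMap h p) :=
  congrArg (fun f : coneScheme σ' ⟶ X.X => f p) (hρ σ' hσ' σ hσ h)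

/-- The exceptional primes of a regular toric resolution are toric divisors. -/
theorem exists_eq_rayPoint (hreg : ∀ σ' ∈ Δ'.cones,
      ∃ (b : Module.Basis (Fin d) ℤ (Fin d → ℤ)) (s : Set (Fin d)), σ' = latticeCone (b '' s))
    {y : X'.X} (hy : Order.coheight y = 1) (hy0 : y ∉ Set.range (A'.chart ⊥ Δ'.bot_mem)) :
    ∃ (b : Module.Basis (Fin d) ℤ (Fin d → ℤ)) (k : Fin d) (h : latticeCone {b k} ∈ Δ'.cones),
      A'.chart _ h (divPoint (toReal_mem_ray (b k))) = y := by
  obtain ⟨σ, hσ, p, rfl⟩ := A'.cover y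
  obtain ⟨b, s, rfl⟩ := hreg σ hσ
  rw [coheight_eq_of_isOpenImmersion] at hy
  have hp : p.asIdeal.IsPrime := PrimeSpectrum.isPrime p
  -- Outside the torus some coordinate with index in `s` vanishes at `p`. It generates a nonzero
  -- prime contained in `p`, which is all of `p` since `p` has height one.
  obtain ⟨k, hk, hkp⟩ : ∃ k ∈ s, chi (coordVec b s k) ∈ p.asIdeal := by
    by_contra! hcon
    obtain ⟨m, hm, hface⟩ := isFace_bot (Set.toFinite (b '' s)) (Δ'.strongly_convex _ hσ)
    have h1 : p ∈ Set.range (coneMap (bot_le : ⊥ ≤ latticeCone (b '' s))) := by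
      rw [range_coneMap (Set.toFinite _) ⟨m, hm⟩ hface bot_le]
      exact chi_not_mem b hcon ⟨m, hm⟩
    obtain ⟨q, rfl⟩ := h1
    refine hy0 ⟨q, ?_⟩
    rw [← A'.coneMap_chart _ hσ _ Δ'.bot_mem bot_le]
    rfl
  have hkσ := toReal_mem_latticeCone (Set.mem_image_of_mem b hk)
  have hpdiv : divPoint hkσ = p := by
    refine PrimeSpectrum.ext (eq_of_le_of_coheight_eq_one hy _ (PrimeSpectrum.isPrime _) ?_ ?_)
    · rw [divPoint_asIdeal b hk]
      exact (Ideal.span_singleton_le_iff_mem _).mpr hkp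
    · rw [divPoint_asIdeal b hk]
      exact fun h => one_ne_zero (AddMonoidAlgebra.single_eq_zero.mp
        (Ideal.span_singleton_eq_bot.mp h))
  have hface := isFace_singleton b hk
  have hle : latticeCone {b k} ≤ latticeCone (b '' s) :=
    latticeCone_mono (Set.singleton_subset_iff.mpr (Set.mem_image_of_mem b hk))
  refine ⟨b, k, Δ'.face_mem _ hσ _ hface, ?_⟩
  rw [← hpdiv, ← coneMap_divPoint hle (toReal_mem_ray (b k)),
    ← A'.coneMap_chart _ hσ _ (Δ'.face_mem _ hσ _ hface) hle]
  rfl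

/-- On a chart common to both fans `ρ` is the identity, so codimension does not change. -/
theorem not_isExceptionalPrime_of_mem_cones (hρ : IsToricMorphism A' A ρ)
    {σ : PointedCone ℝ (Fin d → ℝ)} (hσ' : σ ∈ Δ'.cones) (hσ : σ ∈ Δ.cones) (p : coneScheme σ) :
    ¬ IsExceptionalPrime ρ (A'.chart σ hσ' p) := by
  rintro ⟨h1, h2⟩
  have h : coneMap (le_refl σ) = 𝟙 _ := by
    refine (congrArg Spec.map (CommRingCat.hom_ext ?_)).trans (Spec.map_id _)
    exact AddMonoidAlgebra.ringHom_ext (fun r => coneRingHom_single le_rfl _ _)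
      fun m => coneRingHom_single le_rfl _ _
  rw [hρ.apply_chart A A' hσ' hσ le_rfl, h, coheight_eq_of_isOpenImmersion (A.chart σ hσ)] at h2
  rw [coheight_eq_of_isOpenImmersion (A'.chart σ hσ')] at h1
  change 2 ≤ Order.coheight p at h2
  rw [h1] at h2
  exact absurd h2 (by decide)

/-- The discrepancies of a toric resolution are greater than `-1`. -/
theorem discrepancy_pos (hΔ : Δ'.IsRegularSubdivision Δ) (hρ : IsToricMorphism A' A ρ)
    (I : Finset X'.X) (hI : ∀ y, y ∈ I ↔ IsExceptionalPrime ρ y)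
    (disc : X'.X → ℚ) (hdisc : IsRelativeCanonical ρ I disc) {y : X'.X} (hy : y ∈ I) :
    0 < disc y + 1 := by
  classical
  obtain ⟨hint, r, ω, hr, hω, hdiv⟩ := hdisc
  obtain ⟨g, hg0, hg⟩ := exists_formOrder_eq A' ω hω
  have hyI := hy
  obtain ⟨b, k, hk, rfl⟩ := exists_eq_rayPoint A' hΔ.regular ((hI y).mp hy).1
    (not_mem_torus_of_isExceptionalPrime A A' hρ ((hI y).mp hy))
  obtain ⟨τ, hτ, hkτ⟩ := hΔ.le _ hk
  have hvτ : toReal (b k) ∈ τ := hkτ (toReal_mem_ray (b k))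
  have hray : ∀ {w : Fin d → ℤ} (hw : latticeCone {w} ∈ Δ'.cones) (hle : latticeCone {w} ≤ τ),
      ρ (A'.chart _ hw (divPoint (toReal_mem_ray w))) =
        A.chart τ hτ (divPoint (hle (toReal_mem_ray w))) := fun hw hle => by
    rw [hρ.apply_chart A A' hw hτ hle, coneMap_divPoint hle]
  obtain ⟨f, hf0, hf⟩ := hdiv (ρ (A'.chart _ hk (divPoint (toReal_mem_ray (b k)))))
  rw [hray hk hkτ] at hf
  have hgr : g ^ r ≠ 0 := pow_ne_zero r hg0
  have hord : ∀ y, Scheme.ord (g ^ r / f) y = r * Scheme.ord g y - Scheme.ord f y := fun y => by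
    rw [ord_div hgr hf0, ord_pow hg0]
  have hh0 : g ^ r / f ≠ 0 := div_ne_zero hgr hf0
  -- `h` compares `ω^r`, written in terms of the logarithmic form, with a local equation `f` of `r
  -- K_X`. The relation defining `f` is available only at codimension-one points whose image
  -- specializes to the chosen point of `X`.
  set h := g ^ r / f with hdef
  -- The order of `ω` along a ray divisor is `ord g - 1`, so `h` has order `r(a + 1)`, where the
  -- discrepancy `a` is read as `0` on non-exceptional divisors.
  have hordray : ∀ (b' : Module.Basis (Fin d) ℤ (Fin d → ℤ)) (j : Fin d)
      (hj : latticeCone {b' j} ∈ Δ'.cones),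
      ρ (A'.chart _ hj (divPoint (toReal_mem_ray (b' j)))) ⤳
        A.chart τ hτ (divPoint hvτ) →
      (Scheme.ord h (A'.chart _ hj (divPoint (toReal_mem_ray (b' j)))) : ℚ) = r * ((if
        A'.chart _ hj (divPoint (toReal_mem_ray (b' j))) ∈ I then
          disc (A'.chart _ hj (divPoint (toReal_mem_ray (b' j)))) else 0) + 1) := by
    intro b' j hj hsp
    have hb' : latticeCone {b' j} = latticeCone (b' '' {j}) := by rw [Set.image_singleton]
    obtain ⟨m, hm, hmf⟩ := hf _ (coheight_rayPoint A' hj b' hb' (toReal_mem_ray (b' j))) hsp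
    have h1 := hg _ hj b' {j} hb' _ m hm
    rw [sum_ord_torusChar_rayPoint A' hj b' hb' (toReal_mem_ray (b' j))] at h1
    rw [hord]
    push_cast
    rw [h1] at hmf
    push_cast at hmf
    linarith
  -- On the torus the logarithmic form has neither zeros nor poles, and no divisor meeting it is
  -- exceptional, so `div(h) = 0` there near the chosen point.
  have hordtorus : ∀ p : coneScheme (⊥ : PointedCone ℝ (Fin d → ℝ)), Order.coheight p = 1 →
      coneMap (bot_le : ⊥ ≤ τ) p ⤳ divPoint hvτ →
      Scheme.ord h (A'.chart ⊥ Δ'.bot_mem p) = 0 := by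
    intro p hp hsp
    have hnI : A'.chart ⊥ Δ'.bot_mem p ∉ I := fun hmem =>
      not_mem_torus_of_isExceptionalPrime A A' hρ ((hI _).mp hmem) ⟨p, rfl⟩
    obtain ⟨m, hm, hmf⟩ := hf (A'.chart ⊥ Δ'.bot_mem p)
      (by rw [coheight_eq_of_isOpenImmersion (A'.chart ⊥ Δ'.bot_mem)]; exact hp) (by
        rw [hρ.apply_chart A A' Δ'.bot_mem hτ bot_le]
        exact hsp.map (A.chart τ hτ).continuous)
    have h1 := hg ⊥ Δ'.bot_mem b ∅ (by rw [Set.image_empty, latticeCone_empty]) p m hm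
    rw [Finset.sum_eq_zero fun j _ => ord_torusChar_torus A' p _, sub_zero] at h1
    rw [if_neg hnI, mul_zero, add_zero, h1] at hmf
    rw [hord]
    have : (r : ℤ) * Scheme.ord g (A'.chart ⊥ Δ'.bot_mem p) =
      Scheme.ord f (A'.chart ⊥ Δ'.bot_mem p) := by exact_mod_cast hmf
    omega
  have hinj := chartRat_injective (A'.chart ⊥ Δ'.bot_mem)
  have hκ0 : ∀ {P : ConeRing (⊥ : PointedCone ℝ (Fin d → ℝ))}, P ≠ 0 →
      chartRat (A'.chart ⊥ Δ'.bot_mem) P ≠ 0 := fun hP h => hP (hinj (h.trans (map_zero _).symm))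
  have hnoeth := isNoetherianRing_coneRing A' Δ'.bot_mem
  have hq : (divPoint hvτ).asIdeal.IsPrime := PrimeSpectrum.isPrime _
  -- Any poles of `h` on the torus lie over divisors not passing through the chosen point of `U_τ`.
  -- As Laurent polynomials form a factorial ring, multiplying by some `G` regular on `U_τ` and
  -- nonzero at that point gives a Laurent polynomial `P`.
  obtain ⟨G, hG, P, hGP⟩ := exists_mul_eq_of_forall_prime
    (chartRat (A'.chart ⊥ Δ'.bot_mem)) hinj (coneRingHom (bot_le : ⊥ ≤ τ))
    (divPoint hvτ).asIdeal (h := h) (by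
      obtain ⟨P, Q, hQ, hPQ⟩ := chartRat_surj (A'.chart ⊥ Δ'.bot_mem) h
      exact ⟨P, Q, hQ, hPQ⟩) fun π hπ hπq P Q hQ hPQ hπQ => by
    let p : coneScheme (⊥ : PointedCone ℝ (Fin d → ℝ)) :=
      ⟨Ideal.span {π}, (Ideal.span_singleton_prime hπ.ne_zero).mpr hπ⟩
    have hp1 : Order.coheight (A'.chart ⊥ Δ'.bot_mem p) = 1 :=
      coheight_eq_one (A'.chart ⊥ Δ'.bot_mem) (p := p) (x := π) rfl hπ.ne_zero
    have h1 := hordtorus p (by rwa [coheight_eq_of_isOpenImmersion (A'.chart ⊥ Δ'.bot_mem)] at hp1)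
      ((PrimeSpectrum.le_iff_specializes _ _).mp fun r hr => hπq r (Ideal.mem_span_singleton.mp hr))
    by_contra hπP
    have hP0 : P ≠ 0 := by
      rintro rfl
      exact hπP (dvd_zero π)
    rw [hPQ, ord_div (hκ0 hP0) (hκ0 hQ)] at h1
    have h2 := ord_chartRat_of_not_mem (A'.chart ⊥ Δ'.bot_mem) (p := p) (b := P)
      fun hmem => hπP (Ideal.mem_span_singleton.mp hmem)
    have h3 := ord_chartRat_pos (A'.chart ⊥ Δ'.bot_mem) (p := p) hp1
      (b := Q) (Ideal.mem_span_singleton.mpr hπQ) hQ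
    omega
  have hG0 : G ≠ 0 := by
    rintro rfl
    exact hG (zero_mem _)
  have hGne : chartRat (A'.chart ⊥ Δ'.bot_mem) (coneRingHom (bot_le : ⊥ ≤ τ) G) ≠ 0 :=
    hκ0 ((map_ne_zero_iff _ (coneRingHom_injective _)).mpr hG0)
  have hP0 : P ≠ 0 := by
    rintro rfl
    rw [map_zero] at hGP
    exact mul_ne_zero hh0 hGne hGP
  have hordG : ∀ {w : Fin d → ℤ} (hw : latticeCone {w} ∈ Δ'.cones) (hle : latticeCone {w} ≤ τ),
      G ∉ (divPoint (hle (toReal_mem_ray w))).asIdeal →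
      Scheme.ord (chartRat (A'.chart ⊥ Δ'.bot_mem) P)
        (A'.chart _ hw (divPoint (toReal_mem_ray w))) =
      Scheme.ord h (A'.chart _ hw (divPoint (toReal_mem_ray w))) := by
    intro w hw hle hGw
    rw [← hGP, Scheme.ord_mul hh0 hGne]
    have h1 := ord_chartRat_of_not_mem (A'.chart _ hw) (p := divPoint (toReal_mem_ray w))
      (b := coneRingHom hle G) fun hmem => hGw ((coneRingHom_mem_divPoint hle _).mp hmem)
    have h2 : coneRingHom (bot_le : ⊥ ≤ latticeCone {w}) (coneRingHom hle G) =
        coneRingHom (bot_le : ⊥ ≤ τ) G :=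
      RingHom.congr_fun (f := (coneRingHom bot_le).comp (coneRingHom hle))
        (AddMonoidAlgebra.ringHom_ext
          (fun r => by rw [RingHom.comp_apply, coneRingHom_single, coneRingHom_single,
            coneRingHom_single]; rfl)
          fun m => by rw [RingHom.comp_apply, coneRingHom_single, coneRingHom_single,
            coneRingHom_single]; rfl) G
    rw [← h2, chartRat_coneRingHom A' hw Δ'.bot_mem bot_le, h1, add_zero]
  -- The exceptional vector `b k` is a nonnegative combination of rays belonging to both fans;
  -- divisors of such rays are not exceptional and their discrepancy term is zero.
  obtain ⟨T, hT, hTray⟩ := hΔ.exists_extremal_generators hτ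
  obtain ⟨c, hc, hcv⟩ := exists_nonneg_combination (T := T) (hT ▸ hvτ)
  have hcomb : ∀ m : Fin d → ℤ, (intPairing m (b k) : ℝ) = ∑ w ∈ T, c w * (intPairing m w : ℝ) :=
    fun m => by
      rw [← pairing_toReal, hcv, pairing, Finset.sum_congr rfl fun i _ => congrArg _
        (Finset.sum_apply i T _), Finset.sum_congr rfl fun i _ => Finset.mul_sum T _ _,
        Finset.sum_comm]
      refine Finset.sum_congr rfl fun w _ => ?_
      rw [← pairing_toReal, pairing, Finset.mul_sum]
      refine Finset.sum_congr rfl fun i _ => ?_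
      rw [Pi.smul_apply, smul_eq_mul]
      ring
  have hleT : ∀ w ∈ T, latticeCone {w} ≤ τ := fun w hw =>
    hT ▸ latticeCone_mono (Set.singleton_subset_iff.mpr (Finset.mem_coe.mpr hw))
  -- If `w` occurs in the combination, a character of `τ` positive on `w` is positive on `b k`. So
  -- the divisor point of `w` specializes to that of `b k`, which makes `f` usable at `w` and keeps
  -- `G` nonzero there.
  have hpos : ∀ w ∈ T, ∀ m : dualMonoid τ, 0 < c w → 0 < intPairing m w →
      0 < intPairing m (b k) := fun w hw m hcw hmw => by
    have h1 : (0 : ℝ) < intPairing m (b k) := by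
      rw [hcomb]
      refine Finset.sum_pos' (fun u hu => mul_nonneg (hc u) ?_) ⟨w, hw, mul_pos hcw ?_⟩
      · exact_mod_cast intPairing_nonneg (hleT u hu (toReal_mem_ray u)) m
      · exact_mod_cast hmw
    exact_mod_cast h1
  have hPT : ∀ w ∈ T, 0 < c w → ∀ m ∈ P.coeff.support, 0 < intPairing m w := by
    intro w hw hcw
    obtain ⟨⟨hw', bw, j, rfl⟩, hwΔ⟩ := hTray w hw
    refine intPairing_pos_of_ord_pos A' hw' ?_
    have hspec : ρ (A'.chart _ hw' (divPoint (toReal_mem_ray (bw j)))) ⤳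
        A.chart τ hτ (divPoint hvτ) := by
      rw [hray hw' (hleT _ hw)]
      refine Specializes.map ((PrimeSpectrum.le_iff_specializes _ _).mp fun r hr => ?_)
        (A.chart τ hτ).continuous
      rw [mem_divPoint] at hr ⊢
      exact fun m hm => hpos _ hw m hcw (hr m hm)
    rw [hordG hw' (hleT _ hw) fun hmem => hG ?_]
    · have h1 := hordray bw j hw' hspec
      rw [if_neg fun hmem => not_isExceptionalPrime_of_mem_cones A A' hρ hw' hwΔ _
        ((hI _).mp hmem), zero_add, mul_one] at h1
      have h2 : Scheme.ord h (A'.chart _ hw' (divPoint (toReal_mem_ray (bw j)))) = r := by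
        exact_mod_cast h1
      rw [h2]
      exact_mod_cast hr
    · rw [mem_divPoint] at hmem ⊢
      exact fun m hm => hpos _ hw m hcw (hmem m hm)
  -- Not all coefficients vanish, since the `k`-th dual vector takes the value `1` on `b k`.
  obtain ⟨w₀, hw₀, hcw₀⟩ : ∃ w ∈ T, 0 < c w := by
    by_contra! hcon
    have h1 := hcomb (dualBasis b k)
    rw [intPairing_dualBasis, Pi.single_eq_same, Finset.sum_eq_zero fun w hw => by
      rw [le_antisymm (hcon w hw) (hc w), zero_mul]] at h1
    simp at h1
  -- Positivity of the exponents on all rays that occur passes to their positive combination `b k`.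
  -- This argument with supports takes the place of choosing `h` to be a character.
  have hPv : ∀ m ∈ P.coeff.support, 0 < intPairing m (b k) := fun m hm => by
    have h1 : (0 : ℝ) < intPairing m (b k) := by
      rw [hcomb]
      have h2 : ∀ u ∈ T, 0 < c u → (0 : ℝ) < c u * intPairing m u := fun u hu hcu =>
        mul_pos hcu (by exact_mod_cast hPT u hu hcu m hm)
      refine Finset.sum_pos' (fun u hu => ?_) ⟨w₀, hw₀, h2 w₀ hw₀ hcw₀⟩
      rcases (hc u).eq_or_lt with h3 | h3
      · rw [← h3, zero_mul]
      · exact (h2 u hu h3).le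
    exact_mod_cast h1
  have hordP : 0 < Scheme.ord (chartRat (A'.chart ⊥ Δ'.bot_mem) P)
      (A'.chart _ hk (divPoint (toReal_mem_ray (b k)))) := by
    obtain ⟨P', hP'⟩ := exists_coneRingHom_eq (bot_le : ⊥ ≤ latticeCone {b k}) (f := P)
      fun m hm => pairing_nonneg_on_latticeCone.mpr (by simpa using (hPv m hm).le)
    have hP'0 : P' ≠ 0 := by
      rintro rfl
      exact hP0 (by rw [← hP', map_zero])
    rw [← hP', chartRat_coneRingHom A' hk Δ'.bot_mem bot_le]
    refine ord_chartRat_pos (A'.chart _ hk) ((hI _).mp hyI).1 ?_ hP'0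
    exact (mem_divPoint _).mpr fun m hm =>
      hPv _ (hP' ▸ (mem_support_coneRingHom bot_le).mpr ⟨m, hm, rfl⟩)
  rw [hordG hk hkτ hG] at hordP
  have h1 := hordray b k hk (by rw [hray hk hkτ])
  rw [if_pos hyI] at h1
  have h2 : (0 : ℚ) < r * (disc (A'.chart _ hk (divPoint (toReal_mem_ray (b k)))) + 1) := by
    rw [← h1]
    exact_mod_cast hordP
  exact (pos_iff_pos_of_mul_pos h2).mp (by exact_mod_cast hr)

end

end Stringy

/-! ### The theorem -/

open Stringy in
theorem mainTheorem2 {d : ℕ} (Δ Δ' : Fan d) (hΔ : Δ'.IsRegularSubdivision Δ)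
    (X X' : CVariety) (A : ToricAtlas Δ X) (A' : ToricAtlas Δ' X')
    (ρ : X'.X ⟶ X.X) (hρ : IsToricMorphism A' A ρ)
    (I : Finset X'.X) (hI : ∀ y, y ∈ I ↔ IsExceptionalPrime ρ y)
    (disc : X'.X → ℚ) (hdisc : IsRelativeCanonical ρ I disc)
    (E : K0 →+ MvPolynomial (Fin 2) ℤ) (hE : IsEPolynomial E)
    (φ : ℤ → ℤ → MotivicInvariant) (a b : ℤ) (hab : (a, b) ≠ (0, 0))
    (hφ : IsOfType φ a b) (hφb : IsBounded φ) :
    SubstDefined a b (stringyE E X' I disc) ∧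
      stringyPhi φ a b X' I disc =
        subst a b (stringyE E X' I disc) *
          algebraMap Puiseux PuiseuxFrac (phiPoly φ CVariety.point) :=
  stringyPhi_eq_of_tate X' I disc
    (fun _ hJ => of_stratum_mem_range A hΔ A' hρ (fun y hy => (hI y).1 hy) hJ)
    (fun _ hj => (discrepancy_pos A A' hΔ hρ I hI disc hdisc hj).ne')
    E hE.point hE.prodAffine_one φ a b hab hφ hφb
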